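/- Let $n\in\mathbb N$, $M>0$, $T>0$. For $f$ on $\mathbb R^n$ put $\|f\|_{W^{k,p}}=\max_{j\le k}\|D^jf\|_{L^p}$ (weak derivatives, with $D^jf(x)$ measured in the operator norm of multilinear maps for the Euclidean norm), and $H^k=W^{k,2}$. Let $\mathcal A$ be the set of all $\alpha\in L^2([0,T];W^{3,\infty}(\mathbb R^n;\mathbb R^n)\cap H^1(\mathbb R^n;\mathbb R^n))$ (Bochner space) with $\|\alpha(\cdot,s)\|_{W^{3,\infty}}\le M$ and $\|\alpha(\cdot,s)\|_{H^1}\le M$ for a.e. $s\in[0,T]$; $\alpha(\cdot,s)$ is identified with its continuous representative. Then there is a constant $C>0$, depending only on $M,T,n$, such that the following holds for every $\alpha\in\mathcal A$. **Flow.** For every $t\in[0,T)$ and $x\in\mathbb R^n$ the problem $\partial_s\Phi_{t,s}(x)=\alpha(\Phi_{t,s}(x),s)$ for a.e. $s\in(t,T)$, $\Phi_{t,t}(x)=x$, has a unique (Carathéodory) solution on $[t,T]$. Each $\Phi_{t,s}$ is a bijection of $\mathbb R^n$; put $\Psi_{t,s}=\Phi_{t,s}^{-1}$. The maps $\Phi_{t,s},\Psi_{t,s}$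 are of class $C^2$, the functions $\det D\Phi_{t,s}$ and $J_{t,s}:=(\det D\Phi_{t,s})^{-1}$ are of class $C^1$ with weak second derivatives in $L^\infty$, and for all $t\in[0,T)$ and $s,s_1,s_2\in[t,T]$: 1. $\|\Phi_{t,s_1}-\Phi_{t,s_2}\|_{L^\infty}\le M|s_1-s_2|$; 2. $\|D\Phi_{t,s}\|_{L^\infty}\le e^{M(s-t)}$ and $\|D\Psi_{t,s}\|_{L^\infty}\le e^{M(s-t)}$; 3. $\|\Psi_{t,s_1}-\Psi_{t,s_2}\|_{L^\infty}\le Me^{MT}|s_1-s_2|$; 4. $\|D^2\Phi_{t,s}\|_{L^\infty}\le C$ and $\|D^2\Psi_{t,s}\|_{L^\infty}\le C$; 5. $e^{-nM(s-t)}\le\det D\Phi_{t,s}(x)\le e^{nM(s-t)}$ for all $x\in\mathbb R^n$; 6. $\|\nabla J_{t,s}\|_{L^\infty}\le C$ and $\|\nabla\det D\Phi_{t,s}\|_{L^\infty}\le C$; 7. $\|D^2J_{t,s}\|_{L^\infty}\le C$ and $\|D^2\det D\Phi_{t,s}\|_{L^\infty}\le C$. **Continuity equation.** For every $t\in[0,T)$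 and every locally integrable $\bar m:\mathbb R^n\to\mathbb R$, the function $$m(x,s)=\frac{\bar m(\Psi_{t,s}(x))}{\det D\Phi_{t,s}(\Psi_{t,s}(x))},\qquad x\in\mathbb R^n,\ s\in[t,T],$$ is the unique (up to null sets) distributional solution, among functions integrable on $K\times(t,T)$ for every compact $K\subset\mathbb R^n$, of $\partial_sm+\operatorname{div}(\alpha m)=0$ in $\mathbb R^n\times(t,T)$ with $m(\cdot,t)=\bar m$. If $\bar m\in W^{2,\infty}(\mathbb R^n)$, then for every $s\in[t,T]$, $m(\cdot,s)\in W^{2,\infty}(\mathbb R^n)$ and $$\|m(\cdot,s)\|_{W^{2,\infty}}\le C\,\|\bar m\|_{W^{2,\infty}};$$ if $\bar m\in H^2(\mathbb R^n)$, then for every $s\in[t,T]$, $m(\cdot,s)\in H^2(\mathbb R^n)$ and $$\|m(\cdot,s)\|_{H^2}\le C\,\|\bar m\|_{H^2}.$$ -/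

import Mathlib

open MeasureTheory Set Filter Topology
open scoped ENNReal ContDiff

/-- `ℝⁿ` with its Euclidean norm and Lebesgue measure. -/
abbrev Euc (n : ℕ) : Type := EuclideanSpace ℝ (Fin n)

/-- `g` is the weak (distributional) total derivative of `f`: both are locally integrable and
`∫ (∂_v φ) f = - ∫ φ (g · v)` for every test function `φ ∈ C_c^∞(ℝⁿ)` and every direction `v`. -/
structure IsWeakFDeriv {n : ℕ} {F : Type} [NormedAddCommGroup F] [NormedSpace ℝ F]
    (f : Euc n → F) (g : Euc n → (Euc n →L[ℝ] F)) : Prop where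
  locInt : LocallyIntegrable f volume
  locInt_deriv : LocallyIntegrable g volume
  integral_eq : ∀ φ : Euc n → ℝ, ContDiff ℝ ∞ φ → HasCompactSupport φ → ∀ v : Euc n,
    ∫ x, (fderiv ℝ φ x v) • f x = - ∫ x, φ x • g x v

/-- The (extended) Sobolev norm `‖f‖_{W^{k,p}} = max_{j ≤ k} ‖D^j f‖_{L^p}`, where `D^j f` is the
`j`-th weak derivative, a multilinear form measured pointwise in its operator norm.
Weak derivatives are unique up to null sets, so the infimum is over a single class; it is `∞`
if there is no weak derivative. -/
noncomputable def eSobolevNorm {n : ℕ} (p : ℝ≥0∞) :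
    (k : ℕ) → {F : Type} → [NormedAddCommGroup F] → [NormedSpace ℝ F] → (Euc n → F) → ℝ≥0∞
  | 0, _, _, _, f => eLpNorm f p volume
  | k + 1, F, _, _, f => max (eLpNorm f p volume)
      (⨅ g : {g : Euc n → (Euc n →L[ℝ] F) // IsWeakFDeriv f g}, eSobolevNorm p k g.1)

/-- Membership in `W^{k,p}(ℝⁿ; F)`; `H^k` is the case `p = 2`. -/
def MemSobolevW {n : ℕ} {F : Type} [NormedAddCommGroup F] [NormedSpace ℝ F]
    (k : ℕ) (p : ℝ≥0∞) (f : Euc n → F) : Prop :=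
  AEStronglyMeasurable f volume ∧ eSobolevNorm p k f < ⊤

/-- The norm of `W^{3,∞}(ℝⁿ;ℝⁿ) ∩ H¹(ℝⁿ;ℝⁿ)`. -/
noncomputable def controlNorm {n : ℕ} (a : Euc n → Euc n) : ℝ≥0∞ :=
  max (eSobolevNorm ⊤ 3 a) (eSobolevNorm 2 1 a)

/-- Membership in `W^{3,∞}(ℝⁿ;ℝⁿ) ∩ H¹(ℝⁿ;ℝⁿ)`. -/
def MemControlSpace {n : ℕ} (a : Euc n → Euc n) : Prop :=
  MemSobolevW 3 ⊤ a ∧ MemSobolevW 1 2 a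

/-- `α ∈ L²([0,T], W^{3,∞} ∩ H¹)` in the sense of Bochner: `α` takes values in the space for a.e.
time, is the a.e. limit in norm of simple functions with values in the space, and its norm is
square integrable. -/
structure IsBochnerL2 {n : ℕ} (T : ℝ) (α : ℝ → Euc n → Euc n) : Prop where
  mem : ∀ᵐ s ∂(volume.restrict (Icc 0 T)), MemControlSpace (α s)
  stronglyMeasurable : ∃ A : ℕ → SimpleFunc ℝ (Euc n → Euc n),
    (∀ k s, MemControlSpace (A k s)) ∧
    ∀ᵐ s ∂(volume.restrict (Icc 0 T)),
      Tendsto (fun k => controlNorm (fun x => A k s x - α s x)) atTop (𝓝 0)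
  sq_integrable : ∫⁻ s in Icc 0 T, controlNorm (α s) ^ 2 < ⊤

/-- The class `𝒜` of admissible velocity fields `α(x,s)`, written `α s x`.
The field `α(·,s)`, an element of `W^{3,∞}`, is identified with its continuous representative, so
that the flow equation makes sense pointwise. -/
structure IsAdmissibleControl {n : ℕ} (M T : ℝ) (α : ℝ → Euc n → Euc n) : Prop where
  bochner : IsBochnerL2 T α
  bound : ∀ᵐ s ∂(volume.restrict (Icc 0 T)),
    eSobolevNorm ⊤ 3 (α s) ≤ ENNReal.ofReal M ∧ eSobolevNorm 2 1 (α s) ≤ ENNReal.ofReal M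
  continuous_rep : ∀ᵐ s ∂(volume.restrict (Icc 0 T)), Continuous (α s)

/-- `Φ t s x` is the position at time `s ∈ [t,T]` of the particle started at time `t` from `x`:
`s ↦ Φ t s x` is a Carathéodory solution of `∂_s Φ = α(Φ,s)`, `Φ(t) = x`, on `[t,T]`. -/
def IsFlow {n : ℕ} (T : ℝ) (α : ℝ → Euc n → Euc n) (Φ : ℝ → ℝ → Euc n → Euc n) : Prop :=
  ∀ t ∈ Ico 0 T, ∀ x : Euc n,
    IntervalIntegrable (fun τ => α τ (Φ t τ x)) volume t T ∧
    ∀ s ∈ Icc t T, Φ t s x = x + ∫ τ in t..s, α τ (Φ t τ x)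

/-- `u` is a (locally integrable) distributional solution of
`∂_s u + div(α u) = 0` on `ℝⁿ × (t,T)` with `u(·,t) = mbar`. Note that
`fderiv ℝ φ (s,x) (1, α s x) = ∂_s φ + α · ∇φ`. -/
structure IsDistributionalSolution {n : ℕ} (T : ℝ) (α : ℝ → Euc n → Euc n) (t : ℝ)
    (mbar : Euc n → ℝ) (u : ℝ → Euc n → ℝ) : Prop where
  locInt : ∀ K : Set (Euc n), IsCompact K →
    IntegrableOn (fun z : ℝ × Euc n => u z.1 z.2) (Ioo t T ×ˢ K) volume
  weak_eq : ∀ φ : ℝ × Euc n → ℝ, ContDiff ℝ ∞ φ → HasCompactSupport φ →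
    tsupport φ ⊆ Iio T ×ˢ univ →
    (∫ z in Ioo t T ×ˢ (univ : Set (Euc n)), u z.1 z.2 * fderiv ℝ φ z (1, α z.1 z.2))
      + ∫ x, mbar x * φ (t, x) = 0

/-- The Jacobian determinant `det D F (x)`. -/
noncomputable def jacobianDet {n : ℕ} (F : Euc n → Euc n) (x : Euc n) : ℝ :=
  (fderiv ℝ F x).det

/-- The density `m̄(Ψ_{t,s}(x)) / det DΦ_{t,s}(Ψ_{t,s}(x))` transported by the flow `Φ` with
inverse `Ψ`, as a function of `s` and `x`. -/
noncomputable def transportedDensity {n : ℕ} (Φ Ψ : ℝ → ℝ → Euc n → Euc n) (t : ℝ)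
    (mbar : Euc n → ℝ) (s : ℝ) (x : Euc n) : ℝ :=
  mbar (Ψ t s x) / jacobianDet (Φ t s) (Ψ t s x)

/-- `f` is continuously differentiable with `|∇f| ≤ C` everywhere, and its gradient has a weak
derivative `D²f` with `‖D²f‖_{L^∞} ≤ C`. -/
def HasBoundedDerivsTwo {n : ℕ} (C : ℝ) (f : Euc n → ℝ) : Prop :=
  ContDiff ℝ 1 f ∧ (∀ x, ‖fderiv ℝ f x‖ ≤ C) ∧
  ∃ H : Euc n → (Euc n →L[ℝ] Euc n →L[ℝ] ℝ),
    IsWeakFDeriv (fderiv ℝ f) H ∧ eLpNorm H ⊤ volume ≤ ENNReal.ofReal C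

set_option linter.unusedSectionVars false

/-! ### Mollification -/

section Mollification

open scoped Convolution

variable {V : Type*} [NormedAddCommGroup V] [NormedSpace ℝ V] [FiniteDimensional ℝ V]
  [MeasurableSpace V] [BorelSpace V] {μ : Measure V} [μ.IsAddHaarMeasure]
  {F : Type*} [NormedAddCommGroup F] [NormedSpace ℝ F] [CompleteSpace F]

/-- `g` is the weak derivative of `f` with respect to the measure `μ`. -/
structure HasWeakFDeriv (μ : Measure V) (f : V → F) (g : V → V →L[ℝ] F) : Prop where
  locInt : LocallyIntegrable f μ
  locInt_deriv : LocallyIntegrable g μ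
  integral_eq : ∀ φ : V → ℝ, ContDiff ℝ ∞ φ → HasCompactSupport φ → ∀ v : V,
    ∫ x, (fderiv ℝ φ x v) • f x ∂μ = - ∫ x, φ x • g x v ∂μ

/-- The bump function of radius `1 / (k + 1)`. -/
noncomputable def mollBump (V : Type*) [NormedAddCommGroup V] (k : ℕ) : ContDiffBump (0 : V) where
  rIn := ((k : ℝ) + 1)⁻¹ / 2
  rOut := ((k : ℝ) + 1)⁻¹
  rIn_pos := by positivity
  rIn_lt_rOut := half_lt_self (by positivity)

/-- The mollification of `f` at scale `1 / (k + 1)`. -/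
noncomputable def moll (μ : Measure V) (k : ℕ) (f : V → F) : V → F :=
  (mollBump V k).normed μ ⋆[ContinuousLinearMap.lsmul ℝ ℝ, μ] f

theorem moll_apply (k : ℕ) (f : V → F) (x : V) :
    moll μ k f x = ∫ y, (mollBump V k).normed μ (x - y) • f y ∂μ :=
  convolution_lsmul_swap

theorem tendsto_mollBump_rOut : Tendsto (fun k => (mollBump V k).rOut) atTop (𝓝 0) :=
  tendsto_inv_atTop_zero.comp (tendsto_natCast_atTop_atTop.atTop_add tendsto_const_nhds)

theorem moll_ae_tendsto {f : V → F} (hf : LocallyIntegrable f μ) :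
    ∀ᵐ x ∂μ, Tendsto (fun k => moll μ k f x) atTop (𝓝 (f x)) :=
  ContDiffBump.ae_convolution_tendsto_right_of_locallyIntegrable (K := 2) tendsto_mollBump_rOut
    (Eventually.of_forall fun k => by simp only [mollBump]; linarith) hf

theorem moll_contDiff {f : V → F} (hf : LocallyIntegrable f μ) (k : ℕ) :
    ContDiff ℝ ∞ (moll μ k f) :=
  (mollBump V k).hasCompactSupport_normed.contDiff_convolution_left _
    (mollBump V k).contDiff_normed hf

theorem moll_integrand_integrable {f : V → F} (hf : LocallyIntegrable f μ) (k : ℕ) (x : V) :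
    Integrable (fun y => (mollBump V k).normed μ (x - y) • f y) μ :=
  ((mollBump V k).hasCompactSupport_normed.convolutionExists_left
    (ContinuousLinearMap.lsmul ℝ ℝ) (mollBump V k).continuous_normed hf x).integrable_swap

theorem moll_integral_kernel (k : ℕ) (x : V) :
    ∫ y, (mollBump V k).normed μ (x - y) ∂μ = 1 := by
  rw [integral_sub_left_eq_self (fun y => (mollBump V k).normed μ y)]
  exact (mollBump V k).integral_normed

theorem moll_norm_le {f : V → F} {C : ℝ}
    (hC : ∀ᵐ x ∂μ, ‖f x‖ ≤ C) (k : ℕ) (x : V) : ‖moll μ k f x‖ ≤ C := by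
  rw [moll_apply]
  have h1 : Integrable (fun y => (mollBump V k).normed μ (x - y)) μ :=
    (mollBump V k).integrable_normed.comp_sub_left x
  calc ‖∫ y, (mollBump V k).normed μ (x - y) • f y ∂μ‖
      ≤ ∫ y, (mollBump V k).normed μ (x - y) * C ∂μ := by
        refine norm_integral_le_of_norm_le (h1.mul_const C) ?_
        filter_upwards [hC] with y hy
        rw [norm_smul, Real.norm_of_nonneg ((mollBump V k).nonneg_normed _)]
        exact mul_le_mul_of_nonneg_left hy ((mollBump V k).nonneg_normed _)
    _ = C := by rw [integral_mul_const, moll_integral_kernel, one_mul]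

theorem moll_dist_le_of_lipschitz {f : V → F} {L : NNReal} (hf : LipschitzWith L f) (k : ℕ)
    (x : V) : ‖moll μ k f x - f x‖ ≤ L * ((k : ℝ) + 1)⁻¹ := by
  rw [← dist_eq_norm]
  refine ContDiffBump.dist_normed_convolution_le hf.continuous.aestronglyMeasurable
    fun y hy => (hf.dist_le_mul y x).trans ?_
  gcongr
  exact (Metric.mem_ball.1 hy).le

theorem moll_eq_zero {f : V → F} {k : ℕ} {x : V}
    (h : ∀ y ∈ Metric.ball x ((k : ℝ) + 1)⁻¹, f y = 0) : moll μ k f x = 0 := by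
  rw [moll_apply]
  refine integral_eq_zero_of_ae (Eventually.of_forall fun y => ?_)
  by_cases hy : y ∈ Metric.ball x ((k : ℝ) + 1)⁻¹
  · simp [h y hy]
  · have : (mollBump V k).normed μ (x - y) = 0 := by
      rw [← Function.notMem_support, ContDiffBump.support_normed_eq]
      rw [Metric.mem_ball, dist_comm, dist_eq_norm] at hy
      rwa [mem_ball_zero_iff]
    simp [this]

theorem moll_sub {f g : V → F} (hf : LocallyIntegrable f μ) (hg : LocallyIntegrable g μ)
    (k : ℕ) (x : V) : moll μ k (fun y => f y - g y) x = moll μ k f x - moll μ k g x := by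
  simp only [moll_apply, smul_sub]
  exact integral_sub (moll_integrand_integrable hf k x) (moll_integrand_integrable hg k x)

theorem moll_fderiv {f : V → F} {g : V → V →L[ℝ] F} (h : HasWeakFDeriv μ f g) (k : ℕ) (x : V) :
    fderiv ℝ (moll μ k f) x = moll μ k g x := by
  set ρ := (mollBump V k).normed μ with hρ
  have hρ1 : ContDiff ℝ ∞ ρ := (mollBump V k).contDiff_normed
  have hρc : HasCompactSupport ρ := (mollBump V k).hasCompactSupport_normed
  have hd := hρc.hasFDerivAt_convolution_left (ContinuousLinearMap.lsmul ℝ ℝ : ℝ →L[ℝ] F →L[ℝ] F)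
    (hρ1.of_le (by simp)) h.locInt x
  have : fderiv ℝ (moll μ k f) x = _ := hd.fderiv
  rw [this]
  ext v
  have hi : Integrable (fun t => (((ContinuousLinearMap.lsmul ℝ ℝ : ℝ →L[ℝ] F →L[ℝ] F).precompL V)
      (fderiv ℝ ρ (x - t))) (f t)) μ :=
    ((hρc.fderiv ℝ).convolutionExists_left _
      (hρ1.continuous_fderiv (by simp)) h.locInt x).integrable_swap
  rw [convolution_eq_swap, ContinuousLinearMap.integral_apply hi, moll_apply,
    ContinuousLinearMap.integral_apply (moll_integrand_integrable h.locInt_deriv k x)]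
  have hφ := h.integral_eq (fun y => ρ (x - y)) (hρ1.comp (contDiff_const.sub contDiff_id))
    (hρc.comp_homeomorph (Homeomorph.subLeft x)) v
  have hfd : ∀ y, fderiv ℝ (fun y => ρ (x - y)) y v = - fderiv ℝ ρ (x - y) v := by
    intro y
    have h1 := ((hρ1.differentiable (by simp)) (x - y)).hasFDerivAt.comp y
      ((hasFDerivAt_id y).const_sub x)
    have h2 : HasFDerivAt (fun y => ρ (x - y)) _ y := h1
    rw [h2.fderiv]; simp
  simp only [hfd, neg_smul, integral_neg, neg_inj] at hφ
  simpa [ContinuousLinearMap.precompL_apply] using hφ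

/-- Convergence in `L¹` on compact sets. -/
def TendstoL1Loc (μ : Measure V) (u : ℕ → V → F) (f : V → F) : Prop :=
  ∀ K : Set V, IsCompact K → Tendsto (fun k => ∫⁻ x in K, ‖u k x - f x‖ₑ ∂μ) atTop (𝓝 0)

theorem lintegral_moll_le {f : V → F} (hf : Integrable f μ) (k : ℕ) :
    ∫⁻ x, ‖moll μ k f x‖ₑ ∂μ ≤ ∫⁻ x, ‖f x‖ₑ ∂μ := by
  have hm : Integrable (moll μ k f) μ :=
    (mollBump V k).integrable_normed.integrable_convolution _ hf
  have hn : Integrable (moll μ k (fun x => ‖f x‖)) μ :=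
    (mollBump V k).integrable_normed.integrable_convolution _ hf.norm
  rw [← ofReal_integral_norm_eq_lintegral_enorm hm, ← ofReal_integral_norm_eq_lintegral_enorm hf]
  refine ENNReal.ofReal_le_ofReal ?_
  have h1 : ∫ x, moll μ k (fun x => ‖f x‖) x ∂μ = ∫ x, ‖f x‖ ∂μ := by
    have := integral_convolution (ContinuousLinearMap.lsmul ℝ ℝ : ℝ →L[ℝ] ℝ →L[ℝ] ℝ)
      ((mollBump V k).integrable_normed (μ := μ)) hf.norm
    rw [ContDiffBump.integral_normed] at this
    simpa [moll] using this
  rw [← h1]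
  refine integral_mono hm.norm hn fun x => ?_
  simp only [moll_apply]
  refine norm_integral_le_of_norm_le
    (moll_integrand_integrable hf.norm.locallyIntegrable k x) (Eventually.of_forall fun y => ?_)
  rw [norm_smul, Real.norm_of_nonneg ((mollBump V k).nonneg_normed _), smul_eq_mul]

theorem moll_tendstoL1Loc {f : V → F} (hf : LocallyIntegrable f μ) :
    TendstoL1Loc μ (fun k => moll μ k f) f := by
  intro K hK
  set K1 := Metric.cthickening 1 K with hK1
  have hK1c : IsCompact K1 := hK.cthickening
  set f1 := K1.indicator f with hf1
  have hf1i : Integrable f1 μ :=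
    (integrable_indicator_iff hK1c.measurableSet).2 (hf.integrableOn_isCompact hK1c)
  have hKK1 : K ⊆ K1 := Metric.self_subset_cthickening _
  have hmoll : ∀ k, ∀ x ∈ K, moll μ k f x = moll μ k f1 x := by
    intro k x hx
    rw [← sub_eq_zero, ← moll_sub hf hf1i.locallyIntegrable]
    refine moll_eq_zero fun y hy => ?_
    have : y ∈ K1 := by
      refine Metric.mem_cthickening_of_dist_le y x 1 K hx ((Metric.mem_ball.1 hy).le.trans ?_)
      exact inv_le_one_of_one_le₀ (by linarith [(Nat.cast_nonneg k : (0 : ℝ) ≤ k)])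
    simp [hf1, this]
  rw [ENNReal.tendsto_nhds_zero]
  intro ε hε
  obtain ⟨δ, hδ, hδε⟩ : ∃ δ : ℝ, 0 < δ ∧ ENNReal.ofReal δ + ENNReal.ofReal δ + ENNReal.ofReal δ ≤ ε := by
    rcases eq_or_ne ε ⊤ with rfl | hε'
    · exact ⟨1, one_pos, le_top⟩
    · have hp : 0 < ε.toReal := ENNReal.toReal_pos hε.ne' hε'
      refine ⟨ε.toReal / 3, by positivity, ?_⟩
      rw [← ENNReal.ofReal_add (by positivity) (by positivity),
        ← ENNReal.ofReal_add (by positivity) (by positivity)]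
      exact ENNReal.ofReal_le_of_le_toReal (by linarith)
  obtain ⟨h, hhc, hh, hcont, hhi⟩ := hf1i.exists_hasCompactSupport_integral_sub_le hδ
  obtain ⟨C, hC⟩ := hcont.bounded_above_of_compact_support hhc
  have hlow : ∫⁻ x, ‖f1 x - h x‖ₑ ∂μ ≤ ENNReal.ofReal δ := by
    have := ofReal_integral_norm_eq_lintegral_enorm (hf1i.sub hhi)
    simp only [Pi.sub_apply] at this
    rw [← this]
    exact ENNReal.ofReal_le_ofReal hh
  have hconv : Tendsto (fun k => ∫⁻ x in K, ‖moll μ k h x - h x‖ₑ ∂μ) atTop (𝓝 0) := by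
    have : (0 : ℝ≥0∞) = ∫⁻ x in K, 0 ∂μ := by simp
    rw [this]
    refine tendsto_lintegral_of_dominated_convergence (fun _ => ENNReal.ofReal (C + C)) ?_ ?_ ?_ ?_
    · intro k
      exact ((moll_contDiff hhi.locallyIntegrable k).continuous.sub hcont).enorm.measurable
    · intro k
      refine Eventually.of_forall fun x => ?_
      change ‖moll μ k h x - h x‖ₑ ≤ _
      rw [← ofReal_norm]
      refine ENNReal.ofReal_le_ofReal ((norm_sub_le _ _).trans (add_le_add ?_ (hC x)))
      exact moll_norm_le (Eventually.of_forall hC) k x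
    · simpa using ENNReal.mul_ne_top ENNReal.ofReal_ne_top hK.measure_lt_top.ne
    · refine Eventually.of_forall fun x => ?_
      have := ContDiffBump.convolution_tendsto_right_of_continuous (μ := μ)
        (tendsto_mollBump_rOut (V := V)) hcont x
      have h2 : Tendsto (fun k => ‖moll μ k h x - h x‖ₑ) atTop (𝓝 ‖h x - h x‖ₑ) :=
        (this.sub_const (h x)).enorm
      simpa using h2
  filter_upwards [(ENNReal.tendsto_nhds_zero.1 hconv) (ENNReal.ofReal δ) (by simpa using hδ)]
    with k hk
  refine le_trans ?_ hδε
  calc ∫⁻ x in K, ‖moll μ k f x - f x‖ₑ ∂μ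
      ≤ ∫⁻ x in K, (‖moll μ k (fun y => f1 y - h y) x‖ₑ + ‖moll μ k h x - h x‖ₑ
          + ‖f1 x - h x‖ₑ) ∂μ := by
        refine setLIntegral_mono_ae' hK.measurableSet (Eventually.of_forall fun x hx => ?_)
        have e : moll μ k f x - f x = moll μ k (fun y => f1 y - h y) x
            + (moll μ k h x - h x) - (f1 x - h x) := by
          rw [hmoll k x hx, moll_sub hf1i.locallyIntegrable hhi.locallyIntegrable]
          simp only [hf1, indicator_of_mem (hKK1 hx)]
          abel
        rw [e]
        exact enorm_sub_le.trans (add_le_add_left (enorm_add_le _ _) _)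
    _ ≤ ∫⁻ x in K, ‖moll μ k (fun y => f1 y - h y) x‖ₑ ∂μ
          + ∫⁻ x in K, ‖moll μ k h x - h x‖ₑ ∂μ + ∫⁻ x in K, ‖f1 x - h x‖ₑ ∂μ := by
        have m1 : Measurable fun x => ‖moll μ k (fun y => f1 y - h y) x‖ₑ :=
          (moll_contDiff (hf1i.sub hhi).locallyIntegrable k).continuous.enorm.measurable
        have m2 : Measurable fun x => ‖moll μ k h x - h x‖ₑ := 
          ((moll_contDiff hhi.locallyIntegrable k).continuous.sub hcont).enorm.measurable
        have m3 : Measurable fun x => ‖moll μ k (fun y => f1 y - h y) x‖ₑ + ‖moll μ k h x - h x‖ₑ :=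
          m1.add m2
        rw [lintegral_add_left m3, lintegral_add_left m1]
    _ ≤ _ := by
        refine add_le_add (add_le_add ?_ hk) ?_
        · exact (setLIntegral_le_lintegral _ _).trans
            ((lintegral_moll_le (hf1i.sub hhi) k).trans hlow)
        · exact (setLIntegral_le_lintegral _ _).trans hlow

end Mollification

/-! ### Weak derivatives -/

section WeakDerivatives

variable {V : Type*} [NormedAddCommGroup V] [NormedSpace ℝ V] [FiniteDimensional ℝ V]
  [MeasurableSpace V] [BorelSpace V] {μ : Measure V} [μ.IsAddHaarMeasure]
  {F : Type*} [NormedAddCommGroup F] [NormedSpace ℝ F] [CompleteSpace F]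
  {F₁ : Type*} [NormedAddCommGroup F₁] [NormedSpace ℝ F₁] [CompleteSpace F₁]
  {F₂ : Type*} [NormedAddCommGroup F₂] [NormedSpace ℝ F₂] [CompleteSpace F₂]

theorem LocallyIntegrable.continuous_smul {f : V → F} (hf : LocallyIntegrable f μ) {ψ : V → ℝ}
    (hψ : Continuous ψ) (hc : HasCompactSupport ψ) : Integrable (fun x => ψ x • f x) μ :=
  hf.integrable_smul_left_of_hasCompactSupport hψ hc

theorem LocallyIntegrable.clm_apply {g : V → V →L[ℝ] F} (hg : LocallyIntegrable g μ) (v : V) :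
    LocallyIntegrable (fun x => g x v) μ := by
  rw [locallyIntegrable_iff] at hg ⊢
  intro K hK
  exact (hg K hK).apply_continuousLinearMap v

theorem hasWeakFDeriv_of_contDiff {f : V → F} (hf : ContDiff ℝ 1 f) :
    HasWeakFDeriv μ f (fderiv ℝ f) where
  locInt := hf.continuous.locallyIntegrable
  locInt_deriv := (hf.continuous_fderiv (by simp)).locallyIntegrable
  integral_eq φ hφ hφc v := by
    have hd : Continuous fun x => fderiv ℝ φ x v :=
      (hφ.continuous_fderiv (by simp)).clm_apply continuous_const
    have hdc : HasCompactSupport fun x => fderiv ℝ φ x v := hφc.fderiv_apply ℝ v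
    have := integral_smul_fderiv_eq_neg_fderiv_smul_of_integrable (μ := μ) (f := φ) (g := f) (v := v)
      (LocallyIntegrable.continuous_smul hf.continuous.locallyIntegrable hd hdc)
      (LocallyIntegrable.continuous_smul (LocallyIntegrable.clm_apply
        (hf.continuous_fderiv (by simp)).locallyIntegrable v) hφ.continuous hφc)
      (LocallyIntegrable.continuous_smul hf.continuous.locallyIntegrable hφ.continuous hφc)
      (fun x _ => hφ.differentiable (by simp) x) (fun x _ => hf.differentiable (by simp) x)
    rw [this, neg_neg]

theorem TendstoL1Loc.clm_comp {u : ℕ → V → F₁} {f : V → F₁} (h : TendstoL1Loc μ u f)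
    (L : F₁ →L[ℝ] F) : TendstoL1Loc μ (fun k x => L (u k x)) (fun x => L (f x)) := by
  intro K hK
  have h1 := ENNReal.Tendsto.const_mul (a := ‖L‖ₑ) (h K hK) (Or.inr (by simp))
  rw [mul_zero] at h1
  refine tendsto_of_tendsto_of_tendsto_of_le_of_le tendsto_const_nhds h1 (fun _ => zero_le)
    fun k => ?_
  rw [← lintegral_const_mul' _ _ (by simp)]
  refine lintegral_mono fun x => ?_
  rw [← map_sub]
  exact L.le_opENorm _

theorem TendstoL1Loc.add {u w : ℕ → V → F} {f g : V → F} (hu : TendstoL1Loc μ u f)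
    (hw : TendstoL1Loc μ w g) (hm : ∀ k, AEStronglyMeasurable (u k) μ)
    (hf : AEStronglyMeasurable f μ) :
    TendstoL1Loc μ (fun k x => u k x + w k x) (fun x => f x + g x) := by
  intro K hK
  have h1 := (hu K hK).add (hw K hK)
  rw [add_zero] at h1
  refine tendsto_of_tendsto_of_tendsto_of_le_of_le tendsto_const_nhds h1 (fun _ => zero_le)
    fun k => ?_
  have hm' : AEMeasurable (fun x => ‖u k x - f x‖ₑ) (μ.restrict K) :=
    ((hm k).sub hf).enorm.restrict
  rw [← lintegral_add_left' hm']
  refine lintegral_mono fun x => ?_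
  dsimp only
  rw [add_sub_add_comm]
  exact enorm_add_le _ _

theorem TendstoL1Loc.integral_smul {u : ℕ → V → F} {f : V → F} (h : TendstoL1Loc μ u f)
    (hu : ∀ k, LocallyIntegrable (u k) μ) (hf : LocallyIntegrable f μ) {ψ : V → ℝ}
    (hψ : Continuous ψ) (hc : HasCompactSupport ψ) :
    Tendsto (fun k => ∫ x, ψ x • u k x ∂μ) atTop (𝓝 (∫ x, ψ x • f x ∂μ)) := by
  refine tendsto_integral_of_L1 _ (LocallyIntegrable.continuous_smul hf hψ hc).aestronglyMeasurable
    (Eventually.of_forall fun k => LocallyIntegrable.continuous_smul (hu k) hψ hc) ?_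
  obtain ⟨C, hC⟩ := hψ.bounded_above_of_compact_support hc
  have h1 := ENNReal.Tendsto.const_mul (a := ENNReal.ofReal C) (h _ hc.isCompact)
    (Or.inr ENNReal.ofReal_ne_top)
  rw [mul_zero] at h1
  refine tendsto_of_tendsto_of_tendsto_of_le_of_le tendsto_const_nhds h1 (fun _ => zero_le)
    fun k => ?_
  rw [← lintegral_const_mul' _ _ ENNReal.ofReal_ne_top,
    ← lintegral_indicator hc.isCompact.measurableSet]
  refine lintegral_mono fun x => ?_
  dsimp only
  by_cases hx : x ∈ tsupport ψ
  · rw [indicator_of_mem hx, ← smul_sub, enorm_smul]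
    gcongr
    rw [← ofReal_norm]
    exact ENNReal.ofReal_le_ofReal (hC x)
  · rw [indicator_of_notMem hx, image_eq_zero_of_notMem_tsupport hx]
    simp

theorem HasWeakFDeriv.of_tendsto {f : V → F} {g : V → V →L[ℝ] F} {u : ℕ → V → F}
    {w : ℕ → V → V →L[ℝ] F} (h : ∀ k, HasWeakFDeriv μ (u k) (w k)) (hu : TendstoL1Loc μ u f)
    (hw : TendstoL1Loc μ w g) (hf : LocallyIntegrable f μ) (hg : LocallyIntegrable g μ) :
    HasWeakFDeriv μ f g where
  locInt := hf
  locInt_deriv := hg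
  integral_eq φ hφ hφc v := by
    have h1 := hu.integral_smul (fun k => (h k).locInt) hf
      ((hφ.continuous_fderiv (by simp)).clm_apply continuous_const) (hφc.fderiv_apply ℝ v)
    have h2 := ((hw.clm_comp (ContinuousLinearMap.apply ℝ F v)).integral_smul
      (fun k => LocallyIntegrable.clm_apply (h k).locInt_deriv v)
      (LocallyIntegrable.clm_apply hg v) hφ.continuous hφc).neg
    refine tendsto_nhds_unique h1 (h2.congr fun k => ?_)
    exact ((h k).integral_eq φ hφ hφc v).symm

theorem LocallyIntegrable.bilin (B : F₁ →L[ℝ] F₂ →L[ℝ] F) {f : V → F₁} {b : V → F₂}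
    (hf : LocallyIntegrable f μ) (hb : AEStronglyMeasurable b μ) {C : ℝ}
    (hC : ∀ᵐ x ∂μ, ‖b x‖ ≤ C) : LocallyIntegrable (fun x => B (f x) (b x)) μ := by
  rw [locallyIntegrable_iff] at hf ⊢
  intro K hK
  exact B.integrable_of_bilin_of_bdd_right C (hf K hK) hb.restrict (ae_restrict_of_ae hC)

theorem TendstoL1Loc.bilin (B : F₁ →L[ℝ] F₂ →L[ℝ] F) {u : ℕ → V → F₁} {f : V → F₁}
    {w : ℕ → V → F₂} {b : V → F₂} (hu : TendstoL1Loc μ u f) (hf : LocallyIntegrable f μ)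
    (hum : ∀ k, AEStronglyMeasurable (u k) μ)
    (hw : ∀ k, AEStronglyMeasurable (w k) μ) (hb : AEStronglyMeasurable b μ)
    (hwb : ∀ᵐ x ∂μ, Tendsto (fun k => w k x) atTop (𝓝 (b x))) {C : ℝ}
    (hC : ∀ k, ∀ᵐ x ∂μ, ‖w k x‖ ≤ C) (hCb : ∀ᵐ x ∂μ, ‖b x‖ ≤ C) :
    TendstoL1Loc μ (fun k x => B (u k x) (w k x)) (fun x => B (f x) (b x)) := by
  intro K hK
  have e : (0 : ℝ≥0∞) = ‖B‖ₑ * ENNReal.ofReal C * 0 + 0 := by simp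
  have h1 := ENNReal.Tendsto.const_mul (a := ‖B‖ₑ * ENNReal.ofReal C) (hu K hK)
    (Or.inr (ENNReal.mul_ne_top (by simp) ENNReal.ofReal_ne_top))
  have h2 : Tendsto (fun k => ∫⁻ x in K, ‖B‖ₑ * ‖f x‖ₑ * ‖w k x - b x‖ₑ ∂μ) atTop (𝓝 0) := by
    have : (0 : ℝ≥0∞) = ∫⁻ x in K, 0 ∂μ := by simp
    rw [this]
    refine tendsto_lintegral_of_dominated_convergence'
      (fun x => ‖B‖ₑ * ‖f x‖ₑ * ENNReal.ofReal (C + C)) ?_ ?_ ?_ ?_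
    · intro k
      exact ((hf.aestronglyMeasurable.enorm.const_mul _).mul ((hw k).sub hb).enorm).restrict
    · intro k
      refine ae_restrict_of_ae ?_
      filter_upwards [hC k, hCb] with x hx hx'
      gcongr
      rw [← ofReal_norm]
      exact ENNReal.ofReal_le_ofReal ((norm_sub_le _ _).trans (add_le_add hx hx'))
    · rw [lintegral_mul_const' _ _ ENNReal.ofReal_ne_top, lintegral_const_mul' _ _ (by simp)]
      refine ENNReal.mul_ne_top (ENNReal.mul_ne_top (by simp) ?_) ENNReal.ofReal_ne_top
      exact (hf.integrableOn_isCompact hK).2.ne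
    · refine ae_restrict_of_ae ?_
      filter_upwards [hwb] with x hx
      have h3 : Tendsto (fun k => ‖w k x - b x‖ₑ) atTop (𝓝 ‖b x - b x‖ₑ) :=
        (hx.sub_const (b x)).enorm
      have h4 := ENNReal.Tendsto.const_mul (a := ‖B‖ₑ * ‖f x‖ₑ) h3
        (Or.inr (ENNReal.mul_ne_top (by simp) (by simp)))
      simpa using h4
  have h3 := h1.add h2
  rw [← e] at h3
  refine tendsto_of_tendsto_of_tendsto_of_le_of_le tendsto_const_nhds h3 (fun _ => zero_le)
    fun k => ?_
  have hm : AEMeasurable (fun x => ‖B‖ₑ * ENNReal.ofReal C * ‖u k x - f x‖ₑ) (μ.restrict K) :=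
    (((hum k).sub hf.aestronglyMeasurable).enorm.const_mul _).restrict
  rw [← lintegral_const_mul' _ _ (ENNReal.mul_ne_top (by simp) ENNReal.ofReal_ne_top),
    ← lintegral_add_left' hm]
  refine lintegral_mono_ae (ae_restrict_of_ae ?_)
  filter_upwards [hC k] with x hx
  have e2 : B (u k x) (w k x) - B (f x) (b x) = B (u k x - f x) (w k x) + B (f x) (w k x - b x) := by
    simp only [map_sub, sub_apply]; abel
  have hB : ∀ (y : F₁) (z : F₂), ‖B y z‖ₑ ≤ ‖B‖ₑ * ‖y‖ₑ * ‖z‖ₑ := fun y z =>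
    ((B y).le_opENorm z).trans (mul_le_mul_left (B.le_opENorm y) _)
  rw [e2]
  refine (enorm_add_le _ _).trans (add_le_add ((hB _ _).trans ?_) (hB _ _))
  rw [mul_right_comm]
  gcongr
  rw [← ofReal_norm]
  exact ENNReal.ofReal_le_ofReal hx

theorem moll_hasFDerivAt {f : V → F} {g : V → V →L[ℝ] F} (h : HasWeakFDeriv μ f g) (k : ℕ) (x : V) :
    HasFDerivAt (moll μ k f) (moll μ k g x) x := by
  rw [← moll_fderiv h k]
  exact ((moll_contDiff h.locInt k).differentiable (by simp) x).hasFDerivAt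

/-- The Leibniz rule for weak derivatives, one factor being bounded with bounded derivative. -/
theorem HasWeakFDeriv.bilin (B : F₁ →L[ℝ] F₂ →L[ℝ] F) {f : V → F₁} {g : V → V →L[ℝ] F₁}
    {b : V → F₂} {h : V → V →L[ℝ] F₂} (hf : HasWeakFDeriv μ f g) (hb : HasWeakFDeriv μ b h) {C : ℝ}
    (hC : ∀ᵐ x ∂μ, ‖b x‖ ≤ C) (hC' : ∀ᵐ x ∂μ, ‖h x‖ ≤ C) :
    HasWeakFDeriv μ (fun x => B (f x) (b x))
      (fun x => B.precompR V (f x) (h x) + B.precompL V (g x) (b x)) := by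
  have cf := fun k => (moll_contDiff hf.locInt k).continuous.aestronglyMeasurable (μ := μ)
  have cg := fun k => (moll_contDiff hf.locInt_deriv k).continuous.aestronglyMeasurable (μ := μ)
  have cb := fun k => (moll_contDiff hb.locInt k).continuous.aestronglyMeasurable (μ := μ)
  have ch := fun k => (moll_contDiff hb.locInt_deriv k).continuous.aestronglyMeasurable (μ := μ)
  have mb := hb.locInt.aestronglyMeasurable
  have mh := hb.locInt_deriv.aestronglyMeasurable
  have l1 := LocallyIntegrable.bilin (B.precompR V) hf.locInt mh hC'
  have l2 := LocallyIntegrable.bilin (B.precompL V) hf.locInt_deriv mb hC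
  refine HasWeakFDeriv.of_tendsto (u := fun k x => B (moll μ k f x) (moll μ k b x))
    (w := fun k x => B.precompR V (moll μ k f x) (moll μ k h x)
      + B.precompL V (moll μ k g x) (moll μ k b x)) ?_ ?_ ?_
      (LocallyIntegrable.bilin B hf.locInt mb hC) (l1.add l2)
  · intro k
    have hd : ∀ x, HasFDerivAt (fun x => B (moll μ k f x) (moll μ k b x)) _ x :=
      fun x => B.hasFDerivAt_of_bilinear (moll_hasFDerivAt hf k x) (moll_hasFDerivAt hb k x)
    have hc : ContDiff ℝ 1 (fun x => B (moll μ k f x) (moll μ k b x)) :=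
      B.isBoundedBilinearMap.contDiff.comp
        (((moll_contDiff hf.locInt k).of_le (by simp)).prodMk
          ((moll_contDiff hb.locInt k).of_le (by simp)))
    have h1 := hasWeakFDeriv_of_contDiff (μ := μ) hc
    rwa [funext fun x => (hd x).fderiv] at h1
  · exact (moll_tendstoL1Loc hf.locInt).bilin B hf.locInt cf cb mb
      (moll_ae_tendsto hb.locInt) (fun k => Eventually.of_forall (moll_norm_le hC k)) hC
  · have t1 := (moll_tendstoL1Loc hf.locInt).bilin (B.precompR V) hf.locInt cf ch mh
      (moll_ae_tendsto hb.locInt_deriv) (fun k => Eventually.of_forall (moll_norm_le hC' k)) hC'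
    have t2 := (moll_tendstoL1Loc hf.locInt_deriv).bilin (B.precompL V) hf.locInt_deriv cg cb mb
      (moll_ae_tendsto hb.locInt) (fun k => Eventually.of_forall (moll_norm_le hC k)) hC
    refine t1.add t2 (fun k => ?_) l1.aestronglyMeasurable
    exact (B.precompR V).aestronglyMeasurable_comp₂ (cf k) (ch k)

theorem quasiMeasurePreserving_of_map_le {Ψ : V ≃ₜ V} {c : ℝ≥0∞} (hc : μ.map Ψ ≤ c • μ) :
    Measure.QuasiMeasurePreserving Ψ μ μ :=
  ⟨Ψ.continuous.measurable, (Measure.absolutelyContinuous_of_le hc).trans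
    Measure.smul_absolutelyContinuous⟩

theorem lintegral_comp_le {Ψ : V ≃ₜ V} {c : ℝ≥0∞} (hc : μ.map Ψ ≤ c • μ) (G : V → ℝ≥0∞)
    (K : Set V) : ∫⁻ x in K, G (Ψ x) ∂μ ≤ c * ∫⁻ y in Ψ '' K, G y ∂μ := by
  have h1 : ∫⁻ x in K, G (Ψ x) ∂μ = ∫⁻ y in Ψ '' K, G y ∂(μ.map Ψ) := by
    have : Measure.map Ψ μ = Measure.map Ψ.toMeasurableEquiv μ := rfl
    rw [this, Ψ.toMeasurableEquiv.restrict_map, lintegral_map_equiv]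
    congr 2
    simp [Set.preimage_image_eq _ Ψ.injective]
  rw [h1, ← smul_eq_mul, ← lintegral_smul_measure, ← Measure.restrict_smul]
  exact lintegral_mono' (Measure.restrict_mono subset_rfl hc) le_rfl

theorem LocallyIntegrable.comp_homeomorph {Ψ : V ≃ₜ V} {c : ℝ≥0∞} (hc : μ.map Ψ ≤ c • μ)
    (hc' : c ≠ ⊤) {f : V → F} (hf : LocallyIntegrable f μ) :
    LocallyIntegrable (fun x => f (Ψ x)) μ := by
  rw [locallyIntegrable_iff]
  intro K hK
  refine ⟨(hf.aestronglyMeasurable.comp_quasiMeasurePreserving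
    (quasiMeasurePreserving_of_map_le hc)).restrict, ?_⟩
  refine (lintegral_comp_le hc (fun y => ‖f y‖ₑ) K).trans_lt ?_
  exact ENNReal.mul_lt_top hc'.lt_top (hf.integrableOn_isCompact (hK.image Ψ.continuous)).2

theorem TendstoL1Loc.comp_homeomorph {Ψ : V ≃ₜ V} {c : ℝ≥0∞} (hc : μ.map Ψ ≤ c • μ)
    (hc' : c ≠ ⊤) {u : ℕ → V → F} {f : V → F} (h : TendstoL1Loc μ u f) :
    TendstoL1Loc μ (fun k x => u k (Ψ x)) (fun x => f (Ψ x)) := by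
  intro K hK
  have h1 := ENNReal.Tendsto.const_mul (a := c) (h _ (hK.image Ψ.continuous)) (Or.inr hc')
  rw [mul_zero] at h1
  exact tendsto_of_tendsto_of_tendsto_of_le_of_le tendsto_const_nhds h1 (fun _ => zero_le)
    fun k => lintegral_comp_le hc (fun y => ‖u k y - f y‖ₑ) K

/-- The chain rule for weak derivatives and a `C¹` change of variables. -/
theorem HasWeakFDeriv.comp_homeomorph {Ψ : V ≃ₜ V} {c : ℝ≥0∞} (hc : μ.map Ψ ≤ c • μ)
    (hc' : c ≠ ⊤) (hΨ : ContDiff ℝ 1 Ψ) {C : ℝ} (hC : ∀ x, ‖fderiv ℝ Ψ x‖ ≤ C)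
    {f : V → F} {g : V → V →L[ℝ] F} (hf : HasWeakFDeriv μ f g) :
    HasWeakFDeriv μ (fun x => f (Ψ x)) (fun x => (g (Ψ x)).comp (fderiv ℝ Ψ x)) := by
  have mΨ := (hΨ.continuous_fderiv (by simp)).aestronglyMeasurable (μ := μ)
  have lg := LocallyIntegrable.comp_homeomorph hc hc' hf.locInt_deriv
  refine HasWeakFDeriv.of_tendsto (u := fun k x => moll μ k f (Ψ x))
    (w := fun k x => (moll μ k g (Ψ x)).comp (fderiv ℝ Ψ x)) ?_
    ((moll_tendstoL1Loc hf.locInt).comp_homeomorph hc hc') ?_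
    (LocallyIntegrable.comp_homeomorph hc hc' hf.locInt)
    (LocallyIntegrable.bilin (ContinuousLinearMap.compL ℝ V V F) lg mΨ (Eventually.of_forall hC))
  · intro k
    have h1 := hasWeakFDeriv_of_contDiff (μ := μ)
      (((moll_contDiff hf.locInt k).of_le (by simp) : ContDiff ℝ 1 _).comp hΨ)
    have h2 : fderiv ℝ (moll μ k f ∘ Ψ)
        = fun x => (moll μ k g (Ψ x)).comp (fderiv ℝ Ψ x) := by
      funext x
      exact ((moll_hasFDerivAt hf k (Ψ x)).comp x
        (hΨ.differentiable (by simp) x).hasFDerivAt).fderiv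
    rwa [h2] at h1
  · exact ((moll_tendstoL1Loc hf.locInt_deriv).comp_homeomorph hc hc').bilin
      (ContinuousLinearMap.compL ℝ V V F) lg
      (fun k => ((moll_contDiff hf.locInt_deriv k).continuous.comp Ψ.continuous).aestronglyMeasurable)
      (fun _ => mΨ) mΨ (Eventually.of_forall fun x => tendsto_const_nhds)
      (fun _ => Eventually.of_forall hC) (Eventually.of_forall hC)

end WeakDerivatives

/-! ### Regularity of functions with bounded weak derivatives -/

section Regularity

variable {V : Type*} [NormedAddCommGroup V] [NormedSpace ℝ V] [FiniteDimensional ℝ V]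
  [MeasurableSpace V] [BorelSpace V] {μ : Measure V} [μ.IsAddHaarMeasure]
  {F : Type*} [NormedAddCommGroup F] [NormedSpace ℝ F]

theorem HasWeakFDeriv.congr {f f' : V → F} {g g' : V → V →L[ℝ] F} (h : HasWeakFDeriv μ f g)
    (hf : f =ᵐ[μ] f') (hg : g =ᵐ[μ] g') : HasWeakFDeriv μ f' g' where
  locInt := h.locInt.congr hf
  locInt_deriv := h.locInt_deriv.congr hg
  integral_eq φ hφ hφc v := by
    have h1 : ∫ x, (fderiv ℝ φ x v) • f' x ∂μ = ∫ x, (fderiv ℝ φ x v) • f x ∂μ :=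
      integral_congr_ae (by filter_upwards [hf] with x hx; rw [hx])
    have h2 : ∫ x, φ x • g' x v ∂μ = ∫ x, φ x • g x v ∂μ :=
      integral_congr_ae (by filter_upwards [hg] with x hx; rw [hx])
    rw [h1, h2, h.integral_eq φ hφ hφc v]

theorem forall_norm_le_of_ae {f : V → F} (hf : Continuous f) {C : ℝ} (h : ∀ᵐ x ∂μ, ‖f x‖ ≤ C)
    (x : V) : ‖f x‖ ≤ C := by
  have hd : Dense {x | ‖f x‖ ≤ C} := Measure.dense_of_ae h
  have hc : IsClosed {x | ‖f x‖ ≤ C} := isClosed_le hf.norm continuous_const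
  have : x ∈ closure {x | ‖f x‖ ≤ C} := hd x
  rwa [hc.closure_eq] at this

/-- A Lipschitz function has its classical derivative as weak derivative. -/
theorem LipschitzWith.hasWeakFDeriv [FiniteDimensional ℝ F] {L : NNReal} {f : V → F}
    (hf : LipschitzWith L f) : HasWeakFDeriv μ f (fderiv ℝ f) := by
  have : CompleteSpace F := FiniteDimensional.complete ℝ F
  have hm : LocallyIntegrable (fderiv ℝ f) μ := by
    borelize F
    borelize (V →L[ℝ] F)
    rw [locallyIntegrable_iff]
    intro K hK
    refine Integrable.mono' (g := fun _ => (L : ℝ)) (integrableOn_const hK.measure_lt_top.ne)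
      (measurable_fderiv ℝ f).aestronglyMeasurable
      (Eventually.of_forall fun x => norm_fderiv_le_of_lipschitz ℝ hf)
  refine ⟨hf.continuous.locallyIntegrable, hm, fun φ hφ hφc v => ?_⟩
  have hd : Continuous fun x => fderiv ℝ φ x v :=
    (hφ.continuous_fderiv (by simp)).clm_apply continuous_const
  have hdc : HasCompactSupport fun x => fderiv ℝ φ x v := hφc.fderiv_apply ℝ v
  have i1 := LocallyIntegrable.continuous_smul hf.continuous.locallyIntegrable (μ := μ) hd hdc
  have i2 := LocallyIntegrable.continuous_smul (LocallyIntegrable.clm_apply hm v) hφ.continuous hφc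
  rw [SeparatingDual.eq_iff_forall_dual_eq (R := ℝ)]
  intro l
  rw [map_neg, ← l.integral_comp_comm i1, ← l.integral_comp_comm i2]
  obtain ⟨D, hD⟩ := (hφ.of_le (by simp) : ContDiff ℝ 1 φ).lipschitzWith_of_hasCompactSupport hφc
    (by simp)
  have key := LipschitzWith.integral_lineDeriv_mul_eq (μ := μ) (l.lipschitz.comp hf) hD hφc v
  have e1 : ∫ x, lineDeriv ℝ (l ∘ f) x v * φ x ∂μ = ∫ x, l (φ x • fderiv ℝ f x v) ∂μ := by
    refine integral_congr_ae ?_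
    filter_upwards [hf.ae_differentiableAt (μ := μ)] with x hx
    have := (l.hasFDerivAt.comp x hx.hasFDerivAt).hasLineDerivAt v
    rw [this.lineDeriv, map_smul, smul_eq_mul, mul_comm]
    rfl
  have e2 : ∫ x, lineDeriv ℝ φ x (-v) * (l ∘ f) x ∂μ = - ∫ x, l (fderiv ℝ φ x v • f x) ∂μ := by
    rw [← integral_neg]
    congr 1
    funext x
    rw [((hφ.differentiable (by simp) x).hasFDerivAt.hasLineDerivAt (-v)).lineDeriv]
    simp
  rw [← e1, key, e2, neg_neg]

variable [CompleteSpace F]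

theorem moll_lipschitz {f : V → F} {g : V → V →L[ℝ] F} (h : HasWeakFDeriv μ f g) {C : NNReal}
    (hC : ∀ᵐ x ∂μ, ‖g x‖ ≤ C) (k : ℕ) : LipschitzWith C (moll μ k f) :=
  lipschitzWith_of_nnnorm_fderiv_le ((moll_contDiff h.locInt k).differentiable (by simp))
    fun x => by rw [moll_fderiv h]; exact moll_norm_le hC k x

/-- A function with bounded weak derivative has a Lipschitz representative. -/
theorem HasWeakFDeriv.exists_lipschitz {f : V → F} {g : V → V →L[ℝ] F} (h : HasWeakFDeriv μ f g)
    {C : NNReal} (hC : ∀ᵐ x ∂μ, ‖g x‖ ≤ C) : ∃ f' : V → F, LipschitzWith C f' ∧ f =ᵐ[μ] f' := by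
  have hl := moll_lipschitz h hC
  have hae := moll_ae_tendsto h.locInt
  have hd : Dense {x | Tendsto (fun k => moll μ k f x) atTop (𝓝 (f x))} := Measure.dense_of_ae hae
  have hcs : ∀ x, CauchySeq fun k => moll μ k f x := by
    intro x
    rw [Metric.cauchySeq_iff]
    intro ε hε
    obtain ⟨y, hy, hxy⟩ := hd.exists_dist_lt x (ε := ε / (3 * (C + 1))) (by positivity)
    obtain ⟨N, hN⟩ := Metric.cauchySeq_iff.1 (Tendsto.cauchySeq hy) (ε / 3) (by positivity)
    refine ⟨N, fun m hm n hn => ?_⟩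
    have h1 := (hl m).dist_le_mul x y
    have h2 := (hl n).dist_le_mul y x
    have h3 := hN m hm n hn
    have h4 : (C : ℝ) * dist x y ≤ ε / 3 := by
      calc (C : ℝ) * dist x y ≤ (C + 1) * (ε / (3 * (C + 1))) := by gcongr; linarith
        _ = ε / 3 := by field_simp
    rw [dist_comm y x] at h2
    linarith [dist_triangle4 (moll μ m f x) (moll μ m f y) (moll μ n f y) (moll μ n f x)]
  choose f' hf' using fun x => cauchySeq_tendsto_of_complete (hcs x)
  refine ⟨f', LipschitzWith.of_dist_le_mul fun x y => ?_, ?_⟩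
  · exact le_of_tendsto' ((hf' x).dist (hf' y)) fun k => (hl k).dist_le_mul x y
  · filter_upwards [hae] with x hx using tendsto_nhds_unique hx (hf' x)

/-- A continuous function with Lipschitz weak derivative is classically differentiable. -/
theorem HasWeakFDeriv.hasFDerivAt {f : V → F} {g : V → V →L[ℝ] F} (h : HasWeakFDeriv μ f g)
    (hf : Continuous f) {L : NNReal} (hg : LipschitzWith L g) (x : V) : HasFDerivAt f (g x) x := by
  refine hasFDerivAt_of_tendstoUniformly (l := atTop) (f := fun k => moll μ k f)
    (f' := fun k => moll μ k g) (g := f) (g' := g) ?_ (fun k x => moll_hasFDerivAt h k x) (fun x => ?_) x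
  · rw [Metric.tendstoUniformly_iff]
    intro ε hε
    have : Tendsto (fun k : ℕ => (L : ℝ) * ((k : ℝ) + 1)⁻¹) atTop (𝓝 (L * 0)) :=
      (tendsto_mollBump_rOut (V := V)).const_mul _
    rw [mul_zero] at this
    filter_upwards [this.eventually (gt_mem_nhds hε)] with k hk y
    rw [dist_comm, dist_eq_norm]
    exact (moll_dist_le_of_lipschitz hg k y).trans_lt hk
  · exact ContDiffBump.convolution_tendsto_right_of_continuous tendsto_mollBump_rOut hf x

end Regularity

/-! ### The admissible velocity fields -/

theorem IsWeakFDeriv.hasWeakFDeriv {n : ℕ} {F : Type} [NormedAddCommGroup F] [NormedSpace ℝ F]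
    {f : Euc n → F} {g : Euc n → (Euc n →L[ℝ] F)} (h : IsWeakFDeriv f g) :
    HasWeakFDeriv volume f g := ⟨h.locInt, h.locInt_deriv, h.integral_eq⟩

theorem HasWeakFDeriv.isWeakFDeriv {n : ℕ} {F : Type} [NormedAddCommGroup F] [NormedSpace ℝ F]
    {f : Euc n → F} {g : Euc n → (Euc n →L[ℝ] F)} (h : HasWeakFDeriv volume f g) :
    IsWeakFDeriv f g := ⟨h.locInt, h.locInt_deriv, h.integral_eq⟩

theorem exists_of_eSobolevNorm_succ_lt {n : ℕ} {F : Type} [NormedAddCommGroup F] [NormedSpace ℝ F]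
    {p : ℝ≥0∞} {k : ℕ} {f : Euc n → F} {a : ℝ≥0∞} (h : eSobolevNorm p (k + 1) f < a) :
    eLpNorm f p volume < a ∧ ∃ g, HasWeakFDeriv volume f g ∧ eSobolevNorm p k g < a := by
  rw [eSobolevNorm, max_lt_iff, iInf_lt_iff] at h
  obtain ⟨h1, ⟨g, hg⟩, h2⟩ := h
  exact ⟨h1, g, hg.hasWeakFDeriv, h2⟩

theorem ae_norm_le_of_eLpNorm_top_le {X F : Type*} [MeasurableSpace X] {μ : Measure X}
    [NormedAddCommGroup F] {f : X → F} {a : ℝ} (ha : 0 ≤ a)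
    (h : eLpNorm f ⊤ μ ≤ ENNReal.ofReal a) : ∀ᵐ x ∂μ, ‖f x‖ ≤ a := by
  rw [eLpNorm_exponent_top] at h
  filter_upwards [ae_le_eLpNormEssSup (f := f) (μ := μ)] with x hx
  have := hx.trans h
  rwa [← ofReal_norm, ENNReal.ofReal_le_ofReal_iff ha] at this

/-- A twice continuously differentiable vector field, bounded by `M` together with its first two
derivatives, and whose second derivative is `M`-Lipschitz. -/
structure IsC2Field {E W : Type*} [NormedAddCommGroup E] [NormedSpace ℝ E] [NormedAddCommGroup W]
    [NormedSpace ℝ W] (M : ℝ) (f : E → W) : Prop where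
  diff : Differentiable ℝ f
  diff2 : Differentiable ℝ (fderiv ℝ f)
  bound : ∀ x, ‖f x‖ ≤ M
  bound1 : ∀ x, ‖fderiv ℝ f x‖ ≤ M
  bound2 : ∀ x, ‖fderiv ℝ (fderiv ℝ f) x‖ ≤ M
  lip2 : ∀ x y, ‖fderiv ℝ (fderiv ℝ f) x - fderiv ℝ (fderiv ℝ f) y‖ ≤ M * ‖x - y‖

theorem isC2Field_zero {E W : Type*} [NormedAddCommGroup E] [NormedSpace ℝ E]
    [NormedAddCommGroup W] [NormedSpace ℝ W] {M : ℝ} (hM : 0 ≤ M) :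
    IsC2Field M (fun _ : E => (0 : W)) := by
  have h1 : fderiv ℝ (fun _ : E => (0 : W)) = fun _ => 0 := by funext x; simp
  have h2 : fderiv ℝ (fun _ : E => (0 : E →L[ℝ] W)) = fun _ => 0 := by funext x; simp
  refine ⟨differentiable_const _, ?_, ?_, ?_, ?_, ?_⟩
  · rw [h1]; exact differentiable_const _
  · simpa using hM
  · intro x; rw [h1]; simpa using hM
  · intro x; rw [h1, h2]; exact (norm_zero (E := E →L[ℝ] E →L[ℝ] W)).trans_le hM
  · intro x y
    rw [h1, h2, sub_self]
    exact (norm_zero (E := E →L[ℝ] E →L[ℝ] W)).trans_le (by positivity)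

theorem isC2Field_of_eSobolevNorm_lt {n : ℕ} {W : Type} [NormedAddCommGroup W] [NormedSpace ℝ W]
    [CompleteSpace W] {a : ℝ} (ha : 0 ≤ a) {f : Euc n → W} (hf : Continuous f)
    (h : eSobolevNorm ⊤ 3 f < ENNReal.ofReal a) : IsC2Field a f := by
  obtain ⟨h0, g1, w1, h⟩ := exists_of_eSobolevNorm_succ_lt h
  obtain ⟨h1, g2, w2, h⟩ := exists_of_eSobolevNorm_succ_lt h
  obtain ⟨h2, g3, w3, h⟩ := exists_of_eSobolevNorm_succ_lt h
  rw [eSobolevNorm] at h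
  have b0 := ae_norm_le_of_eLpNorm_top_le ha h0.le
  have b1 := ae_norm_le_of_eLpNorm_top_le ha h1.le
  have b2 := ae_norm_le_of_eLpNorm_top_le ha h2.le
  have b3 := ae_norm_le_of_eLpNorm_top_le ha h.le
  lift a to NNReal using ha
  obtain ⟨G2, hG2, e2⟩ := w3.exists_lipschitz b3
  obtain ⟨G1, hG1, e1⟩ := w2.exists_lipschitz b2
  have d1 : ∀ x, HasFDerivAt G1 (G2 x) x := (w2.congr e1 e2).hasFDerivAt hG1.continuous hG2
  have d0 : ∀ x, HasFDerivAt f (G1 x) x := (w1.congr ae_eq_rfl e1).hasFDerivAt hf hG1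
  have f0 : fderiv ℝ f = G1 := funext fun x => (d0 x).fderiv
  have f1 : fderiv ℝ G1 = G2 := funext fun x => (d1 x).fderiv
  refine ⟨fun x => (d0 x).differentiableAt, ?_, forall_norm_le_of_ae hf b0, ?_, ?_, ?_⟩
  · rw [f0]; exact fun x => (d1 x).differentiableAt
  · rw [f0]
    exact forall_norm_le_of_ae hG1.continuous (by filter_upwards [b1, e1] with x hx e; rwa [← e])
  · rw [f0, f1]
    exact forall_norm_le_of_ae hG2.continuous (by filter_upwards [b2, e2] with x hx e; rwa [← e])
  · rw [f0, f1]
    intro x y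
    simpa [dist_eq_norm] using hG2.dist_le_mul x y

theorem isC2Field_of_eSobolevNorm_le {n : ℕ} {W : Type} [NormedAddCommGroup W] [NormedSpace ℝ W]
    [CompleteSpace W] {M : ℝ} (hM : 0 ≤ M) {f : Euc n → W} (hf : Continuous f)
    (h : eSobolevNorm ⊤ 3 f ≤ ENNReal.ofReal M) : IsC2Field M f := by
  have key : ∀ a > M, IsC2Field a f := fun a ha =>
    isC2Field_of_eSobolevNorm_lt (hM.trans ha.le) hf
      (h.trans_lt ((ENNReal.ofReal_lt_ofReal_iff (hM.trans_lt ha)).2 ha))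
  have k1 := key (M + 1) (by linarith)
  refine ⟨k1.diff, k1.diff2, fun x => ?_, fun x => ?_, fun x => ?_, fun x y => ?_⟩
  · exact le_of_forall_gt_imp_ge_of_dense fun a ha => (key a ha).bound x
  · exact le_of_forall_gt_imp_ge_of_dense fun a ha => (key a ha).bound1 x
  · exact le_of_forall_gt_imp_ge_of_dense fun a ha => (key a ha).bound2 x
  · have : Tendsto (fun a => a * ‖x - y‖) (𝓝[>] M) (𝓝 (M * ‖x - y‖)) :=
      (tendsto_nhdsWithin_of_tendsto_nhds tendsto_id).mul_const _
    refine ge_of_tendsto this ?_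
    filter_upwards [self_mem_nhdsWithin] with a ha using (key a ha).lip2 x y

theorem MemControlSpace.exists_continuous {n : ℕ} {f : Euc n → Euc n} (h : MemControlSpace f) :
    ∃ g : Euc n → Euc n, Continuous g ∧ f =ᵐ[volume] g := by
  have h1 := h.1.2
  obtain ⟨a, ha0, h2⟩ : ∃ a : ℝ, 0 ≤ a ∧ eSobolevNorm ⊤ 3 f < ENNReal.ofReal a :=
    ⟨(eSobolevNorm ⊤ 3 f).toReal + 1, by positivity, by
      rw [ENNReal.lt_ofReal_iff_toReal_lt h1.ne]; linarith⟩
  obtain ⟨h0, g1, w1, h⟩ := exists_of_eSobolevNorm_succ_lt h2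
  obtain ⟨h1, -⟩ := exists_of_eSobolevNorm_succ_lt h
  have b1 := ae_norm_le_of_eLpNorm_top_le ha0 h1.le
  lift a to NNReal using ha0
  obtain ⟨g, hg, e⟩ := w1.exists_lipschitz b1
  exact ⟨g, hg.continuous, e⟩

open Classical in
/-- The continuous representative of `f`, if there is one. -/
noncomputable def continuousRep {n : ℕ} (f : Euc n → Euc n) : Euc n → Euc n :=
  if h : ∃ g : Euc n → Euc n, Continuous g ∧ f =ᵐ[volume] g then h.choose else f

theorem MemControlSpace.continuousRep_spec {n : ℕ} {f : Euc n → Euc n} (h : MemControlSpace f) :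
    Continuous (continuousRep f) ∧ f =ᵐ[volume] continuousRep f := by
  rw [continuousRep, dif_pos h.exists_continuous]
  exact h.exists_continuous.choose_spec

theorem enorm_continuousRep_sub_le {n : ℕ} {f g : Euc n → Euc n} (hf : MemControlSpace f)
    (hg : Continuous g) (x : Euc n) :
    ‖continuousRep f x - g x‖ₑ ≤ controlNorm (fun y => f y - g y) := by
  obtain ⟨hc, he⟩ := hf.continuousRep_spec
  have h1 : ∀ᵐ y : Euc n, ‖continuousRep f y - g y‖ₑ ≤ controlNorm (fun y => f y - g y) := by
    filter_upwards [ae_le_eLpNormEssSup (f := fun y => f y - g y) (μ := volume), he] with y hy e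
    rw [← e]
    refine hy.trans ?_
    rw [← eLpNorm_exponent_top]
    exact le_max_of_le_left (by rw [eSobolevNorm]; exact le_max_left _ _)
  have hd := Measure.dense_of_ae h1
  have hcl : IsClosed {y | ‖continuousRep f y - g y‖ₑ ≤ controlNorm (fun y => f y - g y)} :=
    isClosed_le (hc.sub hg).enorm continuous_const
  have : x ∈ closure {y | ‖continuousRep f y - g y‖ₑ ≤ controlNorm (fun y => f y - g y)} := hd x
  rwa [hcl.closure_eq] at this

/-- A time-dependent vector field, measurable in time, of class `C²` in space with bounds uniform
in time, and vanishing outside `[0, T]`. -/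
structure IsFlowField {E : Type*} [NormedAddCommGroup E] [NormedSpace ℝ E] (M T : ℝ)
    (b : ℝ → E → E) : Prop where
  meas : ∀ x, StronglyMeasurable fun s => b s x
  c2 : ∀ s, IsC2Field M (b s)
  supp : ∀ s, s ∉ Icc 0 T → ∀ x, b s x = 0

theorem IsAdmissibleControl.exists_flowField {n : ℕ} {M T : ℝ} (hM : 0 ≤ M)
    {α : ℝ → Euc n → Euc n} (h : IsAdmissibleControl M T α) :
    ∃ b : ℝ → Euc n → Euc n, IsFlowField M T b ∧ ∀ᵐ s ∂(volume.restrict (Icc 0 T)), α s = b s := by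
  classical
  obtain ⟨A, hA, hAlim⟩ := h.bochner.stronglyMeasurable
  have hae := (hAlim.and (h.bound.and h.continuous_rep))
  obtain ⟨N, hN, hNm, hN0⟩ := exists_measurable_superset_of_null (ae_iff.1 hae)
  set S := Icc 0 T \ N with hS
  have hSm : MeasurableSet S := measurableSet_Icc.diff hNm
  have hgood : ∀ s ∈ S, _ := fun s hs => not_not.1 fun hn => hs.2 (hN hn)
  refine ⟨fun s => if s ∈ S then α s else fun _ => 0, ⟨fun x => ?_, fun s => ?_, ?_⟩, ?_⟩
  · have hlim : ∀ s, Tendsto (fun k => S.indicator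
        (fun s => ((A k).map fun f => continuousRep f x) s) s) atTop
        (𝓝 ((if s ∈ S then α s else fun _ => 0) x)) := by
      intro s
      by_cases hs : s ∈ S
      · simp only [hs, indicator_of_mem, if_true, SimpleFunc.map_apply]
        rw [tendsto_iff_edist_tendsto_0]
        refine tendsto_of_tendsto_of_tendsto_of_le_of_le tendsto_const_nhds (hgood s hs).1
          (fun _ => zero_le) fun k => ?_
        rw [edist_eq_enorm_sub]
        exact enorm_continuousRep_sub_le (hA k s) (hgood s hs).2.2 x
      · simp [hs]
    exact stronglyMeasurable_of_tendsto atTop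
      (fun k => ((A k).map fun f => continuousRep f x).stronglyMeasurable.indicator hSm)
      (tendsto_pi_nhds.2 hlim)
  · by_cases hs : s ∈ S
    · simp only [hs, if_true]
      exact isC2Field_of_eSobolevNorm_le hM (hgood s hs).2.2 (hgood s hs).2.1.1
    · simp only [hs, if_false]
      exact isC2Field_zero hM
  · intro s hs x
    rw [if_neg fun h => hs h.1]
  · have : ∀ᵐ s ∂(volume.restrict (Icc 0 T)), s ∉ N := by
      rw [ae_iff]; simpa using hN0
    filter_upwards [this, ae_restrict_mem measurableSet_Icc] with s hs hs'
    rw [if_pos ⟨hs', hs⟩]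

/-! ### Grönwall's inequality in integral form -/

theorem le_exp_of_le_add_integral_Icc {v : ℝ → ℝ} {a K t t' : ℝ} (hK : 0 ≤ K)
    (hv : ContinuousOn v (Icc t t'))
    (h : ∀ s ∈ Icc t t', v s ≤ a + K * ∫ τ in t..s, v τ) :
    ∀ s ∈ Icc t t', v s ≤ a * Real.exp (K * (s - t)) := by
  intro s hs
  have htt : t ≤ t' := hs.1.trans hs.2
  set w := IccExtend htt (domRestrict (Icc t t') v) with hw
  have hwc : Continuous w := (continuousOn_iff_continuous_domRestrict.1 hv).Icc_extend'
  have hwv : ∀ τ ∈ Icc t t', w τ = v τ := fun τ hτ => by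
    rw [hw, IccExtend_of_mem htt _ hτ]; rfl
  set U : ℝ → ℝ := fun s => a + K * ∫ τ in t..s, w τ with hU
  have hd : ∀ s, HasDerivAt U (K * w s) s := fun s =>
    ((intervalIntegral.integral_hasDerivAt_right (hwc.intervalIntegrable _ _)
      hwc.stronglyMeasurable.stronglyMeasurableAtFilter hwc.continuousAt).const_mul K).const_add a
  have hwU : ∀ s ∈ Icc t t', w s ≤ U s := by
    intro s hs
    rw [hwv s hs, hU]
    refine (h s hs).trans (le_of_eq ?_)
    dsimp only
    congr 2
    refine intervalIntegral.integral_congr fun τ hτ => ?_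
    rw [uIcc_of_le hs.1] at hτ
    exact (hwv τ ⟨hτ.1, hτ.2.trans hs.2⟩).symm
  have key := le_gronwallBound_of_liminf_deriv_right_le (f := U) (f' := fun s => K * w s) (δ := a)
    (K := K) (ε := 0) (a := t) (b := t')
    (fun s _ => (hd s).continuousAt.continuousWithinAt)
    (fun s _ r hr => (hd s).hasDerivWithinAt.liminf_right_slope_le hr)
    (by simp [hU])
    (fun s hs => by
      rw [add_zero]; exact mul_le_mul_of_nonneg_left (hwU s (Ico_subset_Icc_self hs)) hK) s hs
  rw [gronwallBound_ε0] at key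
  rw [← hwv s hs]
  exact (hwU s hs).trans key

theorem le_exp_of_le_add_abs_integral {v : ℝ → ℝ} {a K t : ℝ} (hK : 0 ≤ K) (hv : Continuous v)
    (h : ∀ s, v s ≤ a + K * |∫ τ in t..s, v τ|) (hv0 : ∀ s, 0 ≤ v s) (s : ℝ) :
    v s ≤ a * Real.exp (K * |s - t|) := by
  rcases le_total t s with hts | hst
  · rw [abs_of_nonneg (sub_nonneg.2 hts)]
    refine le_exp_of_le_add_integral_Icc hK hv.continuousOn (t' := s) (fun r hr => ?_) s ⟨hts, le_rfl⟩
    have := h r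
    rwa [abs_of_nonneg (intervalIntegral.integral_nonneg hr.1 fun τ _ => hv0 τ)] at this
  · have hw : Continuous fun r => v (2 * t - r) := hv.comp (by fun_prop)
    have := le_exp_of_le_add_integral_Icc (a := a) hK hw.continuousOn (t := t) (t' := 2 * t - s)
      (fun r hr => ?_) (2 * t - s) ⟨by linarith, le_rfl⟩
    · rw [abs_sub_comm, abs_of_nonneg (sub_nonneg.2 hst)]
      have e1 : 2 * t - (2 * t - s) = s := by ring
      have e2 : 2 * t - s - t = t - s := by ring
      rwa [e1, e2] at this
    · have h1 := h (2 * t - r)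
      have e : ∫ τ in t..r, v (2 * t - τ) = ∫ τ in (2 * t - r)..t, v τ := by
        rw [intervalIntegral.integral_comp_sub_left (fun x => v x) (2 * t)]
        congr 1; ring
      rw [e]
      rwa [intervalIntegral.integral_symm, abs_neg, abs_of_nonneg
        (intervalIntegral.integral_nonneg (by linarith [hr.1]) fun τ _ => hv0 τ)] at h1

/-! ### Carathéodory ordinary differential equations -/

section Caratheodory

open scoped BoundedContinuousFunction

variable {E : Type*} [NormedAddCommGroup E] [NormedSpace ℝ E] [FiniteDimensional ℝ E]
  {W : Type*} [NormedAddCommGroup W] [NormedSpace ℝ W] [CompleteSpace W]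

/-- A time-dependent map which is measurable in time, Lipschitz in space, and vanishes outside
`[0, T]`. -/
structure IsLipField (K T : ℝ) (b : ℝ → E → W) : Prop where
  meas : ∀ x, StronglyMeasurable fun s => b s x
  lip : ∀ s x y, ‖b s x - b s y‖ ≤ K * ‖x - y‖
  bound0 : ∀ s, ‖b s 0‖ ≤ K
  supp : ∀ s, s ∉ Icc 0 T → ∀ x, b s x = 0

namespace IsLipField

variable {K T : ℝ} {b : ℝ → E → W}

theorem nonneg (hb : IsLipField K T b) : 0 ≤ K := (norm_nonneg _).trans (hb.bound0 0)

theorem continuous (hb : IsLipField K T b) (s : ℝ) : Continuous (b s) :=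
  (LipschitzWith.of_dist_le_mul (K := ⟨K, hb.nonneg⟩) fun x y => by
    rw [dist_eq_norm, dist_eq_norm]; exact hb.lip s x y).continuous

theorem norm_le (hb : IsLipField K T b) (s : ℝ) (x : E) : ‖b s x‖ ≤ K * (‖x‖ + 1) := by
  have h1 := hb.lip s x 0
  have h2 := hb.bound0 s
  rw [sub_zero] at h1
  calc ‖b s x‖ = ‖(b s x - b s 0) + b s 0‖ := by rw [sub_add_cancel]
    _ ≤ K * ‖x‖ + K := (norm_add_le _ _).trans (add_le_add h1 h2)
    _ = _ := by ring

theorem uncurry_meas [MeasurableSpace E] [BorelSpace E] (hb : IsLipField K T b) :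
    StronglyMeasurable fun z : ℝ × E => b z.1 z.2 := by
  have := stronglyMeasurable_uncurry_of_continuous_of_stronglyMeasurable
    (u := fun (x : E) (s : ℝ) => b s x) hb.continuous hb.meas
  exact this.comp_measurable measurable_swap

theorem comp_meas (hb : IsLipField K T b) {γ : ℝ → E} (hγ : Continuous γ) :
    StronglyMeasurable fun s => b s (γ s) := by
  borelize E
  exact hb.uncurry_meas.comp_measurable (measurable_id.prodMk hγ.measurable)

theorem integrable (hb : IsLipField K T b) {γ : ℝ → E} (hγ : Continuous γ) :
    Integrable (fun s => b s (γ s)) := by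
  obtain ⟨C, hC⟩ := (isCompact_Icc (a := (0 : ℝ)) (b := T)).exists_bound_of_continuousOn
    hγ.continuousOn
  have h0 : (fun s => b s (γ s)) = (Icc 0 T).indicator fun s => b s (γ s) := by
    ext s
    by_cases hs : s ∈ Icc 0 T
    · rw [indicator_of_mem hs]
    · rw [indicator_of_notMem hs, hb.supp s hs]
  rw [h0, integrable_indicator_iff measurableSet_Icc]
  refine Integrable.mono' (g := fun _ => K * (C + 1)) (integrableOn_const (by simp))
    (hb.comp_meas hγ).aestronglyMeasurable ?_
  filter_upwards [ae_restrict_mem measurableSet_Icc] with s hs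
  exact (hb.norm_le s _).trans
    (mul_le_mul_of_nonneg_left (by linarith [hC s hs]) hb.nonneg)

end IsLipField

/-- The primitive, based at `t`, of an integrable function. -/
noncomputable def primitiveBCF (t : ℝ) (g : ℝ → W) (hg : Integrable g) : ℝ →ᵇ W :=
  BoundedContinuousFunction.ofNormedAddCommGroup (fun s => ∫ τ in t..s, g τ)
    (intervalIntegral.continuous_primitive (fun _ _ => hg.intervalIntegrable) t) (∫ τ, ‖g τ‖)
    fun _ => (intervalIntegral.norm_integral_le_integral_norm_uIoc).trans
      (setIntegral_le_integral hg.norm (Eventually.of_forall fun _ => norm_nonneg _))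

@[simp] theorem primitiveBCF_apply (t : ℝ) (g : ℝ → W) (hg : Integrable g) (s : ℝ) :
    primitiveBCF t g hg s = ∫ τ in t..s, g τ := rfl

theorem abs_integral_exp_abs_le {K : ℝ} (hK : 0 ≤ K) (t s : ℝ) :
    |∫ τ in t..s, K * Real.exp ((2 * K + 1) * |τ - t|)| ≤ Real.exp ((2 * K + 1) * |s - t|) / 2 := by
  set κ := 2 * K + 1 with hκ
  have hκ0 : 0 < κ := by linarith
  have hc : Continuous fun τ => K * Real.exp (κ * |τ - t|) := by fun_prop
  rcases le_total t s with hts | hst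
  · have h1 : ∫ τ in t..s, K * Real.exp (κ * |τ - t|)
        = K / κ * Real.exp (κ * (s - t)) - K / κ * Real.exp (κ * (t - t)) := by
      rw [← intervalIntegral.integral_eq_sub_of_hasDerivAt (f := fun τ => K / κ * Real.exp (κ * (τ - t)))
        (f' := fun τ => K * Real.exp (κ * (τ - t)))]
      · refine intervalIntegral.integral_congr fun τ hτ => ?_
        rw [uIcc_of_le hts] at hτ
        simp only [abs_of_nonneg (sub_nonneg.2 hτ.1)]
      · intro τ _
        have := ((((hasDerivAt_id' τ).sub_const t).const_mul κ).exp).const_mul (K / κ)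
        refine this.congr_deriv ?_
        field_simp
      · exact Continuous.intervalIntegrable (by fun_prop) _ _
    rw [abs_of_nonneg (intervalIntegral.integral_nonneg hts fun τ _ => by positivity), h1,
      abs_of_nonneg (sub_nonneg.2 hts)]
    have h2 : K / κ ≤ 1 / 2 := by rw [div_le_div_iff₀ hκ0 two_pos]; linarith
    have h3 : 0 ≤ K / κ * Real.exp (κ * (t - t)) := by positivity
    nlinarith [Real.exp_pos (κ * (s - t))]
  · have h1 : ∫ τ in s..t, K * Real.exp (κ * |τ - t|)
        = -(K / κ) * Real.exp (κ * (t - t)) - -(K / κ) * Real.exp (κ * (t - s)) := by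
      rw [← intervalIntegral.integral_eq_sub_of_hasDerivAt
        (f := fun τ => -(K / κ) * Real.exp (κ * (t - τ)))
        (f' := fun τ => K * Real.exp (κ * (t - τ)))]
      · refine intervalIntegral.integral_congr fun τ hτ => ?_
        rw [uIcc_of_le hst] at hτ
        simp only [abs_sub_comm τ t, abs_of_nonneg (sub_nonneg.2 hτ.2)]
      · intro τ _
        have := ((((hasDerivAt_id' τ).const_sub t).const_mul κ).exp).const_mul (-(K / κ))
        refine this.congr_deriv ?_
        field_simp
      · exact Continuous.intervalIntegrable (by fun_prop) _ _
    rw [intervalIntegral.integral_symm, abs_neg,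
      abs_of_nonneg (intervalIntegral.integral_nonneg hst fun τ _ => by positivity), h1,
      abs_sub_comm, abs_of_nonneg (sub_nonneg.2 hst)]
    have h2 : K / κ ≤ 1 / 2 := by rw [div_le_div_iff₀ hκ0 two_pos]; linarith
    have h3 : 0 ≤ K / κ * Real.exp (κ * (t - t)) := by positivity
    nlinarith [Real.exp_pos (κ * (t - s))]

variable {K T : ℝ} {b : ℝ → E → E}

/-- Existence of solutions to Carathéodory integral equations. -/
theorem IsLipField.exists_solution (hb : IsLipField K T b) (t : ℝ) (y : ℝ →ᵇ E) :
    ∃ γ : ℝ →ᵇ E, ∀ s, γ s = y s + ∫ τ in t..s, b τ (γ τ) := by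
  have hK := hb.nonneg
  have : CompleteSpace E := FiniteDimensional.complete ℝ E
  set e : ℝ → ℝ := fun τ => Real.exp ((2 * K + 1) * |τ - t|) with he
  have hec : Continuous e := by fun_prop
  have he1 : ∀ τ, 1 ≤ e τ := fun τ => Real.one_le_exp (by positivity)
  have he0 : ∀ τ, 0 < e τ := fun τ => Real.exp_pos _
  have hcont : ∀ δ : ℝ →ᵇ E, Continuous fun τ => e τ • δ τ := fun δ => hec.smul δ.continuous
  set P : (ℝ →ᵇ E) → (ℝ →ᵇ E) := fun δ =>
    primitiveBCF t (fun τ => b τ (e τ • δ τ)) (hb.integrable (hcont δ)) with hP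
  set G : (ℝ →ᵇ E) → (ℝ →ᵇ E) := fun δ =>
    BoundedContinuousFunction.ofNormedAddCommGroup (fun s => (e s)⁻¹ • (y s + P δ s))
      ((hec.inv₀ fun τ => (he0 τ).ne').smul (y + P δ).continuous) ‖y + P δ‖ (fun s => by
        rw [norm_smul, norm_inv, Real.norm_of_nonneg (he0 s).le]
        calc (e s)⁻¹ * ‖y s + P δ s‖ ≤ 1 * ‖(y + P δ) s‖ := by
              gcongr
              · exact inv_le_one_of_one_le₀ (he1 s)
              · rfl
          _ ≤ _ := by rw [one_mul]; exact (y + P δ).norm_coe_le_norm s) with hG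
  have hGc : ContractingWith (1 / 2) G := by
    refine ⟨by norm_num, LipschitzWith.of_dist_le_mul fun δ δ' => ?_⟩
    rw [BoundedContinuousFunction.dist_le (by positivity)]
    intro s
    have h1 : G δ s - G δ' s = (e s)⁻¹ • (∫ τ in t..s, (b τ (e τ • δ τ) - b τ (e τ • δ' τ))) := by
      rw [intervalIntegral.integral_sub (hb.integrable (hcont δ)).intervalIntegrable
        (hb.integrable (hcont δ')).intervalIntegrable]
      change (e s)⁻¹ • (y s + P δ s) - (e s)⁻¹ • (y s + P δ' s) = _
      rw [← smul_sub, add_sub_add_left_eq_sub]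
      rfl
    have h2 : ‖∫ τ in t..s, (b τ (e τ • δ τ) - b τ (e τ • δ' τ))‖
        ≤ |∫ τ in t..s, dist δ δ' * (K * e τ)| := by
      refine intervalIntegral.norm_integral_le_abs_of_norm_le (ae_of_all _ fun τ => ?_)
        (Continuous.intervalIntegrable (by fun_prop) _ _)
      refine (hb.lip τ _ _).trans ?_
      rw [← smul_sub, norm_smul, Real.norm_of_nonneg (he0 τ).le]
      have : ‖δ τ - δ' τ‖ ≤ dist δ δ' := by
        rw [← dist_eq_norm]; exact BoundedContinuousFunction.dist_coe_le_dist τ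
      calc K * (e τ * ‖δ τ - δ' τ‖) ≤ K * (e τ * dist δ δ') := by
            gcongr
        _ = _ := by ring
    rw [intervalIntegral.integral_const_mul, abs_mul, abs_of_nonneg dist_nonneg] at h2
    have h3 := abs_integral_exp_abs_le hK t s
    rw [dist_eq_norm, h1, norm_smul, norm_inv, Real.norm_of_nonneg (he0 s).le]
    calc (e s)⁻¹ * ‖∫ τ in t..s, (b τ (e τ • δ τ) - b τ (e τ • δ' τ))‖
        ≤ (e s)⁻¹ * (dist δ δ' * (e s / 2)) := by
          have := (he0 s)
          gcongr
          exact h2.trans (mul_le_mul_of_nonneg_left h3 dist_nonneg)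
      _ = _ := by have := (he0 s).ne'; push_cast; field_simp
  have hfix : G (hGc.fixedPoint G) = hGc.fixedPoint G := hGc.fixedPoint_isFixedPt
  set δ := hGc.fixedPoint G with hδ
  refine ⟨y + P δ, fun s => ?_⟩
  have h4 : ∀ τ, e τ • δ τ = (y + P δ) τ := by
    intro τ
    conv_lhs => rw [← hfix]
    change e τ • ((e τ)⁻¹ • (y τ + P δ τ)) = _
    rw [smul_inv_smul₀ (he0 τ).ne']
    rfl
  simp only [← h4]
  rw [h4]
  rfl

theorem IsLipField.dist_solution_le (hb : IsLipField K T b) {t : ℝ} {γ γ' : ℝ → E}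
    (hγ : Continuous γ) (hγ' : Continuous γ') {d : ℝ}
    (h : ∀ s, ‖(γ s - ∫ τ in t..s, b τ (γ τ)) - (γ' s - ∫ τ in t..s, b τ (γ' τ))‖ ≤ d) (s : ℝ) :
    ‖γ s - γ' s‖ ≤ d * Real.exp (K * |s - t|) := by
  refine le_exp_of_le_add_abs_integral (v := fun s => ‖γ s - γ' s‖) hb.nonneg
    (hγ.sub hγ').norm (fun s => ?_) (fun s => norm_nonneg _) s
  have e : γ s - γ' s = ((γ s - ∫ τ in t..s, b τ (γ τ)) - (γ' s - ∫ τ in t..s, b τ (γ' τ)))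
      + ∫ τ in t..s, (b τ (γ τ) - b τ (γ' τ)) := by
    rw [intervalIntegral.integral_sub (hb.integrable hγ).intervalIntegrable
      (hb.integrable hγ').intervalIntegrable]
    abel
  have h2 : ‖∫ τ in t..s, (b τ (γ τ) - b τ (γ' τ))‖ ≤ |∫ τ in t..s, K * ‖γ τ - γ' τ‖| :=
    intervalIntegral.norm_integral_le_abs_of_norm_le (ae_of_all _ fun τ => hb.lip τ _ _)
      (Continuous.intervalIntegrable (by fun_prop) _ _)
  rw [intervalIntegral.integral_const_mul, abs_mul, abs_of_nonneg hb.nonneg] at h2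
  rw [e]
  exact (norm_add_le _ _).trans (add_le_add (h s) h2)

theorem IsLipField.solution_unique (hb : IsLipField K T b) {t : ℝ} {γ γ' : ℝ → E}
    (hγ : Continuous γ) (hγ' : Continuous γ')
    (h : ∀ s, γ s - ∫ τ in t..s, b τ (γ τ) = γ' s - ∫ τ in t..s, b τ (γ' τ)) : γ = γ' := by
  funext s
  have := hb.dist_solution_le hγ hγ' (d := 0) (t := t) (fun s => by rw [h, sub_self, norm_zero]) s
  rw [zero_mul] at this
  exact sub_eq_zero.1 (norm_le_zero_iff.1 this)

end Caratheodory

/-! ### Superposition operators -/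

section Nemytskii

open scoped BoundedContinuousFunction

variable {E : Type*} [NormedAddCommGroup E] [NormedSpace ℝ E] [FiniteDimensional ℝ E]
  {W : Type*} [NormedAddCommGroup W] [NormedSpace ℝ W] [CompleteSpace W]
  {K K' T : ℝ} {b : ℝ → E → W}

theorem IsLipField.memLp_top (hb : IsLipField K T b) (γ : ℝ →ᵇ E) :
    MemLp (fun τ => b τ (γ τ)) ⊤ (volume.restrict (Icc 0 T)) :=
  memLp_top_of_bound (hb.comp_meas γ.continuous).aestronglyMeasurable (K * (‖γ‖ + 1))
    (Eventually.of_forall fun τ => (hb.norm_le τ _).trans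
      (mul_le_mul_of_nonneg_left (add_le_add_left (γ.norm_coe_le_norm τ) 1) hb.nonneg))

/-- The superposition operator `γ ↦ b(·, γ(·))`. -/
noncomputable def nemytskii (hb : IsLipField K T b) (γ : ℝ →ᵇ E) :
    Lp W ⊤ (volume.restrict (Icc 0 T)) := (hb.memLp_top γ).toLp

theorem coeFn_nemytskii (hb : IsLipField K T b) (γ : ℝ →ᵇ E) :
    nemytskii hb γ =ᵐ[volume.restrict (Icc 0 T)] fun τ => b τ (γ τ) := (hb.memLp_top γ).coeFn_toLp

/-- Pointwise application of an essentially bounded operator-valued function. -/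
noncomputable def lpApply (E W : Type*) [NormedAddCommGroup E] [NormedSpace ℝ E]
    [FiniteDimensional ℝ E] [NormedAddCommGroup W] [NormedSpace ℝ W] (T : ℝ) :
    Lp (E →L[ℝ] W) ⊤ (volume.restrict (Icc 0 T))
      →L[ℝ] (ℝ →ᵇ E) →L[ℝ] Lp W ⊤ (volume.restrict (Icc 0 T)) :=
  ((ContinuousLinearMap.compL ℝ (ℝ →ᵇ E) (Lp E ⊤ (volume.restrict (Icc 0 T)))
    (Lp W ⊤ (volume.restrict (Icc 0 T)))).flip
      (BoundedContinuousFunction.toLp ⊤ (volume.restrict (Icc 0 T)) ℝ)).comp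
    ((ContinuousLinearMap.id ℝ (E →L[ℝ] W)).holderL (volume.restrict (Icc 0 T)) ⊤ ⊤ ⊤)

theorem coeFn_lpApply (f : Lp (E →L[ℝ] W) ⊤ (volume.restrict (Icc 0 T))) (h : ℝ →ᵇ E) :
    lpApply E W T f h =ᵐ[volume.restrict (Icc 0 T)] fun τ => f τ (h τ) := by
  have h1 := (ContinuousLinearMap.id ℝ (E →L[ℝ] W)).coeFn_holder (r := ⊤) f
    (BoundedContinuousFunction.toLp (E := E) ⊤ (volume.restrict (Icc 0 T)) ℝ h)
  have h2 := BoundedContinuousFunction.coeFn_toLp (E := E) ⊤ (volume.restrict (Icc 0 T)) ℝ h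
  filter_upwards [h1, h2] with τ e1 e2
  rw [← e2]
  exact e1

theorem Lp_top_norm_le {f : Lp W ⊤ (volume.restrict (Icc 0 T))} {C : ℝ} (hC : 0 ≤ C)
    (h : ∀ᵐ τ ∂(volume.restrict (Icc 0 T)), ‖f τ‖ ≤ C) : ‖f‖ ≤ C := by
  have := Lp.norm_le_of_ae_bound hC h
  simpa using this

theorem continuous_nemytskii (hb : IsLipField K T b) : Continuous (nemytskii hb) := by
  refine (LipschitzWith.of_dist_le_mul (K := ⟨K, hb.nonneg⟩) fun γ γ' => ?_).continuous
  rw [dist_eq_norm]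
  refine Lp_top_norm_le (mul_nonneg hb.nonneg dist_nonneg) ?_
  filter_upwards [Lp.coeFn_sub (nemytskii hb γ) (nemytskii hb γ'), coeFn_nemytskii hb γ,
    coeFn_nemytskii hb γ'] with τ e e1 e2
  rw [e, Pi.sub_apply, e1, e2]
  refine (hb.lip τ _ _).trans (mul_le_mul_of_nonneg_left ?_ hb.nonneg)
  rw [← dist_eq_norm]
  exact BoundedContinuousFunction.dist_coe_le_dist τ

theorem norm_sub_sub_fderiv_le {f : E → W} (hf : Differentiable ℝ f)
    (hK : ∀ x y, ‖fderiv ℝ f x - fderiv ℝ f y‖ ≤ K * ‖x - y‖) (hK0 : 0 ≤ K) (x h : E) :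
    ‖f (x + h) - f x - fderiv ℝ f x h‖ ≤ K * ‖h‖ ^ 2 := by
  have := (convex_closedBall x ‖h‖).norm_image_sub_le_of_norm_hasFDerivWithin_le' (𝕜 := ℝ) (f := f)
    (f' := fderiv ℝ f) (φ := fderiv ℝ f x) (C := K * ‖h‖) (x := x) (y := x + h)
    (fun z _ => (hf z).hasFDerivAt.hasFDerivWithinAt)
    (fun z hz => (hK z x).trans
      (mul_le_mul_of_nonneg_left (by simpa [dist_eq_norm] using Metric.mem_closedBall.1 hz) hK0))
    (Metric.mem_closedBall_self (norm_nonneg _)) (by simp)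
  rw [add_sub_cancel_left] at this
  linarith [this]

theorem hasFDerivAt_nemytskii (hb : IsLipField K T b)
    (hD : IsLipField K' T fun s => fderiv ℝ (b s)) (hd : ∀ s, Differentiable ℝ (b s))
    (γ : ℝ →ᵇ E) :
    HasFDerivAt (nemytskii hb) (lpApply E W T (nemytskii hD γ)) γ := by
  rw [hasFDerivAt_iff_isLittleO_nhds_zero]
  refine Asymptotics.IsBigO.trans_isLittleO (g := fun h : ℝ →ᵇ E => ‖h‖ ^ 2) ?_
    (Asymptotics.isLittleO_norm_pow_id one_lt_two)
  refine Asymptotics.IsBigO.of_bound K' (Eventually.of_forall fun h => ?_)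
  rw [norm_pow, norm_norm]
  refine Lp_top_norm_le (by have := hD.nonneg; positivity) ?_
  filter_upwards [Lp.coeFn_sub (nemytskii hb (γ + h) - nemytskii hb γ)
      (lpApply E W T (nemytskii hD γ) h), Lp.coeFn_sub (nemytskii hb (γ + h)) (nemytskii hb γ),
    coeFn_nemytskii hb (γ + h), coeFn_nemytskii hb γ, coeFn_nemytskii hD γ,
    coeFn_lpApply (nemytskii hD γ) h] with τ e e1 e2 e3 e4 e5
  rw [e, Pi.sub_apply, e1, Pi.sub_apply, e2, e3, e5, e4]
  refine (norm_sub_sub_fderiv_le (hd τ) (hD.lip τ) hD.nonneg (γ τ) (h τ)).trans ?_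
  have := h.norm_coe_le_norm τ
  have := hD.nonneg
  gcongr

theorem contDiff_one_nemytskii (hb : IsLipField K T b)
    (hD : IsLipField K' T fun s => fderiv ℝ (b s)) (hd : ∀ s, Differentiable ℝ (b s)) :
    ContDiff ℝ 1 (nemytskii hb) :=
  contDiff_one_iff_hasFDerivAt.2 ⟨fun γ => lpApply E W T (nemytskii hD γ),
    (lpApply E W T).continuous.comp (continuous_nemytskii hD), hasFDerivAt_nemytskii hb hD hd⟩

theorem contDiff_two_nemytskii {K'' : ℝ} (hb : IsLipField K T b)
    (hD : IsLipField K' T fun s => fderiv ℝ (b s))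
    (hD2 : IsLipField K'' T fun s => fderiv ℝ (fderiv ℝ (b s)))
    (hd : ∀ s, Differentiable ℝ (b s)) (hd2 : ∀ s, Differentiable ℝ (fderiv ℝ (b s))) :
    ContDiff ℝ 2 (nemytskii hb) := by
  have : ContDiff ℝ ((1 : ℕ) + 1) (nemytskii hb) :=
    contDiff_succ_iff_hasFDerivAt.2 ⟨fun γ => lpApply E W T (nemytskii hD γ),
      (lpApply E W T).contDiff.comp (contDiff_one_nemytskii hD hD2 hd2),
      hasFDerivAt_nemytskii hb hD hd⟩
  exact_mod_cast this

theorem integrable_indicator_Lp (f : Lp W ⊤ (volume.restrict (Icc 0 T))) :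
    Integrable ((Icc 0 T).indicator f) := by
  rw [integrable_indicator_iff measurableSet_Icc]
  exact (Lp.memLp f).integrable le_top

/-- Integration from `t`, as an operator on essentially bounded functions on `[0, T]`. -/
noncomputable def volterra (W : Type*) [NormedAddCommGroup W] [NormedSpace ℝ W] [CompleteSpace W]
    (T t : ℝ) : Lp W ⊤ (volume.restrict (Icc 0 T)) →L[ℝ] ℝ →ᵇ W :=
  LinearMap.mkContinuousOfExistsBound
    { toFun := fun f => primitiveBCF t ((Icc 0 T).indicator f) (integrable_indicator_Lp f)
      map_add' := fun f g => by
        ext s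
        have hi := fun f : Lp W ⊤ (volume.restrict (Icc 0 T)) =>
          (integrable_indicator_Lp f).intervalIntegrable (a := t) (b := s)
        simp only [primitiveBCF_apply, BoundedContinuousFunction.add_apply]
        rw [← intervalIntegral.integral_add (hi f) (hi g)]
        refine intervalIntegral.integral_congr_ae' ?_ ?_ <;>
        · filter_upwards [(ae_restrict_iff' measurableSet_Icc).1 (Lp.coeFn_add f g)] with τ e _
          by_cases hτ : τ ∈ Icc 0 T
          · simp only [indicator_of_mem hτ, e hτ, Pi.add_apply]
          · simp only [indicator_of_notMem hτ, add_zero]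
      map_smul' := fun c f => by
        ext s
        simp only [primitiveBCF_apply, BoundedContinuousFunction.coe_smul, RingHom.id_apply]
        rw [← intervalIntegral.integral_smul]
        refine intervalIntegral.integral_congr_ae' ?_ ?_ <;>
        · filter_upwards [(ae_restrict_iff' measurableSet_Icc).1 (Lp.coeFn_smul c f)] with τ e _
          by_cases hτ : τ ∈ Icc 0 T
          · simp only [indicator_of_mem hτ, e hτ, Pi.smul_apply]
          · simp only [indicator_of_notMem hτ, smul_zero] }
    ⟨(volume (Icc 0 T)).toReal, fun f => by
      rw [BoundedContinuousFunction.norm_le (by positivity)]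
      intro s
      have hi := integrable_indicator_Lp f
      refine (intervalIntegral.norm_integral_le_integral_norm_uIoc.trans
        (setIntegral_le_integral hi.norm (Eventually.of_forall fun _ => norm_nonneg _))).trans ?_
      simp only [norm_indicator_eq_indicator_norm]
      rw [integral_indicator measurableSet_Icc]
      have h1 : ∀ᵐ τ ∂(volume.restrict (Icc 0 T)), ‖f τ‖ ≤ ‖f‖ := by
        refine ae_norm_le_of_eLpNorm_top_le (norm_nonneg _) ?_
        rw [Lp.norm_def, ENNReal.ofReal_toReal (Lp.memLp f).2.ne]
      refine (integral_mono_ae ((Lp.memLp f).integrable le_top).norm (integrable_const ‖f‖) h1).trans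
        ?_
      simp [Measure.real]⟩

theorem volterra_apply (f : Lp W ⊤ (volume.restrict (Icc 0 T))) (t s : ℝ) :
    volterra W T t f s = ∫ τ in t..s, (Icc 0 T).indicator f τ := rfl

theorem volterra_eq {f : Lp W ⊤ (volume.restrict (Icc 0 T))} {g : ℝ → W}
    (h : f =ᵐ[volume.restrict (Icc 0 T)] g) (hg : ∀ τ ∉ Icc 0 T, g τ = 0) (t s : ℝ) :
    volterra W T t f s = ∫ τ in t..s, g τ := by
  rw [volterra_apply]
  refine intervalIntegral.integral_congr_ae' ?_ ?_ <;>
  · filter_upwards [(ae_restrict_iff' measurableSet_Icc).1 h] with τ e _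
    by_cases hτ : τ ∈ Icc 0 T
    · rw [indicator_of_mem hτ, e hτ]
    · rw [indicator_of_notMem hτ, hg τ hτ]

theorem volterra_nemytskii (hb : IsLipField K T b) (γ : ℝ →ᵇ E) (t s : ℝ) :
    volterra W T t (nemytskii hb γ) s = ∫ τ in t..s, b τ (γ τ) :=
  volterra_eq (coeFn_nemytskii hb γ) (fun τ hτ => hb.supp τ hτ _) t s

theorem volterra_lpApply {A : ℝ → E → E →L[ℝ] W} (hA : IsLipField K T A) (γ h : ℝ →ᵇ E) (t s : ℝ) :
    volterra W T t (lpApply E W T (nemytskii hA γ) h) s = ∫ τ in t..s, A τ (γ τ) (h τ) := by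
  refine volterra_eq ?_ (fun τ hτ => ?_) t s
  · filter_upwards [coeFn_lpApply (nemytskii hA γ) h, coeFn_nemytskii hA γ] with τ e1 e2
    rw [e1, e2]
  · rw [hA.supp τ hτ, zero_apply]

theorem stronglyMeasurable_fderiv_of_param {a : ℝ → E → W}
    (ha : ∀ x, StronglyMeasurable fun s => a s x) (hd : ∀ s, Differentiable ℝ (a s)) (x : E) :
    StronglyMeasurable fun s => fderiv ℝ (a s) x := by
  have h1 : ∀ v, StronglyMeasurable fun s => fderiv ℝ (a s) x v := by
    intro v
    have hc : Tendsto (fun k : ℕ => (((k : ℝ) + 1))⁻¹) atTop (𝓝[≠] 0) := by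
      refine tendsto_nhdsWithin_iff.2 ⟨tendsto_inv_atTop_zero.comp
        (tendsto_natCast_atTop_atTop.atTop_add tendsto_const_nhds), Eventually.of_forall fun k => ?_⟩
      have : (0 : ℝ) < ((k : ℝ) + 1)⁻¹ := by positivity
      exact this.ne'
    refine stronglyMeasurable_of_tendsto atTop (f := fun (k : ℕ) s =>
      (((k : ℝ) + 1)⁻¹)⁻¹ • (a s (x + ((k : ℝ) + 1)⁻¹ • v) - a s x))
      (fun k => ((ha _).sub (ha _)).const_smul _) (tendsto_pi_nhds.2 fun s => ?_)
    exact ((hd s x).hasFDerivAt.hasLineDerivAt v).tendsto_slope_zero.comp hc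
  have h2 : (fun s => fderiv ℝ (a s) x) = fun s => ∑ i,
      ContinuousLinearMap.smulRightL ℝ E W
        (LinearMap.toContinuousLinearMap ((Module.finBasis ℝ E).coord i))
        (fderiv ℝ (a s) x (Module.finBasis ℝ E i)) := by
    funext s
    ext v
    simp only [_root_.sum_apply, ContinuousLinearMap.smulRightL_apply_apply]
    conv_lhs => rw [← (Module.finBasis ℝ E).sum_repr v, map_sum]
    simp only [map_smul]
    rfl
  rw [h2]
  exact Finset.stronglyMeasurable_fun_sum _ fun i _ =>
    (ContinuousLinearMap.continuous _).comp_stronglyMeasurable (h1 _)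

end Nemytskii

namespace IsFlowField

variable {E : Type*} [NormedAddCommGroup E] [NormedSpace ℝ E] [FiniteDimensional ℝ E]
  {M T : ℝ} {b : ℝ → E → E}

theorem nonneg (hb : IsFlowField M T b) : 0 ≤ M := (norm_nonneg _).trans ((hb.c2 0).bound 0)

theorem eq_zero (hb : IsFlowField M T b) {s : ℝ} (hs : s ∉ Icc 0 T) : b s = fun _ => 0 :=
  funext (hb.supp s hs)

theorem lip0 (hb : IsFlowField M T b) : IsLipField M T b where
  meas := hb.meas
  lip s _ _ := Convex.norm_image_sub_le_of_norm_fderiv_le (𝕜 := ℝ) (fun z _ => (hb.c2 s).diff z)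
    (fun z _ => (hb.c2 s).bound1 z) convex_univ (mem_univ _) (mem_univ _)
  bound0 s := (hb.c2 s).bound 0
  supp := hb.supp

theorem lip1 (hb : IsFlowField M T b) : IsLipField M T fun s => fderiv ℝ (b s) where
  meas := stronglyMeasurable_fderiv_of_param hb.meas fun s => (hb.c2 s).diff
  lip s _ _ := Convex.norm_image_sub_le_of_norm_fderiv_le (𝕜 := ℝ) (fun z _ => (hb.c2 s).diff2 z)
    (fun z _ => (hb.c2 s).bound2 z) convex_univ (mem_univ _) (mem_univ _)
  bound0 s := (hb.c2 s).bound1 0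
  supp s hs x := by rw [hb.eq_zero hs]; simp

theorem lip2 (hb : IsFlowField M T b) : IsLipField M T fun s => fderiv ℝ (fderiv ℝ (b s)) where
  meas := by
    have : CompleteSpace E := FiniteDimensional.complete ℝ E
    exact stronglyMeasurable_fderiv_of_param hb.lip1.meas fun s => (hb.c2 s).diff2
  lip s := (hb.c2 s).lip2
  bound0 s := (hb.c2 s).bound2 0
  supp s hs x := by
    have : fderiv ℝ (fun _ : E => (0 : E)) = fun _ => 0 := by funext x; simp
    rw [hb.eq_zero hs, this]; simp

end IsFlowField

/-! ### The flow of a vector field of class `C²` -/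

section Flow

open scoped BoundedContinuousFunction

variable {E : Type*} [NormedAddCommGroup E] [NormedSpace ℝ E] [FiniteDimensional ℝ E]
  [CompleteSpace E] {M T : ℝ} {b : ℝ → E → E}

theorem IsFlowField.linearized (hb : IsFlowField M T b) {γ : ℝ → E} (hγ : Continuous γ) :
    IsLipField M T fun τ (h : E) => fderiv ℝ (b τ) (γ τ) h where
  meas h := (ContinuousLinearMap.apply ℝ E h).continuous.comp_stronglyMeasurable
    (hb.lip1.comp_meas hγ)
  lip s x y := by
    rw [← map_sub]
    exact ContinuousLinearMap.le_of_opNorm_le _ ((hb.c2 s).bound1 _) _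
  bound0 s := by rw [map_zero, norm_zero]; exact hb.nonneg
  supp s hs x := by rw [hb.lip1.supp s hs, zero_apply]

/-- The map `γ ↦ γ - ∫_t b(τ, γ(τ)) dτ`. -/
noncomputable def flowEquation (hb : IsFlowField M T b) (t : ℝ) (γ : ℝ →ᵇ E) : ℝ →ᵇ E :=
  γ - volterra E T t (nemytskii hb.lip0 γ)

/-- The derivative of `flowEquation`. -/
noncomputable def flowEquationDeriv (hb : IsFlowField M T b) (t : ℝ) (γ : ℝ →ᵇ E) :
    (ℝ →ᵇ E) →L[ℝ] (ℝ →ᵇ E) :=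
  ContinuousLinearMap.id ℝ (ℝ →ᵇ E)
    - (volterra E T t).comp (lpApply E E T (nemytskii hb.lip1 γ))

theorem flowEquation_apply (hb : IsFlowField M T b) (t : ℝ) (γ : ℝ →ᵇ E) (s : ℝ) :
    flowEquation hb t γ s = γ s - ∫ τ in t..s, b τ (γ τ) := by
  rw [← volterra_nemytskii hb.lip0]; rfl

theorem flowEquationDeriv_apply (hb : IsFlowField M T b) (t : ℝ) (γ h : ℝ →ᵇ E) (s : ℝ) :
    flowEquationDeriv hb t γ h s = h s - ∫ τ in t..s, fderiv ℝ (b τ) (γ τ) (h τ) := by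
  rw [← volterra_lpApply hb.lip1]; rfl

theorem hasFDerivAt_flowEquation (hb : IsFlowField M T b) (t : ℝ) (γ : ℝ →ᵇ E) :
    HasFDerivAt (flowEquation hb t) (flowEquationDeriv hb t γ) γ :=
  (hasFDerivAt_id γ).sub ((volterra E T t).hasFDerivAt.comp γ
    (hasFDerivAt_nemytskii hb.lip0 hb.lip1 (fun s => (hb.c2 s).diff) γ))

theorem contDiff_flowEquation (hb : IsFlowField M T b) (t : ℝ) :
    ContDiff ℝ 2 (flowEquation hb t) :=
  contDiff_id.sub ((volterra E T t).contDiff.comp (contDiff_two_nemytskii hb.lip0 hb.lip1 hb.lip2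
    (fun s => (hb.c2 s).diff) fun s => (hb.c2 s).diff2))

theorem flowEquation_bijective (hb : IsFlowField M T b) (t : ℝ) :
    Function.Bijective (flowEquation hb t) := by
  refine ⟨fun γ γ' h => DFunLike.coe_injective ?_, fun y => ?_⟩
  · refine hb.lip0.solution_unique (t := t) γ.continuous γ'.continuous fun s => ?_
    rw [← flowEquation_apply hb, ← flowEquation_apply hb, h]
  · obtain ⟨γ, hγ⟩ := hb.lip0.exists_solution t y
    refine ⟨γ, ?_⟩
    ext s
    rw [flowEquation_apply, hγ, add_sub_cancel_right]

theorem flowEquationDeriv_bijective (hb : IsFlowField M T b) (t : ℝ) (γ : ℝ →ᵇ E) :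
    Function.Bijective (flowEquationDeriv hb t γ) := by
  have hl := hb.linearized γ.continuous
  refine ⟨fun h h' e => DFunLike.coe_injective ?_, fun y => ?_⟩
  · refine hl.solution_unique (t := t) h.continuous h'.continuous fun s => ?_
    rw [← flowEquationDeriv_apply hb, ← flowEquationDeriv_apply hb, e]
  · obtain ⟨h, hh⟩ := hl.exists_solution t y
    refine ⟨h, ?_⟩
    ext s
    rw [flowEquationDeriv_apply, hh, add_sub_cancel_right]

/-- The derivative of `flowEquation`, as an isomorphism. -/
noncomputable def flowEquationDerivEquiv (hb : IsFlowField M T b) (t : ℝ) (γ : ℝ →ᵇ E) :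
    (ℝ →ᵇ E) ≃L[ℝ] (ℝ →ᵇ E) :=
  ContinuousLinearEquiv.ofBijective (flowEquationDeriv hb t γ)
    (LinearMap.ker_eq_bot.2 (flowEquationDeriv_bijective hb t γ).1)
    (LinearMap.range_eq_top.2 (flowEquationDeriv_bijective hb t γ).2)

theorem coe_flowEquationDerivEquiv (hb : IsFlowField M T b) (t : ℝ) (γ : ℝ →ᵇ E) :
    (flowEquationDerivEquiv hb t γ : (ℝ →ᵇ E) →L[ℝ] (ℝ →ᵇ E)) = flowEquationDeriv hb t γ :=
  ContinuousLinearEquiv.coe_ofBijective _ _ _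

/-- `flowEquation` as a homeomorphism. -/
noncomputable def flowHomeomorph (hb : IsFlowField M T b) (t : ℝ) : (ℝ →ᵇ E) ≃ₜ (ℝ →ᵇ E) :=
  (Equiv.ofBijective _ (flowEquation_bijective hb t)).toHomeomorphOfContinuousOpen
    (contDiff_flowEquation hb t).continuous
    (isOpenMap_of_hasStrictFDerivAt_equiv (f' := flowEquationDerivEquiv hb t) fun γ => by
      rw [coe_flowEquationDerivEquiv, ← (hasFDerivAt_flowEquation hb t γ).fderiv]
      exact (contDiff_flowEquation hb t).contDiffAt.hasStrictFDerivAt (by simp))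

theorem contDiff_flowHomeomorph_symm (hb : IsFlowField M T b) (t : ℝ) :
    ContDiff ℝ 2 (flowHomeomorph hb t).symm :=
  (flowHomeomorph hb t).contDiff_symm (f₀' := flowEquationDerivEquiv hb t)
    (fun γ => by rw [coe_flowEquationDerivEquiv]; exact hasFDerivAt_flowEquation hb t γ)
    (contDiff_flowEquation hb t)

/-- Constant functions, as a continuous linear map. -/
noncomputable def constBCF (E : Type*) [NormedAddCommGroup E] [NormedSpace ℝ E] : E →L[ℝ] (ℝ →ᵇ E) :=
  LinearMap.mkContinuous
    { toFun := fun x => BoundedContinuousFunction.const ℝ x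
      map_add' := fun _ _ => rfl
      map_smul' := fun _ _ => rfl } 1 fun x => by
    rw [one_mul]
    exact BoundedContinuousFunction.norm_const_le x

/-- The trajectory through `x` at time `t`. -/
noncomputable def flowCurve (hb : IsFlowField M T b) (t : ℝ) (x : E) : ℝ →ᵇ E :=
  (flowHomeomorph hb t).symm (constBCF E x)

/-- The flow: `flow hb t s x` is the position at time `s` of the particle located at `x` at
time `t`. -/
noncomputable def flow (hb : IsFlowField M T b) (t s : ℝ) (x : E) : E := flowCurve hb t x s

theorem contDiff_flowCurve (hb : IsFlowField M T b) (t : ℝ) : ContDiff ℝ 2 (flowCurve hb t) :=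
  (contDiff_flowHomeomorph_symm hb t).comp (constBCF E).contDiff

theorem flowEquation_flowCurve (hb : IsFlowField M T b) (t : ℝ) (x : E) :
    flowEquation hb t (flowCurve hb t x) = constBCF E x :=
  (flowHomeomorph hb t).apply_symm_apply _

theorem flow_eq (hb : IsFlowField M T b) (t s : ℝ) (x : E) :
    flow hb t s x = x + ∫ τ in t..s, b τ (flow hb t τ x) := by
  have : flowEquation hb t (flowCurve hb t x) s = x := by rw [flowEquation_flowCurve]; rfl
  rw [flowEquation_apply, sub_eq_iff_eq_add] at this
  exact this

theorem continuous_flow_time (hb : IsFlowField M T b) (t : ℝ) (x : E) :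
    Continuous fun s => flow hb t s x := (flowCurve hb t x).continuous

theorem flow_hasFDerivAt (hb : IsFlowField M T b) (t s : ℝ) (x : E) :
    HasFDerivAt (flow hb t s)
      ((BoundedContinuousFunction.evalCLM ℝ s).comp (fderiv ℝ (flowCurve hb t) x)) x :=
  (BoundedContinuousFunction.evalCLM ℝ s : (ℝ →ᵇ E) →L[ℝ] E).hasFDerivAt.comp x
    ((contDiff_flowCurve hb t).differentiable (by simp) x).hasFDerivAt

theorem fderiv_flow (hb : IsFlowField M T b) (t s : ℝ) (x h : E) :
    fderiv ℝ (flow hb t s) x h = fderiv ℝ (flowCurve hb t) x h s := by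
  rw [(flow_hasFDerivAt hb t s x).fderiv]; rfl

theorem contDiff_flow (hb : IsFlowField M T b) (t s : ℝ) : ContDiff ℝ 2 (flow hb t s) :=
  (BoundedContinuousFunction.evalCLM (𝕜 := ℝ) s : (ℝ →ᵇ E) →L[ℝ] E).contDiff.comp
    (contDiff_flowCurve hb t)

theorem fderiv_flow_eq (hb : IsFlowField M T b) (t s : ℝ) (x h : E) :
    fderiv ℝ (flow hb t s) x h
      = h + ∫ τ in t..s, fderiv ℝ (b τ) (flow hb t τ x) (fderiv ℝ (flow hb t τ) x h) := by
  have h1 := (hasFDerivAt_flowEquation hb t (flowCurve hb t x)).comp x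
    ((contDiff_flowCurve hb t).differentiable (by simp) x).hasFDerivAt
  have h2 : flowEquation hb t ∘ flowCurve hb t = constBCF E :=
    funext (flowEquation_flowCurve hb t)
  rw [h2] at h1
  have h3 := DFunLike.congr_fun (DFunLike.congr_fun
    (h1.unique (constBCF E).hasFDerivAt) h) s
  rw [ContinuousLinearMap.comp_apply, flowEquationDeriv_apply, sub_eq_iff_eq_add] at h3
  simp only [fderiv_flow]
  exact h3

theorem continuous_fderiv_flow_time (hb : IsFlowField M T b) (t : ℝ) (x h : E) :
    Continuous fun s => fderiv ℝ (flow hb t s) x h := by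
  simp only [fderiv_flow]
  exact (fderiv ℝ (flowCurve hb t) x h).continuous

theorem flow_unique (hb : IsFlowField M T b) {t : ℝ} {x : E} {γ : ℝ → E} (hγ : Continuous γ)
    (h : ∀ s, γ s = x + ∫ τ in t..s, b τ (γ τ)) (s : ℝ) : γ s = flow hb t s x := by
  refine congrFun (hb.lip0.solution_unique (t := t) hγ (continuous_flow_time hb t x)
    fun s => ?_) s
  rw [sub_eq_iff_eq_add.2 (h s), sub_eq_iff_eq_add.2 (flow_eq hb t s x)]

theorem flow_integrable (hb : IsFlowField M T b) (t : ℝ) (x : E) :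
    Integrable fun τ => b τ (flow hb t τ x) :=
  hb.lip0.integrable (continuous_flow_time hb t x)

theorem flow_self (hb : IsFlowField M T b) (t : ℝ) (x : E) : flow hb t t x = x := by
  rw [flow_eq]; simp

theorem flow_sub_flow (hb : IsFlowField M T b) (t s r : ℝ) (x : E) :
    flow hb t r x = flow hb t s x + ∫ τ in s..r, b τ (flow hb t τ x) := by
  have hi := fun a c => (flow_integrable hb t x).intervalIntegrable (a := a) (b := c)
  rw [flow_eq hb t r, flow_eq hb t s, add_assoc,
    intervalIntegral.integral_add_adjacent_intervals (hi _ _) (hi _ _)]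

theorem flow_flow (hb : IsFlowField M T b) (t s r : ℝ) (x : E) :
    flow hb s r (flow hb t s x) = flow hb t r x :=
  (flow_unique hb (continuous_flow_time hb t x) (fun r => flow_sub_flow hb t s r x) r).symm

theorem flow_inv (hb : IsFlowField M T b) (t s : ℝ) (x : E) : flow hb s t (flow hb t s x) = x := by
  rw [flow_flow, flow_self]

theorem norm_flow_sub_time_le (hb : IsFlowField M T b) (t s r : ℝ) (x : E) :
    ‖flow hb t s x - flow hb t r x‖ ≤ M * |s - r| := by
  rw [flow_sub_flow hb t r s, add_sub_cancel_left]
  exact intervalIntegral.norm_integral_le_of_norm_le_const fun τ _ => (hb.c2 τ).bound _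

theorem norm_flow_sub_le (hb : IsFlowField M T b) (t s : ℝ) (x y : E) :
    ‖flow hb t s x - flow hb t s y‖ ≤ Real.exp (M * |s - t|) * ‖x - y‖ := by
  rw [mul_comm]
  refine hb.lip0.dist_solution_le (t := t) (continuous_flow_time hb t x)
    (continuous_flow_time hb t y) (fun s => ?_) s
  rw [sub_eq_iff_eq_add.2 (flow_eq hb t s x), sub_eq_iff_eq_add.2 (flow_eq hb t s y)]

theorem lipschitzWith_flow (hb : IsFlowField M T b) (t s : ℝ) :
    LipschitzWith (Real.exp (M * |s - t|)).toNNReal (flow hb t s) :=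
  LipschitzWith.of_dist_le_mul fun x y => by
    rw [dist_eq_norm, dist_eq_norm, Real.coe_toNNReal _ (Real.exp_pos _).le]
    exact norm_flow_sub_le hb t s x y

theorem norm_fderiv_flow_le (hb : IsFlowField M T b) (t s : ℝ) (x : E) :
    ‖fderiv ℝ (flow hb t s) x‖ ≤ Real.exp (M * |s - t|) := by
  have := norm_fderiv_le_of_lipschitz ℝ (lipschitzWith_flow hb t s) (x₀ := x)
  rwa [Real.coe_toNNReal _ (Real.exp_pos _).le] at this

theorem norm_inv_flow_sub_time_le (hb : IsFlowField M T b) (t s r : ℝ) (x : E) :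
    ‖flow hb s t x - flow hb r t x‖ ≤ M * Real.exp (M * |r - t|) * |s - r| := by
  rw [← flow_flow hb s r t x]
  have h1 := norm_flow_sub_le hb r t (flow hb s r x) x
  have h2 := norm_flow_sub_time_le hb s r s x
  rw [flow_self] at h2
  rw [abs_sub_comm t r] at h1
  rw [abs_sub_comm r s] at h2
  calc _ ≤ _ := h1
    _ ≤ Real.exp (M * |r - t|) * (M * |s - r|) := by gcongr
    _ = _ := by ring

theorem abs_sub_le_of_mem_Icc {T t s : ℝ} (ht : t ∈ Icc 0 T) (hs : s ∈ Icc 0 T) : |s - t| ≤ T :=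
  abs_sub_le_iff.2 ⟨by linarith [hs.2, ht.1], by linarith [hs.1, ht.2]⟩

theorem norm_intervalIntegral_le_of_supp {W : Type*} [NormedAddCommGroup W] [NormedSpace ℝ W]
    {g : ℝ → W} {C : ℝ} (hT : 0 ≤ T) (hC : ∀ τ ∈ Icc 0 T, ‖g τ‖ ≤ C)
    (h0 : ∀ τ ∉ Icc 0 T, g τ = 0) (t s : ℝ) : ‖∫ τ in t..s, g τ‖ ≤ T * C := by
  have hC0 : 0 ≤ C := (norm_nonneg _).trans (hC 0 ⟨le_rfl, hT⟩)
  have hi : Integrable ((Icc 0 T).indicator fun _ : ℝ => C) :=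
    (integrable_indicator_iff measurableSet_Icc).2 (integrableOn_const (by simp))
  have h1 : ∀ τ, ‖g τ‖ ≤ (Icc 0 T).indicator (fun _ => C) τ := by
    intro τ
    by_cases hτ : τ ∈ Icc 0 T
    · rw [indicator_of_mem hτ]; exact hC τ hτ
    · rw [indicator_of_notMem hτ, h0 τ hτ, norm_zero]
  have h2 := intervalIntegral.norm_integral_le_abs_of_norm_le (a := t) (b := s) (ae_of_all _ h1)
    hi.intervalIntegrable
  refine h2.trans ?_
  rw [← Real.norm_eq_abs]
  refine intervalIntegral.norm_integral_le_integral_norm_uIoc.trans ?_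
  refine (setIntegral_le_integral hi.norm (Eventually.of_forall fun _ => norm_nonneg _)).trans ?_
  simp only [norm_indicator_eq_indicator_norm]
  rw [integral_indicator measurableSet_Icc, setIntegral_const, Real.norm_of_nonneg hC0]
  simp [Measure.real, hT]

theorem norm_fderiv_flow_sub_le (hT : 0 ≤ T) (hb : IsFlowField M T b) {t s : ℝ} (ht : t ∈ Icc 0 T)
    (hs : s ∈ Icc 0 T) (x y : E) :
    ‖fderiv ℝ (flow hb t s) x - fderiv ℝ (flow hb t s) y‖
      ≤ T * M * Real.exp (M * T) ^ 3 * ‖x - y‖ := by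
  have hM := hb.nonneg
  set e := Real.exp (M * T) with he
  have hee : ∀ s ∈ Icc 0 T, Real.exp (M * |s - t|) ≤ e := fun s hs => by
    rw [he]; gcongr; exact abs_sub_le_of_mem_Icc ht hs
  refine ContinuousLinearMap.opNorm_le_bound _ (by positivity) fun h => ?_
  rw [sub_apply]
  have hx := continuous_fderiv_flow_time hb t x h
  have hy := continuous_fderiv_flow_time hb t y h
  have hl := hb.linearized (continuous_flow_time hb t y)
  have key := hl.dist_solution_le (t := t) hx hy (d := T * (M * (e * ‖x - y‖) * (e * ‖h‖)))
    (fun s => ?_) s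
  · refine key.trans ((mul_le_mul_of_nonneg_left (hee s hs) (by positivity)).trans (le_of_eq ?_))
    ring
  · have i1 := ((hb.linearized (continuous_flow_time hb t x)).integrable hx).intervalIntegrable
      (a := t) (b := s)
    have i2 := (hl.integrable hx).intervalIntegrable (a := t) (b := s)
    have e1 : (fderiv ℝ (flow hb t s) x h
        - ∫ τ in t..s, fderiv ℝ (b τ) (flow hb t τ y) (fderiv ℝ (flow hb t τ) x h))
        - (fderiv ℝ (flow hb t s) y h
          - ∫ τ in t..s, fderiv ℝ (b τ) (flow hb t τ y) (fderiv ℝ (flow hb t τ) y h))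
        = ∫ τ in t..s, (fderiv ℝ (b τ) (flow hb t τ x) (fderiv ℝ (flow hb t τ) x h)
          - fderiv ℝ (b τ) (flow hb t τ y) (fderiv ℝ (flow hb t τ) x h)) := by
      rw [intervalIntegral.integral_sub i1 i2, fderiv_flow_eq hb t s x h,
        sub_eq_iff_eq_add.2 ((fderiv_flow_eq hb t s y h))]
      abel
    rw [e1]
    refine norm_intervalIntegral_le_of_supp hT (fun τ hτ => ?_) (fun τ hτ => ?_) t s
    · rw [← sub_apply]
      refine ContinuousLinearMap.le_of_opNorm_le_of_le _
        ((hb.lip1.lip τ _ _).trans (mul_le_mul_of_nonneg_left ?_ hM))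
        (ContinuousLinearMap.le_of_opNorm_le _ ((norm_fderiv_flow_le hb t τ x).trans (hee τ hτ)) h)
      exact (norm_flow_sub_le hb t τ x y).trans
        (mul_le_mul_of_nonneg_right (hee τ hτ) (norm_nonneg _))
    · rw [hb.lip1.supp τ hτ, hb.lip1.supp τ hτ, sub_self]

theorem norm_fderiv_fderiv_flow_le (hT : 0 ≤ T) (hb : IsFlowField M T b) {t s : ℝ}
    (ht : t ∈ Icc 0 T) (hs : s ∈ Icc 0 T) (x : E) :
    ‖fderiv ℝ (fderiv ℝ (flow hb t s)) x‖ ≤ T * M * Real.exp (M * T) ^ 3 := by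
  have hM := hb.nonneg
  have h0 : 0 ≤ T * M * Real.exp (M * T) ^ 3 := by positivity
  exact norm_fderiv_le_of_lipschitz (C := ⟨_, h0⟩) ℝ (LipschitzWith.of_dist_le_mul fun x y => by
    rw [dist_eq_norm, dist_eq_norm]
    exact norm_fderiv_flow_sub_le hT hb ht hs x y)

/-! Integrals of functions along the flow. -/

section AlongFlow

variable {W : Type*} [NormedAddCommGroup W] [NormedSpace ℝ W] [CompleteSpace W]
  {K : ℝ} {a : ℝ → E → W}

theorem hasFDerivAt_integral_flow (hb : IsFlowField M T b) (ha : IsLipField K T a)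
    (hD : IsLipField K T fun s => fderiv ℝ (a s)) (hd : ∀ s, Differentiable ℝ (a s)) (t s : ℝ)
    (x : E) :
    HasFDerivAt (fun x => ∫ τ in t..s, a τ (flow hb t τ x))
      (((BoundedContinuousFunction.evalCLM ℝ s).comp (volterra W T t)).comp
        ((lpApply E W T (nemytskii hD (flowCurve hb t x))).comp (fderiv ℝ (flowCurve hb t) x))) x := by
  have h1 := ((BoundedContinuousFunction.evalCLM ℝ s).comp (volterra W T t)).hasFDerivAt.comp x
    ((hasFDerivAt_nemytskii ha hD hd (flowCurve hb t x)).comp x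
    ((contDiff_flowCurve hb t).differentiable (by simp) x).hasFDerivAt)
  refine h1.congr_of_eventuallyEq (Eventually.of_forall fun y => ?_)
  exact (volterra_nemytskii ha (flowCurve hb t y) t s).symm

theorem contDiff_integral_flow (hb : IsFlowField M T b) (ha : IsLipField K T a)
    (hD : IsLipField K T fun s => fderiv ℝ (a s)) (hd : ∀ s, Differentiable ℝ (a s)) (t s : ℝ) :
    ContDiff ℝ 1 (fun x => ∫ τ in t..s, a τ (flow hb t τ x)) := by
  have h1 := ((BoundedContinuousFunction.evalCLM ℝ s).comp (volterra W T t)).contDiff.comp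
    ((contDiff_one_nemytskii ha hD hd).comp ((contDiff_flowCurve hb t).of_le (by norm_num)))
  convert h1 using 1
  funext y
  exact (volterra_nemytskii ha (flowCurve hb t y) t s).symm

theorem fderiv_integral_flow (hb : IsFlowField M T b) (ha : IsLipField K T a)
    (hD : IsLipField K T fun s => fderiv ℝ (a s)) (hd : ∀ s, Differentiable ℝ (a s)) (t s : ℝ)
    (x h : E) :
    fderiv ℝ (fun x => ∫ τ in t..s, a τ (flow hb t τ x)) x h
      = ∫ τ in t..s, fderiv ℝ (a τ) (flow hb t τ x) (fderiv ℝ (flow hb t τ) x h) := by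
  rw [(hasFDerivAt_integral_flow hb ha hD hd t s x).fderiv]
  simp only [fderiv_flow]
  exact volterra_lpApply hD (flowCurve hb t x) (fderiv ℝ (flowCurve hb t) x h) t s

theorem norm_fderiv_le_of_lipField (ha : IsLipField K T a) (s : ℝ) (x : E) :
    ‖fderiv ℝ (a s) x‖ ≤ K :=
  norm_fderiv_le_of_lipschitz (C := ⟨K, ha.nonneg⟩) ℝ (LipschitzWith.of_dist_le_mul fun x y => by
    rw [dist_eq_norm, dist_eq_norm]
    exact ha.lip s x y)

theorem norm_fderiv_integral_flow_le (hT : 0 ≤ T) (hb : IsFlowField M T b) (ha : IsLipField K T a)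
    (hD : IsLipField K T fun s => fderiv ℝ (a s)) (hd : ∀ s, Differentiable ℝ (a s)) {t : ℝ}
    (ht : t ∈ Icc 0 T) (s : ℝ) (x : E) :
    ‖fderiv ℝ (fun x => ∫ τ in t..s, a τ (flow hb t τ x)) x‖ ≤ T * (K * Real.exp (M * T)) := by
  have hM := hb.nonneg
  have hK := ha.nonneg
  refine ContinuousLinearMap.opNorm_le_bound _ (by positivity) fun h => ?_
  rw [fderiv_integral_flow hb ha hD hd, mul_assoc, mul_assoc]
  refine norm_intervalIntegral_le_of_supp hT (fun τ hτ => ?_) (fun τ hτ => ?_) t s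
  · refine ContinuousLinearMap.le_of_opNorm_le_of_le _ (norm_fderiv_le_of_lipField ha _ _)
      (ContinuousLinearMap.le_of_opNorm_le _ ((norm_fderiv_flow_le hb t τ x).trans ?_) h)
    gcongr
    exact abs_sub_le_of_mem_Icc ht hτ
  · rw [hD.supp τ hτ, zero_apply]

theorem norm_fderiv_integral_flow_sub_le (hT : 0 ≤ T) (hb : IsFlowField M T b)
    (ha : IsLipField K T a) (hD : IsLipField K T fun s => fderiv ℝ (a s))
    (hd : ∀ s, Differentiable ℝ (a s)) {t : ℝ} (ht : t ∈ Icc 0 T) (s : ℝ) (x y : E) :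
    ‖fderiv ℝ (fun x => ∫ τ in t..s, a τ (flow hb t τ x)) x
      - fderiv ℝ (fun x => ∫ τ in t..s, a τ (flow hb t τ x)) y‖
      ≤ T * (K * Real.exp (M * T) ^ 2 + K * (T * M * Real.exp (M * T) ^ 3)) * ‖x - y‖ := by
  have hM := hb.nonneg
  have hK := ha.nonneg
  set e := Real.exp (M * T) with he
  have hee : ∀ s ∈ Icc 0 T, Real.exp (M * |s - t|) ≤ e := fun s hs => by
    rw [he]; gcongr; exact abs_sub_le_of_mem_Icc ht hs
  refine ContinuousLinearMap.opNorm_le_bound _ (by positivity) fun h => ?_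
  have hi : ∀ x, IntervalIntegrable (fun τ => fderiv ℝ (a τ) (flow hb t τ x)
      (fderiv ℝ (flow hb t τ) x h)) volume t s := by
    intro x
    have hc := continuous_fderiv_flow_time hb t x h
    have hl : IsLipField K T fun τ (h : E) => fderiv ℝ (a τ) (flow hb t τ x) h :=
      { meas := fun h => (ContinuousLinearMap.apply ℝ W h).continuous.comp_stronglyMeasurable
          (hD.comp_meas (continuous_flow_time hb t x))
        lip := fun s x y => by
          rw [← map_sub]
          exact ContinuousLinearMap.le_of_opNorm_le _ (norm_fderiv_le_of_lipField ha _ _) _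
        bound0 := fun s => by rw [map_zero, norm_zero]; exact hK
        supp := fun s hs x => by rw [hD.supp s hs, zero_apply] }
    exact (hl.integrable hc).intervalIntegrable
  rw [sub_apply, fderiv_integral_flow hb ha hD hd, fderiv_integral_flow hb ha hD hd,
    ← intervalIntegral.integral_sub (hi x) (hi y), mul_assoc, mul_assoc]
  refine norm_intervalIntegral_le_of_supp hT (fun τ hτ => ?_) (fun τ hτ => ?_) t s
  · have e1 : fderiv ℝ (a τ) (flow hb t τ x) (fderiv ℝ (flow hb t τ) x h)
        - fderiv ℝ (a τ) (flow hb t τ y) (fderiv ℝ (flow hb t τ) y h)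
        = (fderiv ℝ (a τ) (flow hb t τ x) - fderiv ℝ (a τ) (flow hb t τ y))
            (fderiv ℝ (flow hb t τ) x h)
          + fderiv ℝ (a τ) (flow hb t τ y)
            ((fderiv ℝ (flow hb t τ) x - fderiv ℝ (flow hb t τ) y) h) := by
      simp only [sub_apply, map_sub]; abel
    rw [e1]
    have n1 : ‖(fderiv ℝ (a τ) (flow hb t τ x) - fderiv ℝ (a τ) (flow hb t τ y))
            (fderiv ℝ (flow hb t τ) x h)‖ ≤ K * (e * ‖x - y‖) * (e * ‖h‖) := by
      refine ContinuousLinearMap.le_of_opNorm_le_of_le _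
        ((hD.lip τ _ _).trans (mul_le_mul_of_nonneg_left ?_ hK))
        (ContinuousLinearMap.le_of_opNorm_le _ ((norm_fderiv_flow_le hb t τ x).trans (hee τ hτ)) h)
      exact (norm_flow_sub_le hb t τ x y).trans
        (mul_le_mul_of_nonneg_right (hee τ hτ) (norm_nonneg _))
    have n2 : ‖fderiv ℝ (a τ) (flow hb t τ y)
            ((fderiv ℝ (flow hb t τ) x - fderiv ℝ (flow hb t τ) y) h)‖
          ≤ K * ((T * M * e ^ 3 * ‖x - y‖) * ‖h‖) :=
      ContinuousLinearMap.le_of_opNorm_le_of_le _ (norm_fderiv_le_of_lipField ha _ _)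
        (ContinuousLinearMap.le_of_opNorm_le _ (norm_fderiv_flow_sub_le hT hb ht hτ x y) h)
    refine (norm_add_le_of_le n1 n2).trans (le_of_eq ?_)
    ring
  · rw [hD.supp τ hτ, hD.supp τ hτ, zero_apply, zero_apply, sub_self]

end AlongFlow

end Flow

/-! ### Liouville's formula -/

section Determinant

variable {E : Type*} [NormedAddCommGroup E] [NormedSpace ℝ E] [FiniteDimensional ℝ E]

/-- The trace, as a continuous linear functional on endomorphisms. -/
noncomputable def traceCLM (E : Type*) [NormedAddCommGroup E] [NormedSpace ℝ E]
    [FiniteDimensional ℝ E] : (E →L[ℝ] E) →L[ℝ] ℝ :=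
  LinearMap.toContinuousLinearMap ((LinearMap.trace ℝ E).comp (ContinuousLinearMap.coeLM ℝ))

theorem traceCLM_apply (A : E →L[ℝ] E) : traceCLM E A = LinearMap.trace ℝ E A := rfl

theorem contDiff_det : ContDiff ℝ ∞ fun A : E →L[ℝ] E => A.det := by
  have h : (fun A : E →L[ℝ] E => A.det) = fun A : E →L[ℝ] E => Matrix.det
      (LinearMap.toMatrix (Module.finBasis ℝ E) (Module.finBasis ℝ E) (A : E →ₗ[ℝ] E)) := by
    funext A
    exact (LinearMap.det_toMatrix _ _).symm
  rw [h]
  simp only [Matrix.det_apply, LinearMap.toMatrix_apply]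
  refine ContDiff.sum fun σ _ => ContDiff.const_smul _ (contDiff_prod fun i _ => ?_)
  exact ((LinearMap.toContinuousLinearMap ((Module.finBasis ℝ E).coord (σ i))).comp
    (ContinuousLinearMap.apply ℝ E (Module.finBasis ℝ E i))).contDiff

theorem hasDerivAt_det_one_add_smul (A : E →L[ℝ] E) :
    HasDerivAt (fun r : ℝ => (1 + r • A).det) (traceCLM E A) 0 := by
  set e := Module.finBasis ℝ E
  set m := LinearMap.toMatrix e e (A : E →ₗ[ℝ] E) with hm
  have h : ∀ r : ℝ, (1 + r • A).det = Matrix.det (1 + r • m) := by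
    intro r
    change LinearMap.det ((1 + r • A : E →L[ℝ] E) : E →ₗ[ℝ] E) = _
    rw [← LinearMap.det_toMatrix e]
    congr 1
    simp [hm, LinearMap.toMatrix_one]
  have htr : traceCLM E A = Matrix.trace m := by
    rw [traceCLM_apply, LinearMap.trace_eq_matrix_trace ℝ e]
  rw [htr]
  set p := (Matrix.det (1 + (Polynomial.X : Polynomial ℝ) • m.map Polynomial.C)).divX.divX
  have h1 := ((hasDerivAt_id (0 : ℝ)).const_mul (Matrix.trace m)).const_add 1
  have h2 := (p.hasDerivAt (0 : ℝ)).mul ((hasDerivAt_id (0 : ℝ)).pow 2)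
  have h3 : (fun r : ℝ => (1 + r • A).det) = fun r => 1 + Matrix.trace m * r + p.eval r * r ^ 2 :=
    funext fun r => by rw [h, Matrix.det_one_add_smul]
  rw [h3]
  refine (h1.add h2).congr_deriv ?_
  simp

/-- Jacobi's formula. -/
theorem hasDerivAt_det {Y : ℝ → E →L[ℝ] E} {A : E →L[ℝ] E} {τ : ℝ}
    (h : HasDerivAt Y (A.comp (Y τ)) τ) :
    HasDerivAt (fun τ => (Y τ).det) (traceCLM E A * (Y τ).det) τ := by
  have hd : ∀ B, HasFDerivAt (fun A : E →L[ℝ] E => A.det) (fderiv ℝ (fun A => A.det) B) B :=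
    fun B => (contDiff_det.differentiable (by simp) B).hasFDerivAt
  have h1 := (hd (Y τ)).comp_hasDerivAt τ h
  refine h1.congr_deriv ?_
  have h2 : HasDerivAt (fun r : ℝ => Y τ + r • A.comp (Y τ)) (A.comp (Y τ)) 0 := by
    simpa using ((hasDerivAt_id (0 : ℝ)).smul_const (A.comp (Y τ))).const_add (Y τ)
  have h3 := (hd (Y τ + (0 : ℝ) • A.comp (Y τ))).comp_hasDerivAt (0 : ℝ) h2
  have h4 : (fun A : E →L[ℝ] E => A.det) ∘ (fun r : ℝ => Y τ + r • A.comp (Y τ))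
      = fun r : ℝ => (1 + r • A).det * (Y τ).det := by
    funext r
    have : Y τ + r • A.comp (Y τ) = (1 + r • A) * Y τ := by
      rw [add_mul, one_mul, smul_mul_assoc]; rfl
    simp only [Function.comp, this]
    exact LinearMap.det_comp _ _
  rw [h4, zero_smul, add_zero] at h3
  exact h3.unique ((hasDerivAt_det_one_add_smul A).mul_const _)

end Determinant

section LipschitzCurves

variable {Z : Type*} [NormedAddCommGroup Z] [NormedSpace ℝ Z]

theorem absolutelyContinuous_comp_of_contDiff {F : Type*} [NormedAddCommGroup F] [NormedSpace ℝ F]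
    {c : ℝ → Z} {K : NNReal} (hc : LipschitzWith K c) {H : Z → F} (hH : ContDiff ℝ 1 H) (t s : ℝ) :
    AbsolutelyContinuousOnInterval (H ∘ c) t s := by
  have h1 : LocallyLipschitz (H ∘ c) := hH.locallyLipschitz.comp hc.locallyLipschitz
  obtain ⟨C, hC⟩ := (h1.locallyLipschitzOn (s := uIcc t s)).exists_lipschitzOnWith_of_compact
    isCompact_uIcc
  exact hC.absolutelyContinuousOnInterval

theorem lipschitzWith_of_integral_eq [CompleteSpace Z] {c g : ℝ → Z} {K : ℝ} (hK : 0 ≤ K)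
    (hc : ∀ t s, c s - c t = ∫ τ in t..s, g τ) (hgK : ∀ τ, ‖g τ‖ ≤ K) :
    LipschitzWith ⟨K, hK⟩ c :=
  LipschitzWith.of_dist_le_mul fun s t => by
    rw [dist_eq_norm, hc t s, Real.dist_eq]
    exact intervalIntegral.norm_integral_le_of_norm_le_const fun τ _ => hgK τ

end LipschitzCurves

section Liouville

variable {E : Type*} [NormedAddCommGroup E] [NormedSpace ℝ E] [FiniteDimensional ℝ E]
  [CompleteSpace E] {M T : ℝ} {b : ℝ → E → E}

theorem IsLipField.clm_comp {W W' : Type*} [NormedAddCommGroup W] [NormedSpace ℝ W]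
    [NormedAddCommGroup W'] [NormedSpace ℝ W'] {K : ℝ} {a : ℝ → E → W} (ha : IsLipField K T a)
    (L : W →L[ℝ] W') : IsLipField (‖L‖ * K) T fun s x => L (a s x) where
  meas x := L.continuous.comp_stronglyMeasurable (ha.meas x)
  lip s x y := by
    rw [← map_sub, mul_assoc]
    exact L.le_opNorm_of_le (ha.lip s x y)
  bound0 s := L.le_opNorm_of_le (ha.bound0 s)
  supp s hs x := by rw [ha.supp s hs, map_zero]

theorem IsFlowField.trace_lip (hb : IsFlowField M T b) :
    IsLipField (‖traceCLM E‖ * M) T fun s x => traceCLM E (fderiv ℝ (b s) x) :=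
  hb.lip1.clm_comp _

theorem IsFlowField.trace_diff (hb : IsFlowField M T b) (s : ℝ) :
    Differentiable ℝ fun x => traceCLM E (fderiv ℝ (b s) x) :=
  (traceCLM E).differentiable.comp (hb.c2 s).diff2

theorem IsFlowField.trace_fderiv_lip (hb : IsFlowField M T b) :
    IsLipField (‖traceCLM E‖ * M) T
      fun s => fderiv ℝ fun x => traceCLM E (fderiv ℝ (b s) x) := by
  have h1 : (fun s => fderiv ℝ fun x => traceCLM E (fderiv ℝ (b s) x))
      = fun s x => ContinuousLinearMap.compL ℝ E (E →L[ℝ] E) ℝ (traceCLM E)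
          (fderiv ℝ (fderiv ℝ (b s)) x) := by
    funext s x
    exact ((traceCLM E).hasFDerivAt.comp x ((hb.c2 s).diff2 x).hasFDerivAt).fderiv
  rw [h1]
  have h2 := hb.lip2.clm_comp (ContinuousLinearMap.compL ℝ E (E →L[ℝ] E) ℝ (traceCLM E))
  have h3 : ‖ContinuousLinearMap.compL ℝ E (E →L[ℝ] E) ℝ (traceCLM E)‖ ≤ ‖traceCLM E‖ :=
    ContinuousLinearMap.opNorm_le_bound _ (norm_nonneg (traceCLM E)) fun A =>
      ContinuousLinearMap.opNorm_comp_le _ _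
  have h4 := mul_le_mul_of_nonneg_right h3 hb.nonneg
  exact ⟨h2.meas, fun s x y => (h2.lip s x y).trans
    (mul_le_mul_of_nonneg_right h4 (norm_nonneg _)), fun s => (h2.bound0 s).trans h4, h2.supp⟩

/-- The logarithm of the Jacobian determinant of the flow. -/
noncomputable def logJacobian (hb : IsFlowField M T b) (t s : ℝ) (x : E) : ℝ :=
  ∫ τ in t..s, traceCLM E (fderiv ℝ (b τ) (flow hb t τ x))

theorem logJacobian_integrable (hb : IsFlowField M T b) (t : ℝ) (x : E) :
    Integrable fun τ => traceCLM E (fderiv ℝ (b τ) (flow hb t τ x)) :=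
  hb.trace_lip.integrable (continuous_flow_time hb t x)

theorem fderiv_flow_self (hb : IsFlowField M T b) (t : ℝ) (x : E) :
    fderiv ℝ (flow hb t t) x = ContinuousLinearMap.id ℝ E := by
  have : flow hb t t = id := funext (flow_self hb t)
  rw [this, fderiv_id]

theorem IsFlowField.variational_lip (hb : IsFlowField M T b) {γ : ℝ → E} (hγ : Continuous γ) :
    IsLipField M T fun τ (Y : E →L[ℝ] E) => (fderiv ℝ (b τ) (γ τ)).comp Y where
  meas Y := by
    have : Continuous fun A : E →L[ℝ] E => A.comp Y := by fun_prop
    exact this.comp_stronglyMeasurable (hb.lip1.comp_meas hγ)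
  lip s x y := by
    rw [← ContinuousLinearMap.comp_sub]
    exact (ContinuousLinearMap.opNorm_comp_le _ _).trans
      (mul_le_mul_of_nonneg_right ((hb.c2 s).bound1 _) (norm_nonneg _))
  bound0 s := by rw [ContinuousLinearMap.comp_zero, norm_zero]; exact hb.nonneg
  supp s hs x := by rw [hb.lip1.supp s hs, ContinuousLinearMap.zero_comp]

theorem fderiv_flow_eq_integral (hb : IsFlowField M T b) (t s r : ℝ) (x : E) :
    fderiv ℝ (flow hb t r) x - fderiv ℝ (flow hb t s) x
      = ∫ τ in s..r, (fderiv ℝ (b τ) (flow hb t τ x)).comp (fderiv ℝ (flow hb t τ) x) := by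
  have hYc : Continuous fun τ => fderiv ℝ (flow hb t τ) x :=
    continuous_clm_apply.2 fun h => continuous_fderiv_flow_time hb t x h
  have hi := (hb.variational_lip (continuous_flow_time hb t x)).integrable hYc
  ext h
  have hi2 := fun a c => ((hb.linearized (continuous_flow_time hb t x)).integrable
    (continuous_fderiv_flow_time hb t x h)).intervalIntegrable (a := a) (b := c)
  rw [sub_apply, fderiv_flow_eq hb t r, fderiv_flow_eq hb t s, add_sub_add_left_eq_sub,
    intervalIntegral.integral_interval_sub_left (hi2 _ _) (hi2 _ _),
    ContinuousLinearMap.intervalIntegral_apply hi.intervalIntegrable]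
  rfl

/-- **Liouville's formula**. -/
theorem det_fderiv_flow (hb : IsFlowField M T b) {t : ℝ} (ht : t ∈ Icc 0 T) (s : ℝ)
    (x : E) : (fderiv ℝ (flow hb t s) x).det = Real.exp (logJacobian hb t s x) := by
  have hM := hb.nonneg
  set Y := fun τ => fderiv ℝ (flow hb t τ) x with hY
  set A := fun τ => fderiv ℝ (b τ) (flow hb t τ x) with hA
  have hYc : Continuous Y := continuous_clm_apply.2 fun h => continuous_fderiv_flow_time hb t x h
  have hi : Integrable fun τ => (A τ).comp (Y τ) :=
    (hb.variational_lip (continuous_flow_time hb t x)).integrable hYc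
  have hit := logJacobian_integrable hb t x
  have hYe : ∀ r s, Y s - Y r = ∫ τ in r..s, (A τ).comp (Y τ) := fun r s =>
    fderiv_flow_eq_integral hb t r s x
  have hYl := lipschitzWith_of_integral_eq (K := M * Real.exp (M * T)) (by positivity) hYe
    (fun τ => by
      by_cases hτ : τ ∈ Icc 0 T
      · refine (ContinuousLinearMap.opNorm_comp_le _ _).trans
          (mul_le_mul ((hb.c2 τ).bound1 _) ((norm_fderiv_flow_le hb t τ x).trans ?_)
            (norm_nonneg _) hM)
        gcongr
        exact abs_sub_le_of_mem_Icc ht hτ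
      · have : A τ = 0 := hb.lip1.supp τ hτ _
        rw [this, ContinuousLinearMap.zero_comp, norm_zero]; positivity)
  have hll := lipschitzWith_of_integral_eq (c := fun s => logJacobian hb t s x)
    (K := ‖traceCLM E‖ * M) (by positivity) (fun r s =>
      intervalIntegral.integral_interval_sub_left hit.intervalIntegrable hit.intervalIntegrable)
      (fun τ => (traceCLM E).le_opNorm_of_le ((hb.c2 τ).bound1 _))
  set H : (E →L[ℝ] E) × ℝ → ℝ := fun z => z.1.det * Real.exp (- z.2) with hH
  have hHc : ContDiff ℝ 1 H := ((contDiff_det.of_le (by simp)).comp contDiff_fst).mul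
    contDiff_snd.neg.exp
  have hac := absolutelyContinuous_comp_of_contDiff (hYl.prodMk hll) hHc t s
  obtain ⟨C, hC⟩ := hac.const_of_ae_hasDerivAt_zero (by
    filter_upwards [LocallyIntegrable.ae_hasDerivAt_integral hi.locallyIntegrable,
      LocallyIntegrable.ae_hasDerivAt_integral hit.locallyIntegrable] with τ h1 h2 _
    have hYd : HasDerivAt Y ((A τ).comp (Y τ)) τ := by
      have := (h1 t).const_add (Y t)
      exact this.congr_of_eventuallyEq
        (Eventually.of_forall fun s => eq_add_of_sub_eq' (hYe t s))
    have h3 := (hasDerivAt_det hYd).mul ((h2 t).neg.exp)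
    refine h3.congr_deriv ?_
    simp only [hA]
    ring)
  have e1 := hC t left_mem_uIcc
  have e2 := hC s right_mem_uIcc
  have e3 : logJacobian hb t t x = 0 := intervalIntegral.integral_same
  have e4 : (ContinuousLinearMap.id ℝ E).det = 1 := LinearMap.det_id
  simp only [Function.comp, hH, hY, fderiv_flow_self, e3, e4, neg_zero, Real.exp_zero, mul_one] at e1
  simp only [Function.comp, hH, hY, ← e1] at e2
  rw [Real.exp_neg, mul_inv_eq_one₀ (Real.exp_pos _).ne'] at e2
  exact e2

end Liouville

/-! ### Bounds for the Jacobian determinant -/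

section LipschitzDerivative

/-- `f` is continuously differentiable, and its derivative is bounded by `C` and `C`-Lipschitz. -/
structure HasLipschitzDeriv {E : Type*} [NormedAddCommGroup E] [NormedSpace ℝ E] (C : ℝ)
    (f : E → ℝ) : Prop where
  contDiff : ContDiff ℝ 1 f
  bound : ∀ x, ‖fderiv ℝ f x‖ ≤ C
  lip : ∀ x y, ‖fderiv ℝ f x - fderiv ℝ f y‖ ≤ C * ‖x - y‖

variable {E : Type*} [NormedAddCommGroup E] [NormedSpace ℝ E] {C : ℝ} {f : E → ℝ}

theorem HasLipschitzDeriv.nonneg (h : HasLipschitzDeriv C f) : 0 ≤ C :=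
  (norm_nonneg _).trans (h.bound 0)

theorem HasLipschitzDeriv.mono (h : HasLipschitzDeriv C f) {C' : ℝ} (hC : C ≤ C') :
    HasLipschitzDeriv C' f :=
  ⟨h.contDiff, fun x => (h.bound x).trans hC, fun x y => (h.lip x y).trans
    (mul_le_mul_of_nonneg_right hC (norm_nonneg _))⟩

theorem HasLipschitzDeriv.neg (h : HasLipschitzDeriv C f) : HasLipschitzDeriv C fun x => - f x := by
  have h1 : fderiv ℝ (fun x => - f x) = fun x => - fderiv ℝ f x := funext fun x => fderiv_fun_neg
  refine ⟨h.contDiff.neg, fun x => ?_, fun x y => ?_⟩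
  · rw [h1, norm_neg]; exact h.bound x
  · rw [h1, neg_sub_neg, norm_sub_rev]; exact h.lip x y

theorem norm_sub_le_of_fderiv_le {F : Type*} [NormedAddCommGroup F] [NormedSpace ℝ F] {f : E → F}
    (hf : Differentiable ℝ f) (hC : ∀ x, ‖fderiv ℝ f x‖ ≤ C) (x y : E) :
    ‖f x - f y‖ ≤ C * ‖x - y‖ :=
  convex_univ.norm_image_sub_le_of_norm_fderiv_le (fun x _ => hf x) (fun x _ => hC x)
    (mem_univ y) (mem_univ x)

theorem HasLipschitzDeriv.exp (h : HasLipschitzDeriv C f) {B : ℝ} (hB : ∀ x, f x ≤ B) :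
    HasLipschitzDeriv (Real.exp B * (C + C ^ 2)) fun x => Real.exp (f x) := by
  have hC := h.nonneg
  have hd := h.contDiff.differentiable (by simp)
  have h1 : fderiv ℝ (fun x => Real.exp (f x)) = fun x => Real.exp (f x) • fderiv ℝ f x :=
    funext fun x => fderiv_exp (hd x)
  have h2 : ∀ x, ‖fderiv ℝ (fun x => Real.exp (f x)) x‖ ≤ Real.exp B * C := fun x => by
    rw [h1, norm_smul, Real.norm_eq_abs, Real.abs_exp]
    exact mul_le_mul (Real.exp_le_exp.2 (hB x)) (h.bound x) (norm_nonneg _) (Real.exp_pos _).le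
  refine ⟨h.contDiff.exp, fun x => (h2 x).trans ?_, fun x y => ?_⟩
  · gcongr; nlinarith
  · have h3 := norm_sub_le_of_fderiv_le (hd.exp) h2 x y
    have h4 : fderiv ℝ (fun x => Real.exp (f x)) x - fderiv ℝ (fun x => Real.exp (f x)) y
        = (Real.exp (f x) - Real.exp (f y)) • fderiv ℝ f x
          + Real.exp (f y) • (fderiv ℝ f x - fderiv ℝ f y) := by
      rw [h1, sub_smul, smul_sub]; abel
    rw [h4]
    have n1 : ‖(Real.exp (f x) - Real.exp (f y)) • fderiv ℝ f x‖
        ≤ Real.exp B * C * ‖x - y‖ * C := by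
      rw [norm_smul]
      exact mul_le_mul h3 (h.bound x) (norm_nonneg _) (by positivity)
    have n2 : ‖Real.exp (f y) • (fderiv ℝ f x - fderiv ℝ f y)‖
        ≤ Real.exp B * (C * ‖x - y‖) := by
      rw [norm_smul, Real.norm_eq_abs, Real.abs_exp]
      exact mul_le_mul (Real.exp_le_exp.2 (hB y)) (h.lip x y) (norm_nonneg _) (Real.exp_pos _).le
    refine (norm_add_le_of_le n1 n2).trans (le_of_eq ?_)
    ring

theorem HasLipschitzDeriv.lipschitzWith (h : HasLipschitzDeriv C f) :
    LipschitzWith ⟨C, h.nonneg⟩ (fderiv ℝ f) :=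
  LipschitzWith.of_dist_le_mul fun x y => by
    rw [dist_eq_norm, dist_eq_norm]
    exact h.lip x y

theorem HasLipschitzDeriv.norm_fderiv_fderiv_le (h : HasLipschitzDeriv C f) (x : E) :
    ‖fderiv ℝ (fderiv ℝ f) x‖ ≤ C :=
  norm_fderiv_le_of_lipschitz ℝ h.lipschitzWith

theorem eLpNorm_top_le_of_forall {X F : Type*} [MeasurableSpace X] {μ : Measure X}
    [NormedAddCommGroup F] {f : X → F} {C : ℝ} (h : ∀ x, ‖f x‖ ≤ C) :
    eLpNorm f ⊤ μ ≤ ENNReal.ofReal C := by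
  rw [eLpNorm_exponent_top]
  exact eLpNormEssSup_le_of_ae_bound (Eventually.of_forall h)

theorem HasLipschitzDeriv.hasBoundedDerivsTwo {n : ℕ} {f : Euc n → ℝ} (h : HasLipschitzDeriv C f) :
    HasBoundedDerivsTwo C f := by
  have h1 : HasWeakFDeriv volume (fderiv ℝ f) (fderiv ℝ (fderiv ℝ f)) :=
    h.lipschitzWith.hasWeakFDeriv
  have h2 : eLpNorm (fderiv ℝ (fderiv ℝ f)) ⊤ volume ≤ ENNReal.ofReal C :=
    eLpNorm_top_le_of_forall (F := Euc n →L[ℝ] Euc n →L[ℝ] ℝ) h.norm_fderiv_fderiv_le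
  exact ⟨h.contDiff, h.bound, fderiv ℝ (fderiv ℝ f), h1.isWeakFDeriv, h2⟩

end LipschitzDerivative

section Jacobian

variable {E : Type*} [NormedAddCommGroup E] [NormedSpace ℝ E] [FiniteDimensional ℝ E]
  [CompleteSpace E] {M T : ℝ} {b : ℝ → E → E}

/-- A bound for the first two derivatives of the logarithm of the Jacobian determinant. -/
noncomputable def logJacobianBound (E : Type*) [NormedAddCommGroup E] [NormedSpace ℝ E]
    [FiniteDimensional ℝ E] (M T : ℝ) : ℝ :=
  max (T * (‖traceCLM E‖ * M * Real.exp (M * T)))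
    (T * (‖traceCLM E‖ * M * Real.exp (M * T) ^ 2
      + ‖traceCLM E‖ * M * (T * M * Real.exp (M * T) ^ 3)))

theorem hasLipschitzDeriv_logJacobian (hT : 0 ≤ T) (hb : IsFlowField M T b) {t : ℝ}
    (ht : t ∈ Icc 0 T) (s : ℝ) :
    HasLipschitzDeriv (logJacobianBound E M T) (logJacobian hb t s) where
  contDiff := contDiff_integral_flow hb hb.trace_lip hb.trace_fderiv_lip hb.trace_diff t s
  bound x := (norm_fderiv_integral_flow_le hT hb hb.trace_lip hb.trace_fderiv_lip hb.trace_diff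
    ht s x).trans (le_max_left _ _)
  lip x y := (norm_fderiv_integral_flow_sub_le hT hb hb.trace_lip hb.trace_fderiv_lip hb.trace_diff
    ht s x y).trans (mul_le_mul_of_nonneg_right (le_max_right _ _) (norm_nonneg _))

theorem abs_logJacobian_le (hb : IsFlowField M T b) (t s : ℝ) (x : E) :
    |logJacobian hb t s x| ≤ ‖traceCLM E‖ * M * |s - t| := by
  rw [← Real.norm_eq_abs]
  exact intervalIntegral.norm_integral_le_of_norm_le_const fun τ _ =>
    (traceCLM E).le_opNorm_of_le ((hb.c2 τ).bound1 _)

theorem norm_traceCLM_euc_le (n : ℕ) : ‖traceCLM (Euc n)‖ ≤ n := by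
  refine ContinuousLinearMap.opNorm_le_bound _ (by positivity) fun A => ?_
  rw [traceCLM_apply, LinearMap.trace_eq_sum_inner _ (EuclideanSpace.basisFun (Fin n) ℝ)]
  refine (norm_sum_le _ _).trans ?_
  have h : ∀ i ∈ (Finset.univ : Finset (Fin n)), ‖inner ℝ (EuclideanSpace.basisFun (Fin n) ℝ i)
      ((A : Euc n →ₗ[ℝ] Euc n) (EuclideanSpace.basisFun (Fin n) ℝ i))‖ ≤ ‖A‖ := fun i _ => by
    refine (norm_inner_le_norm _ _).trans ?_
    have h1 : ‖EuclideanSpace.basisFun (Fin n) ℝ i‖ = 1 := OrthonormalBasis.norm_eq_one _ i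
    rw [h1, one_mul]
    refine (A.le_opNorm _).trans ?_
    rw [h1, mul_one]
  exact (Finset.sum_le_card_nsmul _ _ _ h).trans (by simp)

end Jacobian

section EucJacobian

variable {n : ℕ} {M T : ℝ} {b : ℝ → Euc n → Euc n}

theorem abs_logJacobian_euc_le (hb : IsFlowField M T b) (t s : ℝ) (x : Euc n) :
    |logJacobian hb t s x| ≤ n * M * |s - t| := by
  have hM := hb.nonneg
  refine (abs_logJacobian_le hb t s x).trans ?_
  gcongr
  exact norm_traceCLM_euc_le n

theorem jacobianDet_flow (hb : IsFlowField M T b) {t : ℝ} (ht : t ∈ Icc 0 T) (s : ℝ) :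
    jacobianDet (flow hb t s) = fun x => Real.exp (logJacobian hb t s x) :=
  funext fun x => det_fderiv_flow hb ht s x

theorem jacobianDet_flow_pos (hb : IsFlowField M T b) {t : ℝ} (ht : t ∈ Icc 0 T) (s : ℝ)
    (x : Euc n) : 0 < jacobianDet (flow hb t s) x := by
  rw [jacobianDet_flow hb ht]; exact Real.exp_pos _

/-- A bound for the first two derivatives of the Jacobian determinant and of its inverse. -/
noncomputable def jacobianBound (n : ℕ) (M T : ℝ) : ℝ :=
  Real.exp (n * M * T) * (logJacobianBound (Euc n) M T + logJacobianBound (Euc n) M T ^ 2)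

theorem abs_logJacobian_euc_le_of_mem (hb : IsFlowField M T b) {t s : ℝ} (ht : t ∈ Icc 0 T)
    (hs : s ∈ Icc 0 T) (x : Euc n) : |logJacobian hb t s x| ≤ n * M * T := by
  have hM := hb.nonneg
  refine (abs_logJacobian_euc_le hb t s x).trans ?_
  gcongr
  exact abs_sub_le_of_mem_Icc ht hs

theorem hasLipschitzDeriv_jacobianDet (hT : 0 ≤ T) (hb : IsFlowField M T b) {t s : ℝ}
    (ht : t ∈ Icc 0 T) (hs : s ∈ Icc 0 T) :
    HasLipschitzDeriv (jacobianBound n M T) (jacobianDet (flow hb t s)) := by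
  rw [jacobianDet_flow hb ht]
  exact (hasLipschitzDeriv_logJacobian hT hb ht s).exp fun x =>
    (abs_le.1 (abs_logJacobian_euc_le_of_mem hb ht hs x)).2

theorem hasLipschitzDeriv_inv_jacobianDet (hT : 0 ≤ T) (hb : IsFlowField M T b) {t s : ℝ}
    (ht : t ∈ Icc 0 T) (hs : s ∈ Icc 0 T) :
    HasLipschitzDeriv (jacobianBound n M T) fun x => (jacobianDet (flow hb t s) x)⁻¹ := by
  simp only [jacobianDet_flow hb ht, ← Real.exp_neg]
  exact (hasLipschitzDeriv_logJacobian hT hb ht s).neg.exp fun x =>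
    neg_le.1 (abs_le.1 (abs_logJacobian_euc_le_of_mem hb ht hs x)).1

theorem jacobianDet_flow_le (hb : IsFlowField M T b) {t s : ℝ} (ht : t ∈ Icc 0 T)
    (hs : s ∈ Icc 0 T) (x : Euc n) : jacobianDet (flow hb t s) x ≤ Real.exp (n * M * T) := by
  rw [jacobianDet_flow hb ht]
  exact Real.exp_le_exp.2 (abs_le.1 (abs_logJacobian_euc_le_of_mem hb ht hs x)).2

theorem inv_jacobianDet_flow_le (hb : IsFlowField M T b) {t s : ℝ} (ht : t ∈ Icc 0 T)
    (hs : s ∈ Icc 0 T) (x : Euc n) : (jacobianDet (flow hb t s) x)⁻¹ ≤ Real.exp (n * M * T) := by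
  rw [jacobianDet_flow hb ht, ← Real.exp_neg]
  exact Real.exp_le_exp.2 (neg_le.1 (abs_le.1 (abs_logJacobian_euc_le_of_mem hb ht hs x)).1)

end EucJacobian

/-! ### Lagrangian coordinates -/

section Lagrangian

variable {n : ℕ} {M T : ℝ} {b : ℝ → Euc n → Euc n}

/-- The flow map as a homeomorphism. -/
noncomputable def flowHomeo (hb : IsFlowField M T b) (t s : ℝ) : Euc n ≃ₜ Euc n where
  toFun := flow hb t s
  invFun := flow hb s t
  left_inv := flow_inv hb t s
  right_inv := flow_inv hb s t
  continuous_toFun := (contDiff_flow hb t s).continuous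
  continuous_invFun := (contDiff_flow hb s t).continuous

theorem flow_injective (hb : IsFlowField M T b) (t s : ℝ) : Function.Injective (flow hb t s) :=
  (flowHomeo hb t s).injective

theorem flow_surjective (hb : IsFlowField M T b) (t s : ℝ) : Function.Surjective (flow hb t s) :=
  (flowHomeo hb t s).surjective

theorem flow_hasFDerivWithinAt (hb : IsFlowField M T b) (t s : ℝ) (S : Set (Euc n)) :
    ∀ x ∈ S, HasFDerivWithinAt (flow hb t s) (fderiv ℝ (flow hb t s) x) S x := fun x _ =>
  (((contDiff_flow hb t s).differentiable (by simp)) x).hasFDerivAt.hasFDerivWithinAt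

theorem lintegral_jacobianDet_mul_flow (hb : IsFlowField M T b) {t : ℝ} (ht : t ∈ Icc 0 T) (s : ℝ)
    (g : Euc n → ℝ≥0∞) :
    ∫⁻ y, ENNReal.ofReal (jacobianDet (flow hb t s) y) * g (flow hb t s y) = ∫⁻ x, g x := by
  have h := lintegral_image_eq_lintegral_abs_det_fderiv_mul volume MeasurableSet.univ
    (flow_hasFDerivWithinAt hb t s univ) (flow_injective hb t s).injOn g
  rw [image_univ, (flow_surjective hb t s).range_eq, Measure.restrict_univ] at h
  rw [h]
  refine lintegral_congr fun y => ?_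
  rw [← jacobianDet, abs_of_pos (jacobianDet_flow_pos hb ht s y)]

/-- The flow maps distort volumes by a bounded factor. -/
theorem map_flow_le (hb : IsFlowField M T b) {t s : ℝ} (ht : t ∈ Icc 0 T) (hs : s ∈ Icc 0 T) :
    (volume : Measure (Euc n)).map (flow hb s t)
      ≤ ENNReal.ofReal (Real.exp (n * M * T)) • (volume : Measure (Euc n)) := by
  refine Measure.le_iff.2 fun A hA => ?_
  have h1 : flow hb s t ⁻¹' A = flow hb t s '' A :=
    ((flowHomeo hb t s).toEquiv.image_eq_preimage_symm A).symm
  rw [Measure.map_apply (contDiff_flow hb s t).continuous.measurable hA, h1,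
    ← lintegral_abs_det_fderiv_eq_addHaar_image volume hA (flow_hasFDerivWithinAt hb t s A)
      (flow_injective hb t s).injOn, Measure.smul_apply, smul_eq_mul, ← setLIntegral_const]
  refine lintegral_mono fun x => ENNReal.ofReal_le_ofReal ?_
  rw [← jacobianDet, abs_of_pos (jacobianDet_flow_pos hb ht s x)]
  exact jacobianDet_flow_le hb ht hs x

theorem continuous_flow_uncurry (hb : IsFlowField M T b) (t : ℝ) :
    Continuous fun z : ℝ × Euc n => flow hb t z.1 z.2 := by
  refine continuous_iff_continuousAt.2 fun z => ?_
  rw [ContinuousAt, tendsto_iff_norm_sub_tendsto_zero]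
  have hlim : Tendsto (fun w : ℝ × Euc n => M * |w.1 - z.1|
      + ‖flow hb t z.1 w.2 - flow hb t z.1 z.2‖) (𝓝 z) (𝓝 0) := by
    have hc : Continuous fun w : ℝ × Euc n => M * |w.1 - z.1|
      + ‖flow hb t z.1 w.2 - flow hb t z.1 z.2‖ := by
      have := (contDiff_flow hb t z.1).continuous
      fun_prop
    simpa using hc.tendsto z
  refine squeeze_zero (fun _ => norm_nonneg _) (fun w => ?_) hlim
  refine (norm_sub_le_norm_sub_add_norm_sub _ (flow hb t z.1 w.2) _).trans ?_
  gcongr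
  exact norm_flow_sub_time_le hb t w.1 z.1 w.2

theorem continuous_inv_flow_uncurry (hb : IsFlowField M T b) (t : ℝ) :
    Continuous fun z : ℝ × Euc n => flow hb z.1 t z.2 := by
  refine continuous_iff_continuousAt.2 fun z => ?_
  rw [ContinuousAt, tendsto_iff_norm_sub_tendsto_zero]
  have hlim : Tendsto (fun w : ℝ × Euc n => M * Real.exp (M * |z.1 - t|) * |w.1 - z.1|
      + ‖flow hb z.1 t w.2 - flow hb z.1 t z.2‖) (𝓝 z) (𝓝 0) := by
    have hc : Continuous fun w : ℝ × Euc n => M * Real.exp (M * |z.1 - t|) * |w.1 - z.1|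
      + ‖flow hb z.1 t w.2 - flow hb z.1 t z.2‖ := by
      have := (contDiff_flow hb z.1 t).continuous
      fun_prop
    simpa using hc.tendsto z
  refine squeeze_zero (fun _ => norm_nonneg _) (fun w => ?_) hlim
  refine (norm_sub_le_norm_sub_add_norm_sub _ (flow hb z.1 t w.2) _).trans ?_
  gcongr
  exact norm_inv_flow_sub_time_le hb t w.1 z.1 w.2

/-- The passage from Lagrangian to Eulerian coordinates in space-time. -/
noncomputable def lagrangian (hb : IsFlowField M T b) (t : ℝ) : ℝ × Euc n ≃ₜ ℝ × Euc n where
  toFun z := (z.1, flow hb t z.1 z.2)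
  invFun z := (z.1, flow hb z.1 t z.2)
  left_inv z := by simp only [flow_inv]
  right_inv z := by simp only [flow_inv]
  continuous_toFun := continuous_fst.prodMk (continuous_flow_uncurry hb t)
  continuous_invFun := continuous_fst.prodMk (continuous_inv_flow_uncurry hb t)

theorem lagrangian_apply (hb : IsFlowField M T b) (t : ℝ) (z : ℝ × Euc n) :
    lagrangian hb t z = (z.1, flow hb t z.1 z.2) := rfl

theorem logJacobian_sub (hb : IsFlowField M T b) (t s r : ℝ) (x : Euc n) :
    |logJacobian hb t s x - logJacobian hb t r x| ≤ ‖traceCLM (Euc n)‖ * M * |s - r| := by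
  have hi := fun a c => (logJacobian_integrable hb t x).intervalIntegrable (a := a) (b := c)
  rw [logJacobian, logJacobian, intervalIntegral.integral_interval_sub_left (hi _ _) (hi _ _),
    ← Real.norm_eq_abs]
  exact intervalIntegral.norm_integral_le_of_norm_le_const fun τ _ =>
    (traceCLM (Euc n)).le_opNorm_of_le ((hb.c2 τ).bound1 _)

theorem continuous_jacobianDet_flow (hT : 0 ≤ T) (hb : IsFlowField M T b) {t : ℝ}
    (ht : t ∈ Icc 0 T) : Continuous fun z : ℝ × Euc n => jacobianDet (flow hb t z.1) z.2 := by
  simp only [jacobianDet_flow hb ht]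
  refine Real.continuous_exp.comp (continuous_iff_continuousAt.2 fun z => ?_)
  rw [ContinuousAt, tendsto_iff_norm_sub_tendsto_zero]
  have hlim : Tendsto (fun w : ℝ × Euc n => ‖traceCLM (Euc n)‖ * M * |w.1 - z.1|
      + ‖logJacobian hb t z.1 w.2 - logJacobian hb t z.1 z.2‖) (𝓝 z) (𝓝 0) := by
    have hc : Continuous fun w : ℝ × Euc n => ‖traceCLM (Euc n)‖ * M * |w.1 - z.1|
      + ‖logJacobian hb t z.1 w.2 - logJacobian hb t z.1 z.2‖ := by
      have := (hasLipschitzDeriv_logJacobian hT hb ht z.1).contDiff.continuous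
      fun_prop
    simpa using hc.tendsto z
  refine squeeze_zero (fun _ => norm_nonneg _) (fun w => ?_) hlim
  refine (norm_sub_le_norm_sub_add_norm_sub _ (logJacobian hb t z.1 w.2) _).trans ?_
  gcongr
  exact logJacobian_sub hb t w.1 z.1 w.2

/-- Lebesgue measure on the slab `(t,T) × ℝⁿ`. -/
noncomputable def slab (n : ℕ) (t T : ℝ) : Measure (ℝ × Euc n) :=
  (volume.restrict (Ioo t T)).prod volume

theorem slab_eq (n : ℕ) (t T : ℝ) :
    (volume : Measure (ℝ × Euc n)).restrict (Ioo t T ×ˢ univ) = slab n t T := by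
  rw [slab, Measure.volume_eq_prod, ← Measure.prod_restrict, Measure.restrict_univ]

/-- The Jacobian determinant as a density on space-time. -/
noncomputable def jacobianDensity (hb : IsFlowField M T b) (t : ℝ) (z : ℝ × Euc n) : ℝ :=
  jacobianDet (flow hb t z.1) z.2

theorem measurePreserving_lagrangian (hT : 0 ≤ T) (hb : IsFlowField M T b) {t : ℝ}
    (ht : t ∈ Icc 0 T) : MeasurePreserving (lagrangian hb t)
      ((slab n t T).withDensity fun z => ENNReal.ofReal (jacobianDensity hb t z)) (slab n t T) := by
  have hm := (lagrangian hb t).continuous.measurable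
  have hJ : Measurable fun z => ENNReal.ofReal (jacobianDensity hb t z) :=
    (continuous_jacobianDet_flow hT hb ht).measurable.ennreal_ofReal
  refine ⟨hm, Measure.ext_of_lintegral _ fun f hf => ?_⟩
  rw [lintegral_map hf hm]
  refine (lintegral_withDensity_eq_lintegral_mul _ hJ (hf.comp hm)).trans ?_
  rw [slab, lintegral_prod _ (hJ.mul (hf.comp hm)).aemeasurable, lintegral_prod _ hf.aemeasurable]
  exact lintegral_congr fun s => lintegral_jacobianDet_mul_flow hb ht s fun x => f (s, x)

theorem jacobianDensity_pos (hb : IsFlowField M T b) {t : ℝ} (ht : t ∈ Icc 0 T)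
    (z : ℝ × Euc n) : 0 < jacobianDensity hb t z := jacobianDet_flow_pos hb ht z.1 z.2

theorem integrable_lagrangian (hT : 0 ≤ T) (hb : IsFlowField M T b) {t : ℝ}
    (ht : t ∈ Icc 0 T) (f : ℝ × Euc n → ℝ) : Integrable f (slab n t T) ↔
      Integrable (fun z => jacobianDensity hb t z * f (lagrangian hb t z)) (slab n t T) := by
  have hJ : Measurable fun z => ENNReal.ofReal (jacobianDensity hb t z) :=
    (continuous_jacobianDet_flow hT hb ht).measurable.ennreal_ofReal
  rw [← (measurePreserving_lagrangian hT hb ht).integrable_comp_emb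
    (lagrangian hb t).measurableEmbedding, integrable_withDensity_iff_integrable_smul' hJ
      (Eventually.of_forall fun _ => ENNReal.ofReal_lt_top)]
  simp only [ENNReal.toReal_ofReal (jacobianDensity_pos hb ht _).le, smul_eq_mul, Function.comp]

theorem integral_lagrangian (hT : 0 ≤ T) (hb : IsFlowField M T b) {t : ℝ}
    (ht : t ∈ Icc 0 T) (f : ℝ × Euc n → ℝ) : ∫ z, f z ∂(slab n t T)
      = ∫ z, jacobianDensity hb t z * f (lagrangian hb t z) ∂(slab n t T) := by
  have hJ : Measurable fun z => ENNReal.ofReal (jacobianDensity hb t z) :=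
    (continuous_jacobianDet_flow hT hb ht).measurable.ennreal_ofReal
  rw [← (measurePreserving_lagrangian hT hb ht).integral_comp
    (lagrangian hb t).measurableEmbedding, integral_withDensity_eq_integral_toReal_smul hJ
      (Eventually.of_forall fun _ => ENNReal.ofReal_lt_top)]
  simp only [ENNReal.toReal_ofReal (jacobianDensity_pos hb ht _).le, smul_eq_mul]

theorem ae_lagrangian (hT : 0 ≤ T) (hb : IsFlowField M T b) {t : ℝ}
    (ht : t ∈ Icc 0 T) {p : ℝ × Euc n → Prop} :
    (∀ᵐ z ∂(slab n t T), p z) ↔ ∀ᵐ z ∂(slab n t T), p (lagrangian hb t z) := by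
  have hJ : Measurable fun z => ENNReal.ofReal (jacobianDensity hb t z) :=
    (continuous_jacobianDet_flow hT hb ht).measurable.ennreal_ofReal
  rw [← (measurePreserving_lagrangian hT hb ht).map_eq,
    (lagrangian hb t).measurableEmbedding.ae_map_iff, ae_withDensity_iff hJ,
    (measurePreserving_lagrangian hT hb ht).map_eq]
  simp only [ne_eq, ENNReal.ofReal_eq_zero, not_le, jacobianDensity_pos hb ht, true_imp_iff]

theorem norm_flow_sub_self_le (hb : IsFlowField M T b) {t s : ℝ} (ht : t ∈ Icc 0 T)
    (hs : s ∈ Icc 0 T) (x : Euc n) : ‖flow hb t s x - x‖ ≤ M * T := by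
  have h := norm_flow_sub_time_le hb t s t x
  rw [flow_self] at h
  exact h.trans (mul_le_mul_of_nonneg_left (abs_sub_le_of_mem_Icc ht hs) hb.nonneg)

theorem mem_cthickening_of_flow_mem (hb : IsFlowField M T b) {t s : ℝ} (ht : t ∈ Icc 0 T)
    (hs : s ∈ Icc 0 T) {x : Euc n} {K : Set (Euc n)} (hx : flow hb t s x ∈ K) :
    x ∈ Metric.cthickening (M * T) K :=
  Metric.mem_cthickening_of_dist_le x _ _ _ hx (by
    rw [dist_comm, dist_eq_norm]; exact norm_flow_sub_self_le hb ht hs x)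

end Lagrangian

/-! ### Existence for the continuity equation -/

section AlongCharacteristics

variable {E : Type*} [NormedAddCommGroup E] [NormedSpace ℝ E] [FiniteDimensional ℝ E]
  [CompleteSpace E] {M T : ℝ} {b : ℝ → E → E}

theorem ae_hasDerivAt_flow (hb : IsFlowField M T b) (t : ℝ) (y : E) :
    ∀ᵐ s : ℝ, HasDerivAt (fun τ => flow hb t τ y) (b s (flow hb t s y)) s := by
  filter_upwards [LocallyIntegrable.ae_hasDerivAt_integral
    (flow_integrable hb t y).locallyIntegrable] with s hs
  exact ((hs t).const_add y).congr_of_eventuallyEq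
    (Eventually.of_forall fun r => flow_eq hb t r y)

theorem integral_fderiv_along_flow (hb : IsFlowField M T b) {H : ℝ × E → ℝ} (hH : ContDiff ℝ 1 H)
    (t s r : ℝ) (y : E) :
    ∫ τ in s..r, fderiv ℝ H (τ, flow hb t τ y) (1, b τ (flow hb t τ y))
      = H (r, flow hb t r y) - H (s, flow hb t s y) := by
  have hl : LipschitzWith ⟨M, hb.nonneg⟩ fun τ => flow hb t τ y :=
    LipschitzWith.of_dist_le_mul fun s r => by
      rw [dist_eq_norm, Real.dist_eq]
      exact norm_flow_sub_time_le hb t s r y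
  have hac := absolutelyContinuous_comp_of_contDiff (LipschitzWith.id.prodMk hl) hH s r
  have h1 := hac.integral_deriv_eq_sub
  simp only [Function.comp, id] at h1
  rw [← h1]
  refine intervalIntegral.integral_congr_ae ?_
  filter_upwards [ae_hasDerivAt_flow hb t y] with τ hτ _
  exact (((hH.differentiable (by simp) _).hasFDerivAt.comp_hasDerivAt τ
    ((hasDerivAt_id τ).prodMk hτ)).deriv).symm

end AlongCharacteristics

section Existence

variable {n : ℕ} {M T : ℝ} {b : ℝ → Euc n → Euc n}

/-- The density transported by the flow of `b`. -/
noncomputable def flowDensity (hb : IsFlowField M T b) (t : ℝ) (mbar : Euc n → ℝ) :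
    ℝ → Euc n → ℝ :=
  transportedDensity (flow hb) (fun t s => flow hb s t) t mbar

theorem jacobianDensity_mul_flowDensity (hb : IsFlowField M T b) {t : ℝ} (ht : t ∈ Icc 0 T)
    (mbar : Euc n → ℝ) (z : ℝ × Euc n) :
    jacobianDensity hb t z * flowDensity hb t mbar z.1 (flow hb t z.1 z.2) = mbar z.2 := by
  rw [flowDensity, transportedDensity, flow_inv, jacobianDensity]
  exact mul_div_cancel₀ _ (jacobianDet_flow_pos hb ht z.1 z.2).ne'

theorem ae_slab_mem (n : ℕ) (t T : ℝ) : ∀ᵐ z ∂(slab n t T), z.1 ∈ Ioo t T := by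
  rw [← slab_eq]
  filter_upwards [ae_restrict_mem (measurableSet_Ioo.prod MeasurableSet.univ)] with z hz
  exact hz.1

theorem Ioo_subset_Icc_zero {t T : ℝ} (ht : t ∈ Icc 0 T) : Ioo t T ⊆ Icc 0 T := fun _ hs =>
  ⟨ht.1.trans hs.1.le, hs.2.le⟩

theorem integrableOn_slab_iff {K : Set (Euc n)} (hK : MeasurableSet K) {t T : ℝ}
    (f : ℝ × Euc n → ℝ) : IntegrableOn f (Ioo t T ×ˢ K) volume ↔
      Integrable ((univ ×ˢ K).indicator f) (slab n t T) := by
  rw [integrable_indicator_iff (MeasurableSet.univ.prod hK), IntegrableOn, IntegrableOn, ← slab_eq,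
    Measure.restrict_restrict (MeasurableSet.univ.prod hK), prod_inter_prod, univ_inter,
    inter_univ]

theorem integrable_slab_snd {f : Euc n → ℝ} (hf : LocallyIntegrable f volume) {K : Set (Euc n)}
    (hK : IsCompact K) (t T : ℝ) : Integrable (fun z => K.indicator f z.2) (slab n t T) := by
  have h1 : Integrable (K.indicator f) volume :=
    (integrable_indicator_iff hK.measurableSet).2 (hf.integrableOn_isCompact hK)
  exact h1.comp_snd _

theorem integrableOn_flowDensity (hT : 0 ≤ T) (hb : IsFlowField M T b) {t : ℝ} (ht : t ∈ Icc 0 T)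
    {mbar : Euc n → ℝ} (hm : LocallyIntegrable mbar volume) {K : Set (Euc n)} (hK : IsCompact K) :
    IntegrableOn (fun z : ℝ × Euc n => flowDensity hb t mbar z.1 z.2) (Ioo t T ×ˢ K) volume := by
  rw [integrableOn_slab_iff hK.measurableSet, integrable_lagrangian hT hb ht]
  have hA : MeasurableSet ((fun z : ℝ × Euc n => flow hb t z.1 z.2) ⁻¹' K) :=
    (continuous_flow_uncurry hb t).measurable hK.measurableSet
  have h1 := (integrable_slab_snd hm (hK.cthickening (r := M * T)) t T).indicator hA
  refine h1.congr ?_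
  filter_upwards [ae_slab_mem n t T] with z hz
  by_cases h2 : flow hb t z.1 z.2 ∈ K
  · have h3 : lagrangian hb t z ∈ (univ : Set ℝ) ×ˢ K := ⟨mem_univ _, h2⟩
    rw [indicator_of_mem h3, indicator_of_mem (s := (fun z : ℝ × Euc n => flow hb t z.1 z.2) ⁻¹' K) h2,
      indicator_of_mem (mem_cthickening_of_flow_mem hb ht (Ioo_subset_Icc_zero ht hz) h2)]
    exact (jacobianDensity_mul_flowDensity hb ht mbar z).symm
  · have h3 : lagrangian hb t z ∉ (univ : Set ℝ) ×ˢ K := fun h => h2 h.2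
    rw [indicator_of_notMem h3, indicator_of_notMem (s := (fun z : ℝ × Euc n => flow hb t z.1 z.2) ⁻¹' K) h2, mul_zero]

theorem eq_zero_of_notMem_image_snd_tsupport {X Y F : Type*} [TopologicalSpace X]
    [TopologicalSpace Y] [Zero F] {f : X × Y → F} {z : X × Y}
    (hz : z.2 ∉ Prod.snd '' tsupport f) : f z = 0 :=
  image_eq_zero_of_notMem_tsupport fun h => hz ⟨z, h, rfl⟩

theorem stronglyMeasurable_clm_apply {X V W : Type*} [MeasurableSpace X] [NormedAddCommGroup V]
    [NormedSpace ℝ V] [NormedAddCommGroup W] [NormedSpace ℝ W] {A : X → V →L[ℝ] W} {v : X → V}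
    (hA : StronglyMeasurable A) (hv : StronglyMeasurable v) :
    StronglyMeasurable fun x => A x (v x) :=
  isBoundedBilinearMap_apply.continuous.comp_stronglyMeasurable (hA.prodMk hv)

theorem norm_one_prod_le (hb : IsFlowField M T b) (s : ℝ) (x : Euc n) :
    ‖((1 : ℝ), b s x)‖ ≤ 1 + M := by
  have hM := hb.nonneg
  refine max_le ?_ (((hb.c2 s).bound x).trans (by linarith))
  rw [norm_one]; linarith

theorem weak_eq_flowDensity (hT : 0 ≤ T) (hb : IsFlowField M T b) {t : ℝ} (ht : t ∈ Icc 0 T)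
    {mbar : Euc n → ℝ} (hm : LocallyIntegrable mbar volume) {φ : ℝ × Euc n → ℝ}
    (hφ : ContDiff ℝ ∞ φ) (hφc : HasCompactSupport φ) (hφT : tsupport φ ⊆ Iio T ×ˢ univ) :
    ∫ z, flowDensity hb t mbar z.1 z.2 * fderiv ℝ φ z (1, b z.1 z.2) ∂(slab n t T)
      + ∫ x, mbar x * φ (t, x) = 0 := by
  set K : Set (Euc n) := Prod.snd '' tsupport φ with hKdef
  have hK : IsCompact K := hφc.isCompact.image continuous_snd
  set G : ℝ × Euc n → ℝ := fun z =>
    fderiv ℝ φ (lagrangian hb t z) (1, b z.1 (flow hb t z.1 z.2)) with hG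
  have hGm : StronglyMeasurable G := by
    refine stronglyMeasurable_clm_apply
      ((hφ.continuous_fderiv (by simp)).comp (lagrangian hb t).continuous).stronglyMeasurable ?_
    exact stronglyMeasurable_const.prodMk
      (hb.lip0.uncurry_meas.comp_measurable (lagrangian hb t).continuous.measurable)
  obtain ⟨C, hC⟩ := (hφ.continuous_fderiv (by simp)).bounded_above_of_compact_support
    (hφc.fderiv ℝ)
  have hGb : ∀ z, ‖G z‖ ≤ C * (1 + M) := fun z =>
    ContinuousLinearMap.le_of_opNorm_le_of_le _ (hC _) (norm_one_prod_le hb _ _)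
  have hG0 : ∀ z : ℝ × Euc n, z.1 ∈ Ioo t T → z.2 ∉ Metric.cthickening (M * T) K → G z = 0 := by
    intro z hz h
    have h1 : φ =ᶠ[𝓝 (lagrangian hb t z)] 0 := by
      refine notMem_tsupport_iff_eventuallyEq.1 fun h2 => h ?_
      exact mem_cthickening_of_flow_mem hb ht (Ioo_subset_Icc_zero ht hz) ⟨_, h2, rfl⟩
    simp only [hG, h1.fderiv_eq]
    simp
  have hint : Integrable (fun z => mbar z.2 * G z) (slab n t T) := by
    have h1 := (integrable_slab_snd hm (hK.cthickening (r := M * T)) t T).bdd_mul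
      hGm.aestronglyMeasurable (Eventually.of_forall hGb)
    refine h1.congr ?_
    filter_upwards [ae_slab_mem n t T] with z hz
    by_cases h : z.2 ∈ Metric.cthickening (M * T) K
    · rw [indicator_of_mem h, mul_comm]
    · rw [hG0 z hz h, zero_mul, mul_zero]
  have h1 : ∫ z, flowDensity hb t mbar z.1 z.2 * fderiv ℝ φ z (1, b z.1 z.2) ∂(slab n t T)
      = ∫ z, mbar z.2 * G z ∂(slab n t T) := by
    rw [integral_lagrangian hT hb ht]
    refine integral_congr_ae (Eventually.of_forall fun z => ?_)
    simp only [lagrangian_apply, hG]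
    rw [← mul_assoc, jacobianDensity_mul_flowDensity hb ht]
  have h2 : ∀ y, ∫ s in Ioo t T, G (s, y) = - φ (t, y) := by
    intro y
    rw [← integral_Ioc_eq_integral_Ioo, ← intervalIntegral.integral_of_le ht.2]
    simp only [hG, lagrangian_apply]
    rw [integral_fderiv_along_flow hb (hφ.of_le (by simp)), flow_self]
    have : φ (T, flow hb t T y) = 0 :=
      image_eq_zero_of_notMem_tsupport fun h => lt_irrefl T (hφT h).1
    rw [this, zero_sub]
  rw [h1, slab, integral_prod_symm _ hint]
  simp only [integral_const_mul, h2, mul_neg, integral_neg]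
  exact neg_add_cancel _

end Existence

/-! ### Uniqueness for the continuity equation -/

section Uniqueness

variable {n : ℕ} {M T : ℝ} {b : ℝ → Euc n → Euc n}

instance isAddHaarMeasure_volume_space_time :
    (volume : Measure (ℝ × Euc n)).IsAddHaarMeasure :=
  inferInstanceAs ((volume : Measure ℝ).prod (volume : Measure (Euc n))).IsAddHaarMeasure

theorem locallyIntegrableOn_slab {t : ℝ} {w : ℝ × Euc n → ℝ}
    (hw : ∀ K : Set (Euc n), IsCompact K → IntegrableOn w (Ioo t T ×ˢ K) volume) :
    LocallyIntegrableOn w (Ioo t T ×ˢ univ) volume := fun z hz =>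
  ⟨Ioo t T ×ˢ Metric.closedBall z.2 1, mem_nhdsWithin_of_mem_nhds (prod_mem_nhds
    (isOpen_Ioo.mem_nhds hz.1) (Metric.closedBall_mem_nhds _ one_pos)),
    hw _ (isCompact_closedBall _ _)⟩

/-- The weak formulation extends from smooth to Lipschitz test functions. -/
theorem weak_eq_of_lipschitz (hb : IsFlowField M T b) {t : ℝ} {w : ℝ × Euc n → ℝ}
    (hw : ∀ K : Set (Euc n), IsCompact K → IntegrableOn w (Ioo t T ×ˢ K) volume)
    (hweak : ∀ φ : ℝ × Euc n → ℝ, ContDiff ℝ ∞ φ → HasCompactSupport φ →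
      tsupport φ ⊆ Iio T ×ˢ univ → ∫ z, w z * fderiv ℝ φ z (1, b z.1 z.2) ∂(slab n t T) = 0)
    {φ : ℝ × Euc n → ℝ} {L : NNReal} (hφ : LipschitzWith L φ) (hφc : HasCompactSupport φ)
    (hφT : tsupport φ ⊆ Iio T ×ˢ univ) :
    ∫ z, w z * fderiv ℝ φ z (1, b z.1 z.2) ∂(slab n t T) = 0 := by
  obtain ⟨δ, hδ, hS⟩ := hφc.isCompact.exists_cthickening_subset_open
    (isOpen_Iio.prod isOpen_univ) hφT
  set S := Metric.cthickening δ (tsupport φ) with hSdef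
  have hSc : IsCompact S := hφc.isCompact.cthickening
  have hweakd : HasWeakFDeriv volume φ (fderiv ℝ φ) := hφ.hasWeakFDeriv
  have hsupp : ∀ᶠ k : ℕ in atTop, tsupport (moll volume k φ) ⊆ S := by
    have h1 : Tendsto (fun k : ℕ => ((k : ℝ) + 1)⁻¹) atTop (𝓝 0) := by
      simpa only [one_div] using tendsto_one_div_add_atTop_nhds_zero_nat (𝕜 := ℝ)
    filter_upwards [h1.eventually (gt_mem_nhds hδ)] with k hk
    refine closure_minimal (fun x hx => ?_) Metric.isClosed_cthickening
    by_contra hxS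
    refine hx (moll_eq_zero fun y hy => ?_)
    refine image_eq_zero_of_notMem_tsupport fun hyS => hxS ?_
    exact Metric.mem_cthickening_of_dist_le x y δ _ hyS
      (by rw [dist_comm]; exact (Metric.mem_ball.1 hy).le.trans hk.le)
  have hmoll : ∀ k, ContDiff ℝ ∞ (moll volume k φ) := moll_contDiff hweakd.locInt
  have hv : StronglyMeasurable fun z : ℝ × Euc n => ((1 : ℝ), b z.1 z.2) :=
    stronglyMeasurable_const.prodMk hb.lip0.uncurry_meas
  have hwm : AEStronglyMeasurable w (slab n t T) := by
    rw [← slab_eq]; exact (locallyIntegrableOn_slab hw).aestronglyMeasurable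
  set K : Set (Euc n) := Prod.snd '' S with hKdef
  have hK : IsCompact K := hSc.image continuous_snd
  have hlim : Tendsto (fun k : ℕ => ∫ z, w z * fderiv ℝ (moll volume k φ) z (1, b z.1 z.2)
      ∂(slab n t T)) atTop (𝓝 (∫ z, w z * fderiv ℝ φ z (1, b z.1 z.2) ∂(slab n t T))) := by
    refine tendsto_integral_filter_of_dominated_convergence
      (fun z => ‖(univ ×ˢ K).indicator w z‖ * (L * (1 + M))) ?_ ?_ ?_ ?_
    · refine Eventually.of_forall fun k => hwm.mul ?_
      exact (stronglyMeasurable_clm_apply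
        ((hmoll k).continuous_fderiv (by simp)).stronglyMeasurable hv).aestronglyMeasurable
    · filter_upwards [hsupp] with k hk
      refine Eventually.of_forall fun z => ?_
      rw [norm_mul]
      by_cases hz : z ∈ S
      · have hz' : z ∈ (univ : Set ℝ) ×ˢ K := ⟨mem_univ _, z, hz, rfl⟩
        rw [indicator_of_mem hz']
        gcongr
        refine ContinuousLinearMap.le_of_opNorm_le_of_le _ ?_ (norm_one_prod_le hb _ _)
        exact norm_fderiv_le_of_lipschitz ℝ (moll_lipschitz hweakd
          (Eventually.of_forall fun x => norm_fderiv_le_of_lipschitz ℝ hφ) k)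
      · have h1 : moll volume k φ =ᶠ[𝓝 z] 0 :=
          notMem_tsupport_iff_eventuallyEq.1 fun h => hz (hk h)
        rw [h1.fderiv_eq]
        have hM := hb.nonneg
        simp only [Pi.zero_def, fderiv_fun_const, zero_apply, norm_zero, mul_zero]
        positivity
    · exact (((integrableOn_slab_iff hK.measurableSet w).1 (hw K hK)).norm).mul_const _
    · have h1 : ∀ᵐ z ∂(slab n t T),
          Tendsto (fun k => moll volume k (fderiv ℝ φ) z) atTop (𝓝 (fderiv ℝ φ z)) := by
        rw [← slab_eq]
        exact ae_restrict_of_ae (moll_ae_tendsto hweakd.locInt_deriv)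
      filter_upwards [h1] with z hz
      have h2 := ((ContinuousLinearMap.apply ℝ ℝ ((1 : ℝ), b z.1 z.2)).continuous.tendsto _).comp hz
      refine Tendsto.const_mul _ (h2.congr fun k => ?_)
      rw [moll_fderiv hweakd]
      rfl
  refine tendsto_nhds_unique hlim (tendsto_const_nhds.congr' ?_)
  filter_upwards [hsupp] with k hk
  exact (hweak _ (hmoll k) (hSc.of_isClosed_subset (isClosed_tsupport _) hk) (hk.trans hS)).symm

theorem ae_slab_hasDerivAt_flow (hb : IsFlowField M T b) (t : ℝ) :
    ∀ᵐ z ∂(slab n t T), HasDerivAt (fun τ => flow hb t τ z.2) (b z.1 (flow hb t z.1 z.2)) z.1 := by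
  have hc : Continuous (Function.uncurry fun (y : Euc n) (τ : ℝ) => flow hb t τ y) :=
    (continuous_flow_uncurry hb t).comp continuous_swap
  have hm : MeasurableSet {p : Euc n × ℝ |
      HasDerivAt (fun τ => flow hb t τ p.1) (b p.2 (flow hb t p.2 p.1)) p.2} := by
    have h1 := measurableSet_of_differentiableAt_with_param ℝ hc
    have h2 := measurable_deriv_with_param hc
    have h3 : Measurable fun p : Euc n × ℝ => b p.2 (flow hb t p.2 p.1) :=
      (hb.lip0.uncurry_meas.comp_measurable
        (lagrangian hb t).continuous.measurable).measurable.comp measurable_swap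
    convert h1.inter (measurableSet_eq_fun h2 h3) using 1
    ext p
    exact ⟨fun h => ⟨h.differentiableAt, h.deriv⟩, fun h => by
      have := h.1.hasDerivAt
      rwa [show deriv _ _ = _ from h.2] at this⟩
  have h1 : ∀ᵐ y : Euc n, ∀ᵐ s ∂(volume.restrict (Ioo t T)),
      HasDerivAt (fun τ => flow hb t τ y) (b s (flow hb t s y)) s :=
    Eventually.of_forall fun y => ae_restrict_of_ae (ae_hasDerivAt_flow hb t y)
  refine (Measure.ae_prod_iff_ae_ae (measurable_swap hm)).2 ?_
  exact (Measure.ae_ae_comm hm).1 h1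

/-- Truncation of time to `[t,T]`. -/
noncomputable def clampTime (t T s : ℝ) : ℝ := max t (min s T)

theorem clampTime_mem {t T : ℝ} (ht : t ≤ T) (s : ℝ) : clampTime t T s ∈ Icc t T :=
  ⟨le_max_left _ _, max_le ht (min_le_right _ _)⟩

theorem clampTime_of_mem {t T s : ℝ} (hs : s ∈ Icc t T) : clampTime t T s = s := by
  rw [clampTime, min_eq_left hs.2, max_eq_right hs.1]

theorem abs_clampTime_sub_le (t T s r : ℝ) : |clampTime t T s - clampTime t T r| ≤ |s - r| := by
  have := ((LipschitzWith.id.min_const T).const_max t).dist_le_mul s r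
  simpa [Real.dist_eq, clampTime] using this

/-- The primitive in time, vanishing at time `T`, of `ψ` in Lagrangian coordinates. -/
noncomputable def timePrimitive (t T : ℝ) (ψ : ℝ × Euc n → ℝ) (s : ℝ) (y : Euc n) : ℝ :=
  ∫ r in T..clampTime t T s, ψ (r, y)

/-- The test function whose derivative along the flow is `ψ` in Lagrangian coordinates. -/
noncomputable def dualTest (hb : IsFlowField M T b) (t : ℝ) (ψ : ℝ × Euc n → ℝ)
    (z : ℝ × Euc n) : ℝ :=
  max 0 (min 1 (z.1 - t + 1)) * timePrimitive t T ψ z.1 (flow hb (clampTime t T z.1) t z.2)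

theorem abs_timePrimitive_sub_le {t : ℝ} (ht : t ∈ Icc 0 T) {ψ : ℝ × Euc n → ℝ} {C : ℝ}
    (hψ : Continuous ψ) (hC : ∀ z, ‖ψ z‖ ≤ C) {L : NNReal} (hL : LipschitzWith L ψ) (s r : ℝ)
    (y y' : Euc n) : |timePrimitive t T ψ s y - timePrimitive t T ψ r y'|
      ≤ C * |s - r| + L * ‖y - y'‖ * T := by
  have hC0 : 0 ≤ C := (norm_nonneg _).trans (hC 0)
  have hi : ∀ y a c, IntervalIntegrable (fun r => ψ (r, y)) volume a c := fun y a c =>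
    (hψ.comp (by fun_prop)).intervalIntegrable a c
  have h1 : |timePrimitive t T ψ s y - timePrimitive t T ψ r y| ≤ C * |s - r| := by
    rw [timePrimitive, timePrimitive,
      intervalIntegral.integral_interval_sub_left (hi _ _ _) (hi _ _ _), ← Real.norm_eq_abs]
    exact (intervalIntegral.norm_integral_le_of_norm_le_const fun τ _ => hC _).trans
      (mul_le_mul_of_nonneg_left (abs_clampTime_sub_le t T s r) hC0)
  have h2 : |timePrimitive t T ψ r y - timePrimitive t T ψ r y'| ≤ L * ‖y - y'‖ * T := by
    rw [timePrimitive, timePrimitive, ← intervalIntegral.integral_sub (hi _ _ _) (hi _ _ _),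
      ← Real.norm_eq_abs]
    refine (intervalIntegral.norm_integral_le_of_norm_le_const (C := L * ‖y - y'‖)
      fun τ _ => ?_).trans ?_
    · refine (hL.norm_sub_le _ _).trans (le_of_eq ?_)
      rw [Prod.mk_sub_mk, sub_self, Prod.norm_mk, norm_zero, max_eq_right (norm_nonneg _)]
    · gcongr
      have h3 := clampTime_mem ht.2 r
      rw [abs_sub_comm]
      exact abs_sub_le_of_mem_Icc ⟨ht.1.trans h3.1, h3.2⟩ ⟨ht.1.trans ht.2, le_rfl⟩
  exact (abs_sub_le _ (timePrimitive t T ψ r y) _).trans (add_le_add h1 h2)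

theorem exists_lipschitzWith_dualTest (hb : IsFlowField M T b) {t : ℝ} (ht : t ∈ Icc 0 T)
    {ψ : ℝ × Euc n → ℝ} (hψ : ContDiff ℝ ∞ ψ) (hψc : HasCompactSupport ψ) :
    ∃ L, LipschitzWith L (dualTest hb t ψ) := by
  have hM := hb.nonneg
  have hT : 0 ≤ T := ht.1.trans ht.2
  obtain ⟨C, hC⟩ := hψ.continuous.bounded_above_of_compact_support hψc
  have hC0 : 0 ≤ C := (norm_nonneg _).trans (hC 0)
  obtain ⟨L, hL⟩ := hψ.lipschitzWith_of_hasCompactSupport hψc (by simp)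
  set e := Real.exp (M * T) with he
  have hmem : ∀ s, clampTime t T s ∈ Icc 0 T := fun s =>
    ⟨ht.1.trans (clampTime_mem ht.2 s).1, (clampTime_mem ht.2 s).2⟩
  have hflow : ∀ z z' : ℝ × Euc n, ‖flow hb (clampTime t T z.1) t z.2
      - flow hb (clampTime t T z'.1) t z'.2‖ ≤ (M * e + e) * ‖z - z'‖ := by
    intro z z'
    have h1 : ‖flow hb (clampTime t T z.1) t z.2 - flow hb (clampTime t T z'.1) t z.2‖
        ≤ M * e * ‖z - z'‖ := by
      refine (norm_inv_flow_sub_time_le hb t _ _ z.2).trans ?_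
      gcongr
      · rw [he]; gcongr; exact abs_sub_le_of_mem_Icc ht (hmem _)
      · exact (abs_clampTime_sub_le t T _ _).trans (norm_fst_le (z - z'))
    have h2 : ‖flow hb (clampTime t T z'.1) t z.2 - flow hb (clampTime t T z'.1) t z'.2‖
        ≤ e * ‖z - z'‖ := by
      refine (norm_flow_sub_le hb _ t z.2 z'.2).trans ?_
      gcongr
      · rw [he]; gcongr; exact abs_sub_le_of_mem_Icc (hmem _) ht
      · exact norm_snd_le (z - z')
    refine (norm_sub_le_norm_sub_add_norm_sub _
      (flow hb (clampTime t T z'.1) t z.2) _).trans ((add_le_add h1 h2).trans (le_of_eq ?_))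
    ring
  set F : ℝ × Euc n → ℝ := fun z => timePrimitive t T ψ z.1 (flow hb (clampTime t T z.1) t z.2)
    with hF
  set D := C + L * (M * e + e) * T with hD
  have hFl : ∀ z z', |F z - F z'| ≤ D * ‖z - z'‖ := by
    intro z z'
    refine (abs_timePrimitive_sub_le ht hψ.continuous hC hL _ _ _ _).trans ?_
    calc _ ≤ C * ‖z - z'‖ + L * ((M * e + e) * ‖z - z'‖) * T := by
          gcongr
          · exact norm_fst_le (z - z')
          · exact hflow z z'
      _ = _ := by rw [hD]; ring
  have hFb : ∀ z, |F z| ≤ C * T := by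
    intro z
    rw [← Real.norm_eq_abs]
    refine (intervalIntegral.norm_integral_le_of_norm_le_const fun τ _ => hC _).trans ?_
    gcongr
    exact abs_sub_le_of_mem_Icc ⟨hT, le_rfl⟩ (hmem _)
  set χ : ℝ × Euc n → ℝ := fun z => max 0 (min 1 (z.1 - t + 1)) with hχ
  have hχb : ∀ z, |χ z| ≤ 1 := fun z => by
    rw [abs_of_nonneg (le_max_left _ _)]
    exact max_le zero_le_one (min_le_left _ _)
  have hχl : ∀ z z', |χ z - χ z'| ≤ ‖z - z'‖ := by
    intro z z'
    have h1 : LipschitzWith 1 fun s : ℝ => s - t + 1 := LipschitzWith.of_dist_le_mul fun s r => by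
      simp [Real.dist_eq]
    have h2 := ((h1.const_min 1).const_max 0).dist_le_mul z.1 z'.1
    rw [NNReal.coe_one, one_mul, Real.dist_eq, Real.dist_eq] at h2
    exact h2.trans (norm_fst_le (z - z'))
  refine ⟨⟨D + C * T, by positivity⟩, LipschitzWith.of_dist_le_mul fun z z' => ?_⟩
  rw [Real.dist_eq, dist_eq_norm]
  have h1 : dualTest hb t ψ z - dualTest hb t ψ z'
      = χ z * (F z - F z') + (χ z - χ z') * F z' := by
    simp only [dualTest, hF, hχ]; ring
  rw [h1]
  refine (abs_add_le _ _).trans ?_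
  rw [abs_mul, abs_mul]
  calc _ ≤ 1 * (D * ‖z - z'‖) + ‖z - z'‖ * (C * T) := by
        gcongr
        · exact hχb z
        · exact hFl z z'
        · exact hχl z z'
        · exact hFb z'
    _ = (D + C * T) * ‖z - z'‖ := by ring

theorem tsupport_dualTest (hb : IsFlowField M T b) {t : ℝ} (ht : t ∈ Ico 0 T)
    {ψ : ℝ × Euc n → ℝ} (hψc : HasCompactSupport ψ) (hψT : tsupport ψ ⊆ Ioo t T ×ˢ univ) :
    HasCompactSupport (dualTest hb t ψ) ∧ tsupport (dualTest hb t ψ) ⊆ Iio T ×ˢ univ := by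
  have ht' := Ico_subset_Icc_self ht
  have hK1 : IsCompact (insert t (Prod.fst '' tsupport ψ)) :=
    (hψc.isCompact.image continuous_fst).insert t
  obtain ⟨T', hT', hmax⟩ := hK1.exists_isGreatest ⟨t, mem_insert _ _⟩
  have hT'T : T' < T := by
    rcases hT' with h | ⟨z, hz, h⟩
    · rw [h]; exact ht.2
    · rw [← h]; exact (hψT hz).1.2
  have htT' : t ≤ T' := hmax (mem_insert _ _)
  set K : Set (Euc n) := Prod.snd '' tsupport ψ with hKdef
  have hK : IsCompact K := hψc.isCompact.image continuous_snd
  have hS : IsCompact (Icc (t - 1) T' ×ˢ Metric.cthickening (M * T) K) :=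
    isCompact_Icc.prod hK.cthickening
  have hsub : tsupport (dualTest hb t ψ) ⊆ Icc (t - 1) T' ×ˢ Metric.cthickening (M * T) K := by
    refine closure_minimal (fun z hz => ?_) hS.isClosed
    have hz := hz
    rw [Function.mem_support, dualTest, mul_ne_zero_iff] at hz
    have h1 : t - 1 ≤ z.1 := by
      by_contra h
      exact hz.1 (max_eq_left ((min_le_right _ _).trans (by linarith)))
    have h2 : z.1 ≤ T' := by
      by_contra h
      rw [not_le] at h
      refine hz.2 (intervalIntegral.integral_zero_ae (Eventually.of_forall fun r hr => ?_))
      refine image_eq_zero_of_notMem_tsupport fun h3 => ?_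
      have h4 : r ≤ T' := hmax (mem_insert_of_mem _ ⟨_, h3, rfl⟩)
      have h5 : T' < clampTime t T z.1 := lt_max_of_lt_right (lt_min h hT'T)
      exact absurd h4 (not_le.2 ((lt_min hT'T h5).trans hr.1))
    have h3 : flow hb (clampTime t T z.1) t z.2 ∈ K := by
      by_contra h
      refine hz.2 (intervalIntegral.integral_zero_ae (Eventually.of_forall fun r _ => ?_))
      exact eq_zero_of_notMem_image_snd_tsupport h
    have h4 := clampTime_mem ht'.2 z.1
    exact ⟨⟨h1, h2⟩, mem_cthickening_of_flow_mem hb ⟨ht.1.trans h4.1, h4.2⟩ ht' h3⟩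
  exact ⟨hS.of_isClosed_subset (isClosed_tsupport _) hsub, fun z hz =>
    ⟨(hsub hz).1.2.trans_lt hT'T, mem_univ _⟩⟩

theorem fderiv_dualTest (hb : IsFlowField M T b) {t : ℝ} {ψ : ℝ × Euc n → ℝ} (hψ : Continuous ψ)
    {z : ℝ × Euc n} (hz : z.1 ∈ Ioo t T) (hd : DifferentiableAt ℝ (dualTest hb t ψ) (lagrangian hb t z))
    (hflow : HasDerivAt (fun τ => flow hb t τ z.2) (b z.1 (flow hb t z.1 z.2)) z.1) :
    fderiv ℝ (dualTest hb t ψ) (lagrangian hb t z) (1, b z.1 (flow hb t z.1 z.2)) = ψ z := by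
  have h1 : HasDerivAt (dualTest hb t ψ ∘ fun τ => (τ, flow hb t τ z.2)) _ z.1 :=
    hd.hasFDerivAt.comp_hasDerivAt z.1 ((hasDerivAt_id z.1).prodMk hflow)
  have h2 : HasDerivAt (fun τ => ∫ r in T..τ, ψ (r, z.2)) (ψ z) z.1 :=
    ((hψ.comp (by fun_prop : Continuous fun r => (r, z.2))).integral_hasStrictDerivAt T z.1).hasDerivAt
  refine h1.unique (h2.congr_of_eventuallyEq ?_)
  filter_upwards [isOpen_Ioo.mem_nhds hz] with τ hτ
  have h3 : clampTime t T τ = τ := clampTime_of_mem (Ioo_subset_Icc_self hτ)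
  simp only [Function.comp, dualTest, timePrimitive, h3, flow_inv]
  rw [min_eq_left (by linarith [hτ.1]), max_eq_right zero_le_one, one_mul]

theorem weak_solution_eq_zero (hb : IsFlowField M T b) {t : ℝ} (ht : t ∈ Ico 0 T)
    {w : ℝ × Euc n → ℝ}
    (hw : ∀ K : Set (Euc n), IsCompact K → IntegrableOn w (Ioo t T ×ˢ K) volume)
    (hweak : ∀ φ : ℝ × Euc n → ℝ, ContDiff ℝ ∞ φ → HasCompactSupport φ →
      tsupport φ ⊆ Iio T ×ˢ univ → ∫ z, w z * fderiv ℝ φ z (1, b z.1 z.2) ∂(slab n t T) = 0) :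
    ∀ᵐ z ∂(slab n t T), w z = 0 := by
  have ht' := Ico_subset_Icc_self ht
  have hT : 0 ≤ T := ht'.1.trans ht'.2
  set f : ℝ × Euc n → ℝ := fun z => jacobianDensity hb t z * w (lagrangian hb t z) with hf
  have hfi : ∀ K : Set (Euc n), IsCompact K → IntegrableOn f (Ioo t T ×ˢ K) volume := by
    intro K hK
    have hK' := hK.cthickening (r := M * T)
    have h1 := (integrableOn_slab_iff hK'.measurableSet w).1 (hw _ hK')
    rw [integrable_lagrangian hT hb ht'] at h1
    rw [integrableOn_slab_iff hK.measurableSet]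
    refine (h1.indicator (MeasurableSet.univ.prod hK.measurableSet)).congr ?_
    filter_upwards [ae_slab_mem n t T] with z hz
    by_cases hzK : z ∈ (univ : Set ℝ) ×ˢ K
    · have h2 : lagrangian hb t z ∈ (univ : Set ℝ) ×ˢ Metric.cthickening (M * T) K := by
        refine ⟨mem_univ _, ?_⟩
        refine mem_cthickening_of_flow_mem (t := z.1) (s := t) hb (Ioo_subset_Icc_zero ht' hz) ht' ?_
        rw [lagrangian_apply, flow_inv]
        exact hzK.2
      rw [indicator_of_mem hzK, indicator_of_mem hzK, indicator_of_mem h2]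
    · rw [indicator_of_notMem hzK, indicator_of_notMem hzK]
  have hf0 : ∀ᵐ z : ℝ × Euc n, z ∈ Ioo t T ×ˢ (univ : Set (Euc n)) → f z = 0 := by
    refine (isOpen_Ioo.prod isOpen_univ).ae_eq_zero_of_integral_contDiff_smul_eq_zero
      (locallyIntegrableOn_slab hfi) fun ψ hψ hψc hψT => ?_
    obtain ⟨L, hL⟩ := exists_lipschitzWith_dualTest hb ht' hψ hψc
    obtain ⟨hc, hsub⟩ := tsupport_dualTest hb ht hψc hψT
    have h1 := weak_eq_of_lipschitz hb hw hweak hL hc hsub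
    rw [integral_lagrangian hT hb ht'] at h1
    have hd : ∀ᵐ z ∂(slab n t T), DifferentiableAt ℝ (dualTest hb t ψ) z := by
      rw [← slab_eq]; exact ae_restrict_of_ae hL.ae_differentiableAt
    have h2 : ∫ z, ψ z • f z ∂(slab n t T) = 0 := by
      rw [← h1]
      refine integral_congr_ae ?_
      filter_upwards [ae_slab_mem n t T, (ae_lagrangian hT hb ht').1 hd,
        ae_slab_hasDerivAt_flow hb t] with z hz hdz hflow
      have h3 := fderiv_dualTest hb hψ.continuous hz hdz hflow
      change _ = _ * (_ * fderiv ℝ (dualTest hb t ψ) (lagrangian hb t z)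
        (1, b z.1 (flow hb t z.1 z.2)))
      rw [h3, smul_eq_mul, hf]
      ring
    rw [← slab_eq] at h2
    rw [← h2]
    symm
    refine setIntegral_eq_integral_of_forall_compl_eq_zero fun z hz => ?_
    rw [image_eq_zero_of_notMem_tsupport fun h => hz (hψT h), zero_smul]
  rw [ae_lagrangian hT hb ht', ← slab_eq,
    ae_restrict_iff' (measurableSet_Ioo.prod MeasurableSet.univ)]
  filter_upwards [hf0] with z hz hzT
  exact (mul_eq_zero.1 (hz hzT)).resolve_left (jacobianDensity_pos hb ht' z).ne'

end Uniqueness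

/-! ### Sobolev estimates -/

section SobolevCalculus

variable {V : Type*} [NormedAddCommGroup V] [NormedSpace ℝ V] [FiniteDimensional ℝ V]
  [MeasurableSpace V] [BorelSpace V] {μ : Measure V} [μ.IsAddHaarMeasure]
  {F : Type*} [NormedAddCommGroup F] [NormedSpace ℝ F] [CompleteSpace F]
  {F₁ : Type*} [NormedAddCommGroup F₁] [NormedSpace ℝ F₁] [CompleteSpace F₁]
  {F₂ : Type*} [NormedAddCommGroup F₂] [NormedSpace ℝ F₂] [CompleteSpace F₂]
  {p : ℝ≥0∞}

theorem locallyIntegrable_add {G : Type*} [NormedAddCommGroup G] {f g : V → G}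
    (hf : LocallyIntegrable f μ) (hg : LocallyIntegrable g μ) :
    LocallyIntegrable (fun x => f x + g x) μ := hf.add hg

theorem HasWeakFDeriv.add {f f' : V → F} {g g' : V → V →L[ℝ] F} (h : HasWeakFDeriv μ f g)
    (h' : HasWeakFDeriv μ f' g') :
    HasWeakFDeriv μ (fun x => f x + f' x) (fun x => g x + g' x) where
  locInt := h.locInt.add h'.locInt
  locInt_deriv := locallyIntegrable_add h.locInt_deriv h'.locInt_deriv
  integral_eq φ hφ hφc v := by
    have hd : Continuous fun x => fderiv ℝ φ x v :=
      (hφ.continuous_fderiv (by simp)).clm_apply continuous_const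
    have hdc : HasCompactSupport fun x => fderiv ℝ φ x v := hφc.fderiv_apply ℝ v
    have i1 := (LocallyIntegrable.clm_apply h.locInt_deriv
      v).integrable_smul_left_of_hasCompactSupport hφ.continuous hφc
    have i2 := (LocallyIntegrable.clm_apply h'.locInt_deriv
      v).integrable_smul_left_of_hasCompactSupport hφ.continuous hφc
    simp only [smul_add, add_apply]
    rw [integral_add (h.locInt.integrable_smul_left_of_hasCompactSupport hd hdc)
      (h'.locInt.integrable_smul_left_of_hasCompactSupport hd hdc), integral_add i1 i2,
      h.integral_eq φ hφ hφc v, h'.integral_eq φ hφ hφc v]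
    abel

theorem eLpNorm_bilin_le {X : Type*} [MeasurableSpace X] {ν : Measure X} {B : F₁ →L[ℝ] F₂ →L[ℝ] F}
    (hB : ‖B‖ ≤ 1) {f : X → F₁} {b : X → F₂} {K : ℝ} (hb : ∀ x, ‖b x‖ ≤ K) :
    eLpNorm (fun x => B (f x) (b x)) p ν ≤ ENNReal.ofReal K * eLpNorm f p ν := by
  refine eLpNorm_le_mul_eLpNorm_of_ae_le_mul (Eventually.of_forall fun x => ?_) p
  rw [mul_comm]
  refine ContinuousLinearMap.le_of_opNorm_le_of_le _ ?_ (hb x)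
  simpa using ContinuousLinearMap.le_of_opNorm_le B hB (f x)

/-- `f` has a weak derivative `g`, and both are bounded by `a` in `L^p`. -/
structure SobolevOneLE (μ : Measure V) (p a : ℝ≥0∞) (f : V → F) (g : V → V →L[ℝ] F) : Prop where
  deriv : HasWeakFDeriv μ f g
  norm_le : eLpNorm f p μ ≤ a
  norm_deriv_le : eLpNorm g p μ ≤ a

theorem SobolevOneLE.mono {a a' : ℝ≥0∞} {f : V → F} {g : V → V →L[ℝ] F}
    (h : SobolevOneLE μ p a f g) (ha : a ≤ a') : SobolevOneLE μ p a' f g :=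
  ⟨h.deriv, h.norm_le.trans ha, h.norm_deriv_le.trans ha⟩

theorem SobolevOneLE.add {a a' : ℝ≥0∞} (hp : 1 ≤ p) {f f' : V → F} {g g' : V → V →L[ℝ] F}
    (h : SobolevOneLE μ p a f g) (h' : SobolevOneLE μ p a' f' g') :
    SobolevOneLE μ p (a + a') (fun x => f x + f' x) (fun x => g x + g' x) where
  deriv := h.deriv.add h'.deriv
  norm_le := (eLpNorm_add_le h.deriv.locInt.aestronglyMeasurable
    h'.deriv.locInt.aestronglyMeasurable hp).trans (add_le_add h.norm_le h'.norm_le)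
  norm_deriv_le := (eLpNorm_add_le h.deriv.locInt_deriv.aestronglyMeasurable
    h'.deriv.locInt_deriv.aestronglyMeasurable hp).trans
      (add_le_add h.norm_deriv_le h'.norm_deriv_le)

/-- The derivative of a product. -/
noncomputable def bilinDeriv (B : F₁ →L[ℝ] F₂ →L[ℝ] F) (f : V → F₁) (g : V → V →L[ℝ] F₁)
    (b : V → F₂) (b' : V → V →L[ℝ] F₂) (x : V) : V →L[ℝ] F :=
  B.precompR V (f x) (b' x) + B.precompL V (g x) (b x)

theorem SobolevOneLE.bilin (hp : 1 ≤ p) {B : F₁ →L[ℝ] F₂ →L[ℝ] F} (hB : ‖B‖ ≤ 1) {f : V → F₁}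
    {g : V → V →L[ℝ] F₁} {a : ℝ≥0∞} (hf : SobolevOneLE μ p a f g) {b : V → F₂}
    {b' : V → V →L[ℝ] F₂} (hb : HasWeakFDeriv μ b b') {K : ℝ} (hK : ∀ x, ‖b x‖ ≤ K)
    (hK' : ∀ x, ‖b' x‖ ≤ K) :
    SobolevOneLE μ p (2 * (ENNReal.ofReal K * a)) (fun x => B (f x) (b x))
      (bilinDeriv B f g b b') := by
  have hd := hf.deriv.bilin B hb (Eventually.of_forall hK) (Eventually.of_forall hK')
  have n1 : eLpNorm (fun x => B.precompR V (f x) (b' x)) p μ ≤ ENNReal.ofReal K * a :=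
    (eLpNorm_bilin_le ((ContinuousLinearMap.norm_precompR_le V B).trans hB) hK').trans
      (mul_le_mul_right hf.norm_le _)
  have n3 : eLpNorm (fun x => B.precompL V (g x) (b x)) p μ ≤ ENNReal.ofReal K * a :=
    (eLpNorm_bilin_le ((ContinuousLinearMap.norm_precompL_le V B).trans hB) hK).trans
      (mul_le_mul_right hf.norm_deriv_le _)
  have m1 : AEStronglyMeasurable (fun x => B.precompR V (f x) (b' x)) μ :=
    (B.precompR V).aestronglyMeasurable_comp₂ hf.deriv.locInt.aestronglyMeasurable
      hb.locInt_deriv.aestronglyMeasurable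
  have m2 : AEStronglyMeasurable (fun x => B.precompL V (g x) (b x)) μ :=
    (B.precompL V).aestronglyMeasurable_comp₂ hf.deriv.locInt_deriv.aestronglyMeasurable
      hb.locInt.aestronglyMeasurable
  refine ⟨hd, ?_, ?_⟩
  · refine (eLpNorm_bilin_le hB hK).trans ((mul_le_mul_right hf.norm_le _).trans ?_)
    rw [two_mul]; exact le_self_add
  · rw [two_mul]
    exact (eLpNorm_add_le m1 m2 hp).trans (add_le_add n1 n3)

theorem eLpNorm_comp_le {Ψ : V ≃ₜ V} {c : ℝ≥0∞} (hc : μ.map Ψ ≤ c • μ) (hc1 : 1 ≤ c) (hp : 1 ≤ p)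
    {f : V → F} (hf : AEStronglyMeasurable f μ) :
    eLpNorm (fun x => f (Ψ x)) p μ ≤ c * eLpNorm f p μ := by
  have hm : AEStronglyMeasurable f (μ.map Ψ) :=
    hf.mono_ac (quasiMeasurePreserving_of_map_le hc).absolutelyContinuous
  have h1 := eLpNorm_map_measure (p := p) hm Ψ.continuous.aemeasurable
  have h2 : c ≠ 0 := (zero_lt_one.trans_le hc1).ne'
  change eLpNorm (f ∘ Ψ) p μ ≤ _
  rw [← h1]
  refine (eLpNorm_mono_measure f hc).trans ?_
  rw [eLpNorm_smul_measure_of_ne_zero h2, smul_eq_mul]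
  gcongr
  have h3 : (1 / p).toReal ≤ 1 := by
    refine ENNReal.toReal_le_of_le_ofReal zero_le_one ?_
    rw [ENNReal.ofReal_one, one_div]
    exact ENNReal.inv_le_one.2 hp
  exact (ENNReal.rpow_le_rpow_of_exponent_le hc1 h3).trans (ENNReal.rpow_one c).le

theorem norm_compL_apply_le (A : V →L[ℝ] F) (D : V →L[ℝ] V) {e : ℝ} (hD : ‖D‖ ≤ e) :
    ‖A.comp D‖ ≤ e * ‖A‖ := by
  rw [mul_comm]
  exact (A.opNorm_comp_le D).trans (mul_le_mul_of_nonneg_left hD (norm_nonneg _))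

theorem SobolevOneLE.comp_homeomorph (hp : 1 ≤ p) {Ψ : V ≃ₜ V} {c : ℝ≥0∞} (hc : μ.map Ψ ≤ c • μ)
    (hc1 : 1 ≤ c) (hct : c ≠ ⊤) (hΨ : ContDiff ℝ 1 Ψ) {e : ℝ} (he1 : 1 ≤ e)
    (he : ∀ x, ‖fderiv ℝ Ψ x‖ ≤ e) {f : V → F} {g : V → V →L[ℝ] F} {a : ℝ≥0∞}
    (hf : SobolevOneLE μ p a f g) :
    SobolevOneLE μ p (ENNReal.ofReal e * (c * a)) (fun x => f (Ψ x))
      (fun x => (g (Ψ x)).comp (fderiv ℝ Ψ x)) where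
  deriv := hf.deriv.comp_homeomorph hc hct hΨ he
  norm_le := by
    refine (eLpNorm_comp_le hc hc1 hp hf.deriv.locInt.aestronglyMeasurable).trans ?_
    refine (mul_le_mul_right hf.norm_le c).trans ?_
    exact le_mul_of_one_le_left' (ENNReal.one_le_ofReal.2 he1)
  norm_deriv_le := by
    refine (eLpNorm_le_mul_eLpNorm_of_ae_le_mul (g := fun x => g (Ψ x)) (Eventually.of_forall
      fun x => norm_compL_apply_le _ _ (he x)) p).trans ?_
    refine mul_le_mul_right ((eLpNorm_comp_le hc hc1 hp
      hf.deriv.locInt_deriv.aestronglyMeasurable).trans ?_) _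
    exact mul_le_mul_right hf.norm_deriv_le c

/-- `f` has weak derivatives `g` and `h`, all bounded by `a` in `L^p`. -/
structure SobolevTwoLE (μ : Measure V) (p a : ℝ≥0∞) (f : V → F) (g : V → V →L[ℝ] F)
    (h : V → V →L[ℝ] V →L[ℝ] F) : Prop where
  one : SobolevOneLE μ p a f g
  two : SobolevOneLE μ p a g h

theorem SobolevTwoLE.bilin (hp : 1 ≤ p) {B : F₁ →L[ℝ] F₂ →L[ℝ] F} (hB : ‖B‖ ≤ 1) {f : V → F₁}
    {g : V → V →L[ℝ] F₁} {h : V → V →L[ℝ] V →L[ℝ] F₁} {a : ℝ≥0∞} (hf : SobolevTwoLE μ p a f g h)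
    {b : V → F₂} {b' : V → V →L[ℝ] F₂} {b'' : V → V →L[ℝ] V →L[ℝ] F₂} (hb : HasWeakFDeriv μ b b')
    (hb' : HasWeakFDeriv μ b' b'') {K : ℝ} (hK : ∀ x, ‖b x‖ ≤ K) (hK' : ∀ x, ‖b' x‖ ≤ K)
    (hK'' : ∀ x, ‖b'' x‖ ≤ K) :
    ∃ q, SobolevTwoLE μ p (4 * (ENNReal.ofReal K * a)) (fun x => B (f x) (b x))
      (bilinDeriv B f g b b') q := by
  have h1 := hf.one.bilin hp hB hb hK hK'
  have h2 := hf.one.bilin hp ((ContinuousLinearMap.norm_precompR_le V B).trans hB) hb' hK' hK''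
  have h3 := hf.two.bilin hp ((ContinuousLinearMap.norm_precompL_le V B).trans hB) hb hK hK'
  have h4 := h2.add hp h3
  have e4 : 2 * (ENNReal.ofReal K * a) + 2 * (ENNReal.ofReal K * a)
      = 4 * (ENNReal.ofReal K * a) := by rw [← add_mul]; norm_num
  rw [e4] at h4
  exact ⟨_, h1.mono (by rw [← e4]; exact le_self_add), h4⟩

theorem SobolevTwoLE.comp_homeomorph (hp : 1 ≤ p) {Ψ : V ≃ₜ V} {c : ℝ≥0∞} (hc : μ.map Ψ ≤ c • μ)
    (hc1 : 1 ≤ c) (hct : c ≠ ⊤) (hΨ : ContDiff ℝ 2 Ψ) {e : ℝ} (he1 : 1 ≤ e)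
    (he : ∀ x, ‖fderiv ℝ Ψ x‖ ≤ e) (he' : ∀ x, ‖fderiv ℝ (fderiv ℝ Ψ) x‖ ≤ e) {f : V → F}
    {g : V → V →L[ℝ] F} {h : V → V →L[ℝ] V →L[ℝ] F} {a : ℝ≥0∞} (hf : SobolevTwoLE μ p a f g h) :
    ∃ q r, SobolevTwoLE μ p (2 * (ENNReal.ofReal e * (ENNReal.ofReal e * (c * a))))
      (fun x => f (Ψ x)) q r := by
  have : CompleteSpace V := FiniteDimensional.complete ℝ V
  have hΨ1 : ContDiff ℝ 1 Ψ := hΨ.of_le (by norm_num)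
  have h1 := hf.one.comp_homeomorph hp hc hc1 hct hΨ1 he1 he
  have h2 := hf.two.comp_homeomorph hp hc hc1 hct hΨ1 he1 he
  have hD : HasWeakFDeriv μ (fderiv ℝ Ψ) (fderiv ℝ (fderiv ℝ Ψ)) :=
    hasWeakFDeriv_of_contDiff (hΨ.fderiv_right (by norm_num))
  have h3 := h2.bilin hp (ContinuousLinearMap.norm_compL_le ℝ V V F) hD he he'
  refine ⟨_, _, h1.mono ?_, h3⟩
  refine (le_mul_of_one_le_left' (ENNReal.one_le_ofReal.2 he1)).trans ?_
  exact le_mul_of_one_le_left' (by norm_num)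

end SobolevCalculus

section SobolevNorm

variable {n : ℕ} {p : ℝ≥0∞} {f : Euc n → ℝ}

theorem SobolevTwoLE.eSobolevNorm_le {a : ℝ≥0∞} {g : Euc n → Euc n →L[ℝ] ℝ}
    {h : Euc n → Euc n →L[ℝ] Euc n →L[ℝ] ℝ} (hf : SobolevTwoLE volume p a f g h) :
    eSobolevNorm p 2 f ≤ a := by
  have h1 : eSobolevNorm p 1 g ≤ a :=
    max_le hf.two.norm_le (iInf_le_of_le ⟨h, hf.two.deriv.isWeakFDeriv⟩ hf.two.norm_deriv_le)
  exact max_le hf.one.norm_le (iInf_le_of_le ⟨g, hf.one.deriv.isWeakFDeriv⟩ h1)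

theorem exists_sobolevTwoLE {a : ℝ≥0∞} (h : eSobolevNorm p 2 f < a) :
    ∃ g h, SobolevTwoLE volume p a f g h := by
  obtain ⟨h1, g, hg, h2⟩ := exists_of_eSobolevNorm_succ_lt h
  obtain ⟨h3, r, hr, h4⟩ := exists_of_eSobolevNorm_succ_lt h2
  exact ⟨g, r, ⟨hg, h1.le, h3.le⟩, hr, h3.le, le_of_lt h4⟩

theorem memSobolevW_of_forall_sobolevTwoLE {f' : Euc n → ℝ} {C : ℝ} (hf : MemSobolevW 2 p f)
    (h : ∀ a g r, SobolevTwoLE volume p a f g r →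
      ∃ g' r', SobolevTwoLE volume p (ENNReal.ofReal C * a) f' g' r') :
    MemSobolevW 2 p f' ∧ eSobolevNorm p 2 f' ≤ ENNReal.ofReal C * eSobolevNorm p 2 f := by
  have h1 : ∀ a, eSobolevNorm p 2 f < a → eSobolevNorm p 2 f' ≤ ENNReal.ofReal C * a := by
    intro a ha
    obtain ⟨g, r, hgr⟩ := exists_sobolevTwoLE ha
    obtain ⟨g', r', h'⟩ := h a g r hgr
    exact h'.eSobolevNorm_le
  have h2 : eSobolevNorm p 2 f' ≤ ENNReal.ofReal C * eSobolevNorm p 2 f := by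
    have : (𝓝[>] eSobolevNorm p 2 f).NeBot := nhdsGT_neBot_of_exists_gt ⟨⊤, hf.2⟩
    have h3 : Tendsto (fun a => ENNReal.ofReal C * a) (𝓝[>] eSobolevNorm p 2 f)
        (𝓝 (ENNReal.ofReal C * eSobolevNorm p 2 f)) :=
      ENNReal.Tendsto.const_mul (tendsto_id.mono_left nhdsWithin_le_nhds)
        (Or.inr ENNReal.ofReal_ne_top)
    exact ge_of_tendsto h3 (by
      filter_upwards [self_mem_nhdsWithin] with a ha
      exact h1 a ha)
  obtain ⟨g, r, hgr⟩ := exists_sobolevTwoLE hf.2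
  obtain ⟨g', r', h'⟩ := h _ g r hgr
  exact ⟨⟨h'.one.deriv.locInt.aestronglyMeasurable,
    h2.trans_lt (ENNReal.mul_lt_top ENNReal.ofReal_lt_top hf.2)⟩, h2⟩

end SobolevNorm

section Transport

variable {n : ℕ} {M T : ℝ} {b : ℝ → Euc n → Euc n}

/-- A bound for the first two derivatives of the flow and its inverse. -/
noncomputable def flowBound (M T : ℝ) : ℝ :=
  max (Real.exp (M * T)) (T * M * Real.exp (M * T) ^ 3)

/-- A bound for the inverse Jacobian determinant and its first two derivatives. -/
noncomputable def weightBound (n : ℕ) (M T : ℝ) : ℝ :=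
  max (Real.exp (n * M * T)) (jacobianBound n M T)

/-- The constant in the Sobolev estimates for the transported density. -/
noncomputable def transportBound (n : ℕ) (M T : ℝ) : ℝ :=
  2 * (flowBound M T * (flowBound M T * (Real.exp (n * M * T) * (4 * weightBound n M T))))

theorem norm_fderiv_flow_le_flowBound (hb : IsFlowField M T b) {t s : ℝ} (ht : t ∈ Icc 0 T)
    (hs : s ∈ Icc 0 T) (x : Euc n) : ‖fderiv ℝ (flow hb t s) x‖ ≤ flowBound M T := by
  have hM := hb.nonneg
  refine (norm_fderiv_flow_le hb t s x).trans (le_trans ?_ (le_max_left _ _))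
  gcongr
  exact abs_sub_le_of_mem_Icc ht hs

theorem sobolev_flowDensity (hT : 0 ≤ T) (hb : IsFlowField M T b) {t s : ℝ} (ht : t ∈ Icc 0 T)
    (hs : s ∈ Icc 0 T) {p : ℝ≥0∞} (hp : 1 ≤ p) {mbar : Euc n → ℝ} (hm : MemSobolevW 2 p mbar) :
    MemSobolevW 2 p (flowDensity hb t mbar s) ∧ eSobolevNorm p 2 (flowDensity hb t mbar s)
      ≤ ENNReal.ofReal (transportBound n M T) * eSobolevNorm p 2 mbar := by
  have hM := hb.nonneg
  refine memSobolevW_of_forall_sobolevTwoLE hm fun a g r hgr => ?_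
  have hw := hasLipschitzDeriv_inv_jacobianDet hT hb ht hs
  have hw1 : HasWeakFDeriv volume _ _ := hasWeakFDeriv_of_contDiff (μ := volume) hw.contDiff
  have hw2 : HasWeakFDeriv volume _ _ := hw.lipschitzWith.hasWeakFDeriv (μ := volume)
  obtain ⟨q, hq⟩ := hgr.bilin hp (ContinuousLinearMap.opNorm_mul_le ℝ ℝ) hw1 hw2
    (K := weightBound n M T)
    (fun x => by
      rw [Real.norm_eq_abs, abs_of_pos (inv_pos.2 (jacobianDet_flow_pos hb ht s x))]
      exact (inv_jacobianDet_flow_le hb ht hs x).trans (le_max_left _ _))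
    (fun x => (hw.bound x).trans (le_max_right _ _))
    (fun x => (hw.norm_fderiv_fderiv_le x).trans (le_max_right _ _))
  have hc : volume.map (flowHomeo hb s t) ≤ ENNReal.ofReal (Real.exp (n * M * T)) • volume :=
    map_flow_le hb ht hs
  obtain ⟨g', r', h'⟩ := hq.comp_homeomorph hp hc
    (ENNReal.one_le_ofReal.2 (Real.one_le_exp (by positivity))) ENNReal.ofReal_ne_top
    (contDiff_flow hb s t) (e := flowBound M T)
    ((Real.one_le_exp (by positivity)).trans (le_max_left _ _))
    (norm_fderiv_flow_le_flowBound hb hs ht)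
    (fun x => (norm_fderiv_fderiv_flow_le hT hb hs ht x).trans (le_max_right _ _))
  have e1 : (fun x => ContinuousLinearMap.mul ℝ ℝ (mbar (flowHomeo hb s t x))
      (jacobianDet (flow hb t s) (flowHomeo hb s t x))⁻¹) = flowDensity hb t mbar s := rfl
  have hF : 0 ≤ flowBound M T := (Real.exp_pos _).le.trans (le_max_left _ _)
  have hW : 0 ≤ weightBound n M T := (Real.exp_pos _).le.trans (le_max_left _ _)
  have e2 : 2 * (ENNReal.ofReal (flowBound M T) * (ENNReal.ofReal (flowBound M T)
      * (ENNReal.ofReal (Real.exp (n * M * T)) * (4 * (ENNReal.ofReal (weightBound n M T) * a)))))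
      = ENNReal.ofReal (transportBound n M T) * a := by
    rw [transportBound, ENNReal.ofReal_mul (by norm_num), ENNReal.ofReal_mul hF,
      ENNReal.ofReal_mul hF, ENNReal.ofReal_mul (Real.exp_pos _).le,
      ENNReal.ofReal_mul (by norm_num), ENNReal.ofReal_ofNat, ENNReal.ofReal_ofNat]
    ring
  rw [e1, e2] at h'
  exact ⟨g', r', h'⟩

end Transport

/-! ### Admissible controls -/

section Control

variable {n : ℕ} {M T : ℝ} {b α : ℝ → Euc n → Euc n}

theorem integrable_mul_fderiv (hb : IsFlowField M T b) {t : ℝ} {w : ℝ × Euc n → ℝ}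
    (hw : ∀ K : Set (Euc n), IsCompact K → IntegrableOn w (Ioo t T ×ˢ K) volume)
    {φ : ℝ × Euc n → ℝ} (hφ : ContDiff ℝ ∞ φ) (hφc : HasCompactSupport φ) :
    Integrable (fun z => w z * fderiv ℝ φ z (1, b z.1 z.2)) (slab n t T) := by
  have hK : IsCompact (Prod.snd '' tsupport φ) := hφc.isCompact.image continuous_snd
  obtain ⟨C, hC⟩ := (hφ.continuous_fderiv (by simp)).bounded_above_of_compact_support
    (hφc.fderiv ℝ)
  have hm : StronglyMeasurable fun z : ℝ × Euc n => fderiv ℝ φ z (1, b z.1 z.2) :=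
    stronglyMeasurable_clm_apply (hφ.continuous_fderiv (by simp)).stronglyMeasurable
      (stronglyMeasurable_const.prodMk hb.lip0.uncurry_meas)
  have h1 := ((integrableOn_slab_iff hK.measurableSet w).1 (hw _ hK)).bdd_mul
    hm.aestronglyMeasurable (c := C * (1 + M)) (Eventually.of_forall fun z =>
      ContinuousLinearMap.le_of_opNorm_le_of_le _ (hC z) (norm_one_prod_le hb _ _))
  refine h1.congr (Eventually.of_forall fun z => ?_)
  by_cases hz : z ∈ tsupport φ
  · have hz' : z ∈ (univ : Set ℝ) ×ˢ (Prod.snd '' tsupport φ) := ⟨mem_univ _, z, hz, rfl⟩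
    simp only [indicator_of_mem hz', mul_comm]
  · have h2 : φ =ᶠ[𝓝 z] 0 := notMem_tsupport_iff_eventuallyEq.1 hz
    have h3 : fderiv ℝ φ z = 0 := by rw [h2.fderiv_eq]; simp
    simp only [h3, zero_apply, zero_mul, mul_zero]

theorem ae_eq_of_ae_restrict_Icc (hα : ∀ᵐ s ∂(volume.restrict (Icc 0 T)), α s = b s) :
    ∀ᵐ s : ℝ, s ∈ Icc 0 T → α s = b s :=
  (ae_restrict_iff' measurableSet_Icc).1 hα

theorem ae_slab_eq (hα : ∀ᵐ s ∂(volume.restrict (Icc 0 T)), α s = b s) {t : ℝ}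
    (ht : t ∈ Icc 0 T) : ∀ᵐ z ∂(slab n t T), α z.1 = b z.1 :=
  Measure.quasiMeasurePreserving_fst.ae
    (ae_restrict_of_ae_restrict_of_subset (Ioo_subset_Icc_zero ht) hα)

theorem setIntegral_mul_fderiv_eq (hα : ∀ᵐ s ∂(volume.restrict (Icc 0 T)), α s = b s) {t : ℝ}
    (ht : t ∈ Icc 0 T) (u : ℝ → Euc n → ℝ) (φ : ℝ × Euc n → ℝ) :
    ∫ z in Ioo t T ×ˢ (univ : Set (Euc n)), u z.1 z.2 * fderiv ℝ φ z (1, α z.1 z.2)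
      = ∫ z, u z.1 z.2 * fderiv ℝ φ z (1, b z.1 z.2) ∂(slab n t T) := by
  rw [slab_eq]
  refine integral_congr_ae ?_
  filter_upwards [ae_slab_eq hα ht] with z hz
  rw [hz]

theorem isFlow_flow (hb : IsFlowField M T b)
    (hα : ∀ᵐ s ∂(volume.restrict (Icc 0 T)), α s = b s) : IsFlow T α (flow hb) := by
  intro t ht x
  have h0 := ae_eq_of_ae_restrict_Icc hα
  have hsub : ∀ s ∈ Icc t T, uIoc t s ⊆ Icc 0 T := fun s hs τ hτ => by
    rw [uIoc_of_le hs.1] at hτ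
    exact ⟨ht.1.trans hτ.1.le, hτ.2.trans hs.2⟩
  have h1 : ∀ s ∈ Icc t T, ∀ᵐ τ : ℝ, τ ∈ uIoc t s →
      b τ (flow hb t τ x) = α τ (flow hb t τ x) := fun s hs => by
    filter_upwards [h0] with τ hτ hτs
    rw [hτ (hsub s hs hτs)]
  refine ⟨((flow_integrable hb t x).intervalIntegrable (a := t) (b := T)).congr_ae ?_,
    fun s hs => ?_⟩
  · exact (ae_restrict_iff' measurableSet_uIoc).2 (h1 T ⟨ht.2.le, le_rfl⟩)
  · rw [← intervalIntegral.integral_congr_ae (h1 s hs)]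
    exact flow_eq hb t s x

theorem isFlow_unique (hb : IsFlowField M T b)
    (hα : ∀ᵐ s ∂(volume.restrict (Icc 0 T)), α s = b s) {Φ' : ℝ → ℝ → Euc n → Euc n}
    (hΦ : IsFlow T α Φ') {t s : ℝ} (ht : t ∈ Ico 0 T) (hs : s ∈ Icc t T) :
    Φ' t s = flow hb t s := by
  funext x
  obtain ⟨hi, he⟩ := hΦ t ht x
  have h0 := ae_eq_of_ae_restrict_Icc hα
  have hcont : ContinuousOn (fun τ => Φ' t τ x) (Icc t T) := by
    have h1 : ContinuousOn (fun s => x + ∫ τ in t..s, α τ (Φ' t τ x)) (Icc t T) := by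
      refine continuousOn_const.add ?_
      have := intervalIntegral.continuousOn_primitive_interval' hi left_mem_uIcc
      rwa [uIcc_of_le ht.2.le] at this
    exact h1.congr he
  have hv : ContinuousOn (fun τ => ‖Φ' t τ x - flow hb t τ x‖) (Icc t T) :=
    (hcont.sub (continuous_flow_time hb t x).continuousOn).norm
  have hle : ∀ s ∈ Icc t T, ‖Φ' t s x - flow hb t s x‖
      ≤ 0 + M * ∫ τ in t..s, ‖Φ' t τ x - flow hb t τ x‖ := by
    intro s hs
    have hsub : Icc t s ⊆ Icc t T := Icc_subset_Icc le_rfl hs.2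
    have hi1 : IntervalIntegrable (fun τ => α τ (Φ' t τ x)) volume t s :=
      hi.mono_set (by rw [uIcc_of_le hs.1, uIcc_of_le ht.2.le]; exact hsub)
    have hi2 : IntervalIntegrable (fun τ => b τ (flow hb t τ x)) volume t s :=
      (flow_integrable hb t x).intervalIntegrable
    have hi3 : IntervalIntegrable (fun τ => M * ‖Φ' t τ x - flow hb t τ x‖) volume t s :=
      ((hv.mono hsub).const_smul M).intervalIntegrable_of_Icc hs.1
    rw [he s hs, flow_eq hb t s x, add_sub_add_left_eq_sub, ← intervalIntegral.integral_sub hi1 hi2,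
      zero_add, ← intervalIntegral.integral_const_mul]
    refine intervalIntegral.norm_integral_le_of_norm_le hs.1 ?_ hi3
    filter_upwards [h0] with τ hτ hτs
    rw [hτ ⟨ht.1.trans hτs.1.le, hτs.2.trans hs.2⟩]
    exact hb.lip0.lip τ _ _
  have h2 := le_exp_of_le_add_integral_Icc hb.nonneg hv hle s hs
  rw [zero_mul] at h2
  exact sub_eq_zero.1 (norm_le_zero_iff.1 h2)

theorem isDistributionalSolution_flowDensity (hb : IsFlowField M T b)
    (hα : ∀ᵐ s ∂(volume.restrict (Icc 0 T)), α s = b s) {t : ℝ} (ht : t ∈ Ico 0 T)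
    {mbar : Euc n → ℝ} (hm : LocallyIntegrable mbar volume) :
    IsDistributionalSolution T α t mbar (flowDensity hb t mbar) where
  locInt _ hK := integrableOn_flowDensity (ht.1.trans ht.2.le) hb (Ico_subset_Icc_self ht) hm hK
  weak_eq φ hφ hφc hφT := by
    rw [setIntegral_mul_fderiv_eq hα (Ico_subset_Icc_self ht)]
    exact weak_eq_flowDensity (ht.1.trans ht.2.le) hb (Ico_subset_Icc_self ht) hm hφ hφc hφT

theorem isDistributionalSolution_unique (hb : IsFlowField M T b)
    (hα : ∀ᵐ s ∂(volume.restrict (Icc 0 T)), α s = b s) {t : ℝ} (ht : t ∈ Ico 0 T)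
    {mbar : Euc n → ℝ} {u v : ℝ → Euc n → ℝ} (hu : IsDistributionalSolution T α t mbar u)
    (hv : IsDistributionalSolution T α t mbar v) :
    ∀ᵐ z : ℝ × Euc n ∂(volume.restrict (Ioo t T ×ˢ univ)), u z.1 z.2 = v z.1 z.2 := by
  have ht' := Ico_subset_Icc_self ht
  have h := weak_solution_eq_zero hb ht (w := fun z => u z.1 z.2 - v z.1 z.2)
    (fun K hK => (hu.locInt K hK).sub (hv.locInt K hK)) fun φ hφ hφc hφT => by
      have h1 := hu.weak_eq φ hφ hφc hφT
      have h2 := hv.weak_eq φ hφ hφc hφT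
      rw [setIntegral_mul_fderiv_eq hα ht'] at h1 h2
      simp only [sub_mul]
      rw [integral_sub (integrable_mul_fderiv hb hu.locInt hφ hφc)
        (integrable_mul_fderiv hb hv.locInt hφ hφc)]
      linarith
  rw [slab_eq]
  filter_upwards [h] with z hz
  exact sub_eq_zero.1 hz

end Control

theorem mainTheorem8 (n : ℕ) (M T : ℝ) (hM : 0 < M) (hT : 0 < T) :
    ∃ C : ℝ, 0 < C ∧ ∀ α : ℝ → Euc n → Euc n, IsAdmissibleControl M T α →
      ∃ Φ Ψ : ℝ → ℝ → Euc n → Euc n,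
        -- `Φ` is the unique flow of `α`, and `Ψ t s` is the inverse of `Φ t s`
        IsFlow T α Φ ∧
        (∀ Φ' : ℝ → ℝ → Euc n → Euc n, IsFlow T α Φ' →
          ∀ t ∈ Ico 0 T, ∀ s ∈ Icc t T, Φ' t s = Φ t s) ∧
        (∀ t ∈ Ico 0 T, ∀ s ∈ Icc t T,
          Function.LeftInverse (Ψ t s) (Φ t s) ∧ Function.RightInverse (Ψ t s) (Φ t s)) ∧
        -- time regularity of the flow and of its inverse
        (∀ t ∈ Ico 0 T, ∀ s₁ ∈ Icc t T, ∀ s₂ ∈ Icc t T, ∀ x : Euc n,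
          ‖Φ t s₁ x - Φ t s₂ x‖ ≤ M * |s₁ - s₂| ∧
          ‖Ψ t s₁ x - Ψ t s₂ x‖ ≤ M * Real.exp (M * T) * |s₁ - s₂|) ∧
        -- spatial regularity of the flow, of its inverse and of the Jacobian determinant
        (∀ t ∈ Ico 0 T, ∀ s ∈ Icc t T,
          ContDiff ℝ 2 (Φ t s) ∧ ContDiff ℝ 2 (Ψ t s) ∧
          (∀ x : Euc n,
            ‖fderiv ℝ (Φ t s) x‖ ≤ Real.exp (M * (s - t)) ∧
            ‖fderiv ℝ (Ψ t s) x‖ ≤ Real.exp (M * (s - t)) ∧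
            ‖fderiv ℝ (fderiv ℝ (Φ t s)) x‖ ≤ C ∧
            ‖fderiv ℝ (fderiv ℝ (Ψ t s)) x‖ ≤ C ∧
            Real.exp (-(n * M * (s - t))) ≤ jacobianDet (Φ t s) x ∧
            jacobianDet (Φ t s) x ≤ Real.exp (n * M * (s - t))) ∧
          HasBoundedDerivsTwo C (jacobianDet (Φ t s)) ∧
          HasBoundedDerivsTwo C (fun x => (jacobianDet (Φ t s) x)⁻¹)) ∧
        -- the transported density is the unique distributional solution
        (∀ t ∈ Ico 0 T, ∀ mbar : Euc n → ℝ, LocallyIntegrable mbar volume →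
          IsDistributionalSolution T α t mbar (transportedDensity Φ Ψ t mbar) ∧
          ∀ u : ℝ → Euc n → ℝ, IsDistributionalSolution T α t mbar u →
            ∀ᵐ z : ℝ × Euc n ∂(volume.restrict (Ioo t T ×ˢ univ)),
              u z.1 z.2 = transportedDensity Φ Ψ t mbar z.1 z.2) ∧
        -- the `W^{2,∞}` and the `H²` estimates for the solution
        (∀ t ∈ Ico 0 T, ∀ mbar : Euc n → ℝ, ∀ p : ENNReal, p = ⊤ ∨ p = 2 →
          MemSobolevW 2 p mbar → ∀ s ∈ Icc t T,
            MemSobolevW 2 p (transportedDensity Φ Ψ t mbar s) ∧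
            eSobolevNorm p 2 (transportedDensity Φ Ψ t mbar s)
              ≤ ENNReal.ofReal C * eSobolevNorm p 2 mbar) := by
  refine ⟨max (flowBound M T) (max (jacobianBound n M T) (transportBound n M T)),
    lt_max_of_lt_left (lt_max_of_lt_left (Real.exp_pos _)), fun α hαadm => ?_⟩
  obtain ⟨b, hb, hα⟩ := hαadm.exists_flowField hM.le
  have hflow : flowBound M T
      ≤ max (flowBound M T) (max (jacobianBound n M T) (transportBound n M T)) := le_max_left _ _
  have hjac : jacobianBound n M T
      ≤ max (flowBound M T) (max (jacobianBound n M T) (transportBound n M T)) :=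
    (le_max_left _ _).trans (le_max_right _ _)
  have htrans : transportBound n M T
      ≤ max (flowBound M T) (max (jacobianBound n M T) (transportBound n M T)) :=
    (le_max_right _ _).trans (le_max_right _ _)
  generalize max (flowBound M T) (max (jacobianBound n M T) (transportBound n M T)) = C at *
  have hmem : ∀ t ∈ Ico 0 T, ∀ s ∈ Icc t T, s ∈ Icc 0 T := fun t ht s hs =>
    ⟨ht.1.trans hs.1, hs.2⟩
  refine ⟨flow hb, fun t s => flow hb s t, isFlow_flow hb hα,
    fun Φ' hΦ' t ht s hs => isFlow_unique hb hα hΦ' ht hs,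
    fun t _ s _ => ⟨flow_inv hb t s, flow_inv hb s t⟩, fun t ht s₁ _ s₂ hs₂ x => ⟨?_, ?_⟩,
    fun t ht s hs => ?_, fun t ht mbar hm => ?_, fun t ht mbar p hp hm s hs => ?_⟩
  · exact norm_flow_sub_time_le hb t s₁ s₂ x
  · refine (norm_inv_flow_sub_time_le hb t s₁ s₂ x).trans ?_
    gcongr
    exact abs_sub_le_of_mem_Icc (Ico_subset_Icc_self ht) (hmem t ht s₂ hs₂)
  · have ht' := Ico_subset_Icc_self ht
    have hs' := hmem t ht s hs
    have hst : |s - t| = s - t := abs_of_nonneg (sub_nonneg.2 hs.1)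
    refine ⟨contDiff_flow hb t s, contDiff_flow hb s t, fun x => ⟨?_, ?_, ?_, ?_, ?_, ?_⟩,
      ((hasLipschitzDeriv_jacobianDet hT.le hb ht' hs').mono hjac).hasBoundedDerivsTwo,
      ((hasLipschitzDeriv_inv_jacobianDet hT.le hb ht' hs').mono hjac).hasBoundedDerivsTwo⟩
    · rw [← hst]; exact norm_fderiv_flow_le hb t s x
    · rw [← hst, abs_sub_comm]; exact norm_fderiv_flow_le hb s t x
    · exact (norm_fderiv_fderiv_flow_le hT.le hb ht' hs' x).trans ((le_max_right _ _).trans hflow)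
    · exact (norm_fderiv_fderiv_flow_le hT.le hb hs' ht' x).trans ((le_max_right _ _).trans hflow)
    · rw [jacobianDet_flow hb ht', ← hst]
      exact Real.exp_le_exp.2 (abs_le.1 (abs_logJacobian_euc_le hb t s x)).1
    · rw [jacobianDet_flow hb ht', ← hst]
      exact Real.exp_le_exp.2 (abs_le.1 (abs_logJacobian_euc_le hb t s x)).2
  · have hsol := isDistributionalSolution_flowDensity hb hα ht hm
    exact ⟨hsol, fun u hu => isDistributionalSolution_unique hb hα ht hu hsol⟩
  · have hp1 : 1 ≤ p := by rcases hp with rfl | rfl <;> norm_num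
    obtain ⟨h1, h2⟩ := sobolev_flowDensity hT.le hb (Ico_subset_Icc_self ht) (hmem t ht s hs) hp1 hm
    exact ⟨h1, h2.trans (mul_le_mul_left (ENNReal.ofReal_le_ofReal htrans) _)⟩
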